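/- For integers $u,k\ge 0$ consider a quantified Boolean formula $\phi=\forall y_1\cdots\forall y_u\,\exists x_1\cdots\exists x_k\,\psi(y_1,\dots,y_u,x_1,\dots,x_k)$, a $\forall\exists$-QBF, whose matrix $\psi$ is a propositional formula in conjunctive normal form; $k$ is the number of existential variables of $\phi$ and $|\phi|$ is its size (one plus the number of quantified variables, the number of clauses and the number of occurrences of literals, which is polynomially equivalent to the length of any standard encoding). The matrix is a $d$-CNF if each of its clauses contains at most $d$ literals. There is an algorithm (a Turing machine) that, given a $\forall\exists$-QBF $\phi$, decides whether $\phi$ is true or false and whose running time on formulas with a $d$-CNF matrix is $O\bigl(k^{O_d(k^{d-1})}\bigr)\cdot|\phi|^{O(1)}$. Precisely: there are a deterministic multi-stack Turing machine $M$ and constants $A,c\in\mathbb N$ such that for every integer $d\ge 1$ there is a constant $C_d\in\mathbb N$ such that, for every $\forall\exists$-QBF $\phi$ whose matrix is a $d$-CNF, $M$ on input $\phi$ halts within $$A\cdot \max(k,1)^{\,C_d\,k^{d-1}}\cdot|\phi|^{c}$$ steps and outputs whether $\phi$ is true (here $0^0=1$). -/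

import Mathlib

/-- A literal over universal variables `y_0, …, y_{u-1}` (`Sum.inl`) and existential variables
`x_0, …, x_{k-1}` (`Sum.inr`): a variable together with the value that makes the literal true
(`true` for the variable itself, `false` for its negation). -/
abbrev QLiteral (u k : ℕ) : Type := (Fin u ⊕ Fin k) × Bool

/-- A quantified Boolean formula `∀ y_0 … y_{u-1} ∃ x_0 … x_{k-1} ψ` with two quantifier blocks,
whose matrix `ψ` is in conjunctive normal form, given as a list of clauses, each of which is a
list of literals. -/
structure ForallExistsQBF where
  /-- the number of universally quantified variables -/
  u : ℕ
  /-- the number of existentially quantified variables -/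
  k : ℕ
  /-- the clauses of the matrix -/
  matrix : List (List (QLiteral u k))

namespace ForallExistsQBF

/-- The matrix of `φ` is satisfied by the assignment `y` to the universal and `x` to the
existential variables: every clause contains a true literal. -/
def Satisfies (φ : ForallExistsQBF) (y : Fin φ.u → Bool) (x : Fin φ.k → Bool) : Prop :=
  ∀ c ∈ φ.matrix, ∃ l ∈ c, Sum.elim y x l.1 = l.2

/-- The quantified formula `φ` evaluates to true. -/
def IsTrue (φ : ForallExistsQBF) : Prop :=
  ∀ y : Fin φ.u → Bool, ∃ x : Fin φ.k → Bool, φ.Satisfies y x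

/-- The matrix of `φ` is a `d`-CNF: every clause has at most `d` literals. -/
def IsCNF (φ : ForallExistsQBF) (d : ℕ) : Prop :=
  ∀ c ∈ φ.matrix, c.length ≤ d

/-- The size `|φ|`: one, plus the number of quantified variables, plus the number of clauses, plus
the number of occurrences of literals. The length of any standard encoding of `φ` is bounded
above and below by a polynomial in this number. -/
def size (φ : ForallExistsQBF) : ℕ :=
  1 + φ.u + φ.k + (φ.matrix.map fun c => c.length + 1).sum

end ForallExistsQBF

/-- The input alphabet of a machine that reads quantified Boolean formulas. -/
inductive QSymbol
  /-- the quantifier `∀`; in a literal it marks a universal variable -/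
  | all
  /-- the quantifier `∃`; in a literal it marks an existential variable -/
  | ex
  /-- the start of a positive literal -/
  | pos
  /-- the start of a negated literal -/
  | neg
  /-- a digit of the index of a variable, written in unary -/
  | tick
  /-- the end of a clause -/
  | close
  deriving DecidableEq

instance : Fintype QSymbol where
  elems := {QSymbol.all, QSymbol.ex, QSymbol.pos, QSymbol.neg, QSymbol.tick, QSymbol.close}
  complete x := by cases x <;> simp

namespace ForallExistsQBF

/-- A variable, written as the kind of its quantifier followed by its index in unary. -/
def encodeVar {u k : ℕ} : Fin u ⊕ Fin k → List QSymbol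
  | Sum.inl i => QSymbol.all :: List.replicate i.val QSymbol.tick
  | Sum.inr j => QSymbol.ex :: List.replicate j.val QSymbol.tick

/-- A literal, written as its sign followed by its variable. -/
def encodeLiteral {u k : ℕ} (l : QLiteral u k) : List QSymbol :=
  (if l.2 = true then QSymbol.pos else QSymbol.neg) :: encodeVar l.1

/-- A clause, written as the sequence of its literals followed by an end marker. -/
def encodeClause {u k : ℕ} (c : List (QLiteral u k)) : List QSymbol :=
  c.flatMap encodeLiteral ++ [QSymbol.close]

/-- The word that represents `φ`: the quantifier prefix `∀ … ∀ ∃ … ∃`, then the clauses. -/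
def encode (φ : ForallExistsQBF) : List QSymbol :=
  List.replicate φ.u QSymbol.all ++ List.replicate φ.k QSymbol.ex ++ φ.matrix.flatMap encodeClause

end ForallExistsQBF

/-- The Turing machine `M` (Mathlib's `FinTM2`: finitely many stacks, labels and internal states),
started on the word that represents `φ`, halts after at most `t` steps, and its output is the
single bit `true` if `φ` is true, and the single bit `false` if `φ` is false. -/
def DecidesWithin (M : Turing.TM2ComputableAux QSymbol Bool) (φ : ForallExistsQBF) (t : ℕ) : Prop :=
  ∃ b : Bool, (b = true ↔ φ.IsTrue) ∧
    Nonempty (Turing.TM2OutputsInTime M.tm (φ.encode.map M.inputAlphabet.symm)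
      (some ([b].map M.outputAlphabet.symm)) t)

/-! ### Structured stack programs -/

/-! Suppose the universal assignment `y` refutes the formula, so that under `y` every `x` falsifies
some clause. Among clauses whose universal literals are false under `y`, only the existential part
decides which `x` falsify them, so one representative per existential part suffices. Clauses without
universal literals impose nothing on `y`; the others have at most `d - 1` existential literals,
which leaves at most `(2k+1)^(d-1)` parts. Hence `y` matters only on a set `V` of at most `T = d
(2k+1)^(d-1)` universal variables (`exists_support`).

Trying all such sets would cost about `|φ|^T`. Instead `V` is hashed: with `a` the bit length of the
length of the input word, some modulus `p = O(a T^2)` separates the indices in `V`. Otherwise all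
numbers up to a bound `2n` would divide the product of the differences, and so would the central
binomial coefficient of `n`, which exceeds that product (`exists_injOn_mod`). So `y` may be replaced
by an assignment that makes true the variables whose index modulo `p` lies in a list of `T` numbers
(`exists_residueAssignment`). These lists are the numbers below `Q^T` with `Q = O(a T^2)`, and each
is tested against all `2^k` assignments `x`. Since `a^T ≤ T^T 2^a` (`pow_le_pow_self_mul_two_pow`),
the logarithmic factor contributes only `T^T` times a polynomial, and for `k, d ≥ 2` everything fits
into `k^(O_d(k^(d-1)))` times a polynomial.

For `k ≤ 1` or unit clauses the search does not fit the bound, but then a polynomial test for two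
clashing clauses is complete (`clash_of_not_isTrue`). That test is always sound. The algorithm
combines both tests and starts the search only if `k` and the actual clause width are at least 2;
`d` itself is never needed.

To obtain an actual machine, the tests are written as expressions with bounded iteration over unary
numbers, compiled to stack programs and then to machine code. The running time is polynomial in the
largest value that occurs (`runs_compile`), so the analysis reduces to bounding values
(`exists_bound`). -/

/-- The stacks of the machine: the two halves of the input, the environment, the stack of values,
a stack for suspended data, a scratch stack and the output. -/
inductive Stk
  | inp | aux | env | val | hold | tmp | out
  deriving DecidableEq

instance : Fintype Stk where
  elems := {Stk.inp, Stk.aux, Stk.env, Stk.val, Stk.hold, Stk.tmp, Stk.out}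
  complete x := by cases x <;> simp

/-- The alphabet of each stack. -/
def StkSym : Stk → Type
  | Stk.inp => QSymbol
  | Stk.aux => QSymbol
  | Stk.env => QSymbol
  | Stk.val => QSymbol
  | Stk.hold => QSymbol
  | Stk.tmp => QSymbol
  | Stk.out => Bool

/-- The contents of all stacks. -/
abbrev Stacks : Type := ∀ k : Stk, List (StkSym k)

/-- Structured programs that act on the stacks and on a register for one symbol. -/
inductive Prog : Type
  | push (k : Stk) (f : Option QSymbol → StkSym k) : Prog
  | pop (k : Stk) (g : Option (StkSym k) → Option QSymbol) : Prog
  | seq (p q : Prog) : Prog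
  | ite (f : Option QSymbol → Bool) (p q : Prog) : Prog
  | loop (f : Option QSymbol → Bool) (p : Prog) : Prog

namespace Prog

/-- Execution of a program in exactly `t` steps. -/
inductive Exec : Prog → Option QSymbol → Stacks → ℕ → Option QSymbol → Stacks → Prop
  | push (k : Stk) (f : Option QSymbol → StkSym k) (s : Option QSymbol) (S : Stacks) :
      Exec (push k f) s S 1 s (Function.update S k (f s :: S k))
  | pop (k : Stk) (g : Option (StkSym k) → Option QSymbol) (s : Option QSymbol) (S : Stacks) :
      Exec (pop k g) s S 1 (g (S k).head?) (Function.update S k (S k).tail)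
  | seq {p q : Prog} {s₁ s₂ s₃ : Option QSymbol} {S₁ S₂ S₃ : Stacks} {t₁ t₂ : ℕ} :
      Exec p s₁ S₁ t₁ s₂ S₂ → Exec q s₂ S₂ t₂ s₃ S₃ → Exec (seq p q) s₁ S₁ (t₁ + t₂) s₃ S₃
  | ite_true {f : Option QSymbol → Bool} {p q : Prog} {s s' : Option QSymbol} {S S' : Stacks}
      {t : ℕ} : f s = true → Exec p s S t s' S' → Exec (ite f p q) s S (1 + t) s' S'
  | ite_false {f : Option QSymbol → Bool} {p q : Prog} {s s' : Option QSymbol} {S S' : Stacks}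
      {t : ℕ} : f s = false → Exec q s S t s' S' → Exec (ite f p q) s S (1 + t) s' S'
  | loop_done {f : Option QSymbol → Bool} {p : Prog} {s : Option QSymbol} {S : Stacks} :
      f s = false → Exec (loop f p) s S 1 s S
  | loop_step {f : Option QSymbol → Bool} {p : Prog} {s₁ s₂ s₃ : Option QSymbol}
      {S₁ S₂ S₃ : Stacks} {t₁ t₂ : ℕ} : f s₁ = true → Exec p s₁ S₁ t₁ s₂ S₂ →
      Exec (loop f p) s₂ S₂ t₂ s₃ S₃ → Exec (loop f p) s₁ S₁ (1 + t₁ + t₂) s₃ S₃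

/-- The control points of a program. -/
def Label : Prog → Type
  | push _ _ => Unit
  | pop _ _ => Unit
  | seq p q => Label p ⊕ Label q
  | ite _ p q => Option (Label p ⊕ Label q)
  | loop _ p => Option (Label p)

/-- A program has finitely many control points. -/
theorem finite_label : ∀ p : Prog, Finite (Label p)
  | push _ _ => inferInstanceAs (Finite Unit)
  | pop _ _ => inferInstanceAs (Finite Unit)
  | seq p q => @Finite.instSum _ _ (finite_label p) (finite_label q)
  | ite _ p q =>
    have := finite_label p
    have := finite_label q
    inferInstanceAs (Finite (Option (Label p ⊕ Label q)))
  | loop _ p =>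
    have := finite_label p
    inferInstanceAs (Finite (Option (Label p)))

/-- The control point at which a program starts. -/
def entry : (p : Prog) → Label p
  | push _ _ => ()
  | pop _ _ => ()
  | seq p _ => Sum.inl (entry p)
  | ite _ _ _ => none
  | loop _ _ => none

open Turing.TM2 in
/-- The statements at the control points of a program that is embedded into a larger machine and
continues with the statement `ex`. -/
def code {Λ : Type} : (p : Prog) → (Label p → Λ) → Stmt StkSym Λ (Option QSymbol) → Label p →
    Stmt StkSym Λ (Option QSymbol)
  | push k f, _, ex => fun _ => Stmt.push k f ex
  | pop k g, _, ex => fun _ => Stmt.pop k (fun _ => g) ex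
  | seq p q, emb, ex => Sum.elim
      (code p (fun l => emb (Sum.inl l)) (Stmt.goto fun _ => emb (Sum.inr (entry q))))
      (code q (fun l => emb (Sum.inr l)) ex)
  | ite f p q, emb, ex => fun l => Option.elim l
      (Stmt.branch f (Stmt.goto fun _ => emb (some (Sum.inl (entry p))))
        (Stmt.goto fun _ => emb (some (Sum.inr (entry q)))))
      (Sum.elim (code p (fun l => emb (some (Sum.inl l))) ex)
        (code q (fun l => emb (some (Sum.inr l))) ex))
  | loop f p, emb, ex => fun l => Option.elim l
      (Stmt.branch f (Stmt.goto fun _ => emb (some (entry p))) ex)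
      (code p (fun l => emb (some l)) (Stmt.goto fun _ => emb none))

open Turing.TM2 in
/-- The machine code of a program simulates its execution, step for step. -/
theorem Exec.simulate {Λ : Type} {M : Λ → Stmt StkSym Λ (Option QSymbol)} {p : Prog}
    {s s' : Option QSymbol} {S S' : Stacks} {t : ℕ} (h : Exec p s S t s' S') :
    ∀ (emb : Label p → Λ) (ex : Stmt StkSym Λ (Option QSymbol)),
      (∀ l, M (emb l) = code p emb ex l) →
      (flip bind (step M))^[t] (some ⟨some (emb (entry p)), s, S⟩) = some (stepAux ex s' S') := by
  have one : ∀ (l : Λ) (s : Option QSymbol) (S : Stacks),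
      (flip bind (step M))^[1] (some ⟨some l, s, S⟩) = some (stepAux (M l) s S) := by
    intro l s S
    rfl
  -- Each subprogram is used with its own label embedding and its own continuation, so both stay
  -- universally quantified. The continuation is executed within the last step of the program, hence
  -- sequencing costs no extra step.
  induction h with
  | push k f s S =>
    intro emb ex hM
    rw [one, hM]
    simp [code]
  | pop k g s S =>
    intro emb ex hM
    rw [one, hM]
    simp [code]
  | seq _ _ ihp ihq =>
    intro emb ex hM
    rw [Nat.add_comm, Function.iterate_add_apply]
    have := ihp (fun l => emb (Sum.inl l)) _ (fun l => hM (Sum.inl l))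
    simp only [entry] at this ⊢
    rw [this]
    exact ihq (fun l => emb (Sum.inr l)) ex (fun l => hM (Sum.inr l))
  | ite_true hf _ ih =>
    intro emb ex hM
    rw [Nat.add_comm, Function.iterate_add_apply, one, hM]
    simp only [code, entry, Option.elim, stepAux, hf, cond_true]
    exact ih (fun l => emb (some (Sum.inl l))) ex (fun l => hM (some (Sum.inl l)))
  | ite_false hf _ ih =>
    intro emb ex hM
    rw [Nat.add_comm, Function.iterate_add_apply, one, hM]
    simp only [code, entry, Option.elim, stepAux, hf, cond_false]
    exact ih (fun l => emb (some (Sum.inr l))) ex (fun l => hM (some (Sum.inr l)))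
  | loop_done hf =>
    intro emb ex hM
    rw [one, hM]
    simp only [code, entry, Option.elim, stepAux, hf, cond_false]
  | loop_step hf _ _ ihp ihl =>
    intro emb ex hM
    rw [Nat.add_comm, Nat.add_comm 1, Function.iterate_add_apply, Function.iterate_add_apply, one,
      hM]
    simp only [code, entry, Option.elim, stepAux, hf, cond_true]
    have := ihp (fun l => emb (some l)) _ (fun l => hM (some l))
    rw [this]
    exact ihl emb ex hM

/-- The Turing machine that runs a program on its input stack and then halts. -/
noncomputable def machine (p : Prog) : Turing.TM2ComputableAux QSymbol Bool where
  tm :=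
    { K := Stk
      k₀ := Stk.inp
      k₁ := Stk.out
      Γ := StkSym
      Λ := Label p
      main := entry p
      ΛFin := @Fintype.ofFinite _ (finite_label p)
      Γk₀Fin := inferInstanceAs (Fintype QSymbol)
      σ := Option QSymbol
      initialState := none
      m := code p id Turing.TM2.Stmt.halt }
  inputAlphabet := Equiv.refl QSymbol
  outputAlphabet := Equiv.refl Bool

/-- Stack contents, stack by stack. -/
def mkStacks (i a e v h t : List QSymbol) (o : List Bool) : Stacks
  | Stk.inp => i
  | Stk.aux => a
  | Stk.env => e
  | Stk.val => v
  | Stk.hold => h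
  | Stk.tmp => t
  | Stk.out => o

theorem outputs_of_exec {p : Prog} {w : List QSymbol} {b : Bool} {t T : ℕ}
    (h : Exec p none (mkStacks w [] [] [] [] [] []) t none (mkStacks [] [] [] [] [] [] [b]))
    (hT : t ≤ T) :
    Nonempty (Turing.TM2OutputsInTime (machine p).tm (w.map (machine p).inputAlphabet.symm)
      (some ([b].map (machine p).outputAlphabet.symm)) T) := by
  refine ⟨⟨⟨t, ?_⟩, hT⟩⟩
  have := h.simulate (M := code p id Turing.TM2.Stmt.halt) id Turing.TM2.Stmt.halt (fun _ => rfl)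
  have hin : Turing.initList (machine p).tm (w.map (machine p).inputAlphabet.symm)
      = ⟨some (entry p), none, mkStacks w [] [] [] [] [] []⟩ := by
    have hw : w.map (machine p).inputAlphabet.symm = w := List.map_id w
    rw [hw]
    unfold Turing.initList
    congr 1
    funext k
    cases k <;> rfl
  have hout : Turing.haltList (machine p).tm ([b].map (machine p).outputAlphabet.symm)
      = ⟨none, none, mkStacks [] [] [] [] [] [] [b]⟩ := by
    unfold Turing.haltList
    congr 1
    funext k
    cases k <;> rfl
  rw [hin]
  simp only [Option.map_some]
  rw [hout]
  exact this

end Prog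

/-! ### Time-bounded execution and transport of unary numbers between stacks. -/

namespace Prog

/-- `p` transforms the stacks `S` into `S'` in at most `T` steps, whatever the register holds. -/
def Runs (p : Prog) (S : Stacks) (T : ℕ) (S' : Stacks) : Prop :=
  ∀ s, ∃ s', ∃ t ≤ T, Exec p s S t s' S'

theorem Runs.mono {p : Prog} {S S' : Stacks} {T T' : ℕ} (h : Runs p S T S') (hT : T ≤ T') :
    Runs p S T' S' := fun s =>
  let ⟨s', t, ht, hp⟩ := h s
  ⟨s', t, ht.trans hT, hp⟩

theorem Runs.seq {p q : Prog} {S₁ S₂ S₃ : Stacks} {T₁ T₂ : ℕ} (hp : Runs p S₁ T₁ S₂)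
    (hq : Runs q S₂ T₂ S₃) : Runs (Prog.seq p q) S₁ (T₁ + T₂) S₃ := fun s =>
  let ⟨s', _, ht, hp⟩ := hp s
  let ⟨s'', _, ht', hq⟩ := hq s'
  ⟨s'', _, add_le_add ht ht', hp.seq hq⟩

theorem Runs.push {k : Stk} {x : StkSym k} {S S' : Stacks}
    (h : Function.update S k (x :: S k) = S') : Runs (push k fun _ => x) S 1 S' := fun s =>
  ⟨s, 1, le_rfl, h ▸ Exec.push k (fun _ => x) s S⟩

/-- Repeatedly run `q`, and then `body` as long as the register satisfies `f`. -/
def drain (f : Option QSymbol → Bool) (q body : Prog) : Prog :=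
  seq q (loop f (seq body q))

/-- The index counts the rounds still to come: `G j` is the state before a pop, `G' j` and `r j` the
state and register after it. A round costs one test, one `q` and at most `c` steps of `body`; the
final `2` is the first `q` and the last test. -/
theorem Runs.drain {f : Option QSymbol → Bool} {q body : Prog} (G G' : ℕ → Stacks)
    (r : ℕ → Option QSymbol) {v c : ℕ} {S' : Stacks}
    (hr : ∀ j < v, f (r j) = true)
    (hq : ∀ j < v, ∀ s, Exec q s (G (j + 1)) 1 (r j) (G' j))
    (hb : ∀ j < v, ∃ s', ∃ t ≤ c, Exec body (r j) (G' j) t s' (G j))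
    (hend : ∀ s, ∃ s', f s' = false ∧ Exec q s (G 0) 1 s' S') :
    Runs (drain f q body) (G v) (v * (c + 2) + 2) S' := by
  intro s
  -- The loop runs `body` and then `q`, so the first `q` is split off; every round then starts just
  -- after a pop and the induction closes.
  suffices h : ∀ s, ∃ s₁ S₁ s', ∃ t ≤ v * (c + 2) + 1, Exec q s (G v) 1 s₁ S₁ ∧
      Exec (loop f (Prog.seq body q)) s₁ S₁ t s' S' by
    obtain ⟨s₁, S₁, s', t, ht, h₁, h₂⟩ := h s
    exact ⟨s', 1 + t, by omega, h₁.seq h₂⟩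
  induction v with
  | zero =>
    intro s
    obtain ⟨s', hf, he⟩ := hend s
    exact ⟨s', S', s', 1, by omega, he, .loop_done hf⟩
  | succ v ih =>
    intro s
    obtain ⟨s₂, t₂, ht₂, hb₂⟩ := hb v (by omega)
    obtain ⟨s₁, S₁, s', t, ht, h₁, h₂⟩ := ih (fun j hj => hr j (by omega))
      (fun j hj => hq j (by omega)) (fun j hj => hb j (by omega)) s₂
    refine ⟨r v, G' v, s', _, ?_, hq v (by omega) s, .loop_step (hr v (by omega)) (hb₂.seq h₁) h₂⟩
    rw [Nat.succ_mul]
    omega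

section Stacks
variable (i a e v h t : List QSymbol) (o : List Bool)

@[simp] theorem update_inp (x : List QSymbol) :
    Function.update (mkStacks i a e v h t o) Stk.inp x = mkStacks x a e v h t o := by
  funext k; cases k <;> rfl

@[simp] theorem update_aux (x : List QSymbol) :
    Function.update (mkStacks i a e v h t o) Stk.aux x = mkStacks i x e v h t o := by
  funext k; cases k <;> rfl

@[simp] theorem update_env (x : List QSymbol) :
    Function.update (mkStacks i a e v h t o) Stk.env x = mkStacks i a x v h t o := by
  funext k; cases k <;> rfl

@[simp] theorem update_val (x : List QSymbol) :
    Function.update (mkStacks i a e v h t o) Stk.val x = mkStacks i a e x h t o := by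
  funext k; cases k <;> rfl

@[simp] theorem update_hold (x : List QSymbol) :
    Function.update (mkStacks i a e v h t o) Stk.hold x = mkStacks i a e v x t o := by
  funext k; cases k <;> rfl

@[simp] theorem update_tmp (x : List QSymbol) :
    Function.update (mkStacks i a e v h t o) Stk.tmp x = mkStacks i a e v h x o := by
  funext k; cases k <;> rfl

@[simp] theorem update_out (x : List Bool) :
    Function.update (mkStacks i a e v h t o) Stk.out x = mkStacks i a e v h t x := by
  funext k; cases k <;> rfl

end Stacks

/-- Pop a symbol from the stack `inp` into the register. -/
def popInp : Prog := pop Stk.inp fun x => x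
/-- Pop a symbol from the stack `aux` into the register. -/
def popAux : Prog := pop Stk.aux fun x => x
/-- Pop a symbol from the stack `env` into the register. -/
def popEnv : Prog := pop Stk.env fun x => x
/-- Pop a symbol from the stack `val` into the register. -/
def popVal : Prog := pop Stk.val fun x => x
/-- Pop a symbol from the stack `hold` into the register. -/
def popHold : Prog := pop Stk.hold fun x => x
/-- Pop a symbol from the stack `tmp` into the register. -/
def popTmp : Prog := pop Stk.tmp fun x => x

section Pops
variable {s : Option QSymbol} {i a e v h t : List QSymbol} {o : List Bool}

theorem exec_popInp :
    Exec popInp s (mkStacks i a e v h t o) 1 i.head? (mkStacks i.tail a e v h t o) := by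
  exact (congrArg (Exec popInp s _ 1 i.head?) (update_inp ..)).mp
    (Exec.pop Stk.inp (fun x => x) s (mkStacks i a e v h t o))

theorem exec_popAux :
    Exec popAux s (mkStacks i a e v h t o) 1 a.head? (mkStacks i a.tail e v h t o) := by
  exact (congrArg (Exec popAux s _ 1 a.head?) (update_aux ..)).mp
    (Exec.pop Stk.aux (fun x => x) s (mkStacks i a e v h t o))

theorem exec_popEnv :
    Exec popEnv s (mkStacks i a e v h t o) 1 e.head? (mkStacks i a e.tail v h t o) := by
  exact (congrArg (Exec popEnv s _ 1 e.head?) (update_env ..)).mp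
    (Exec.pop Stk.env (fun x => x) s (mkStacks i a e v h t o))

theorem exec_popVal :
    Exec popVal s (mkStacks i a e v h t o) 1 v.head? (mkStacks i a e v.tail h t o) := by
  exact (congrArg (Exec popVal s _ 1 v.head?) (update_val ..)).mp
    (Exec.pop Stk.val (fun x => x) s (mkStacks i a e v h t o))

theorem exec_popHold :
    Exec popHold s (mkStacks i a e v h t o) 1 h.head? (mkStacks i a e v h.tail t o) := by
  exact (congrArg (Exec popHold s _ 1 h.head?) (update_hold ..)).mp
    (Exec.pop Stk.hold (fun x => x) s (mkStacks i a e v h t o))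

theorem exec_popTmp :
    Exec popTmp s (mkStacks i a e v h t o) 1 t.head? (mkStacks i a e v h t.tail o) := by
  exact (congrArg (Exec popTmp s _ 1 t.head?) (update_tmp ..)).mp
    (Exec.pop Stk.tmp (fun x => x) s (mkStacks i a e v h t o))

theorem runs_pushEnv (x : QSymbol) : Runs (push Stk.env fun _ => x) (mkStacks i a e v h t o) 1
    (mkStacks i a (x :: e) v h t o) := Runs.push (update_env ..)

theorem runs_pushVal (x : QSymbol) : Runs (push Stk.val fun _ => x) (mkStacks i a e v h t o) 1
    (mkStacks i a e (x :: v) h t o) := Runs.push (update_val ..)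

theorem runs_pushHold (x : QSymbol) : Runs (push Stk.hold fun _ => x) (mkStacks i a e v h t o) 1
    (mkStacks i a e v (x :: h) t o) := Runs.push (update_hold ..)

theorem runs_pushTmp (x : QSymbol) : Runs (push Stk.tmp fun _ => x) (mkStacks i a e v h t o) 1
    (mkStacks i a e v h (x :: t) o) := Runs.push (update_tmp ..)

theorem exec_pushAux (x : QSymbol) : Exec (push Stk.aux fun s => s.getD QSymbol.tick) (some x)
    (mkStacks i a e v h t o) 1 (some x) (mkStacks i (x :: a) e v h t o) := by
  exact (congrArg (Exec _ (some x) _ 1 (some x)) (update_aux ..)).mp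
    (Exec.push Stk.aux (fun s => s.getD QSymbol.tick) (some x) (mkStacks i a e v h t o))

theorem exec_pushInp (x : QSymbol) : Exec (push Stk.inp fun s => s.getD QSymbol.tick) (some x)
    (mkStacks i a e v h t o) 1 (some x) (mkStacks (x :: i) a e v h t o) := by
  exact (congrArg (Exec _ (some x) _ 1 (some x)) (update_inp ..)).mp
    (Exec.push Stk.inp (fun s => s.getD QSymbol.tick) (some x) (mkStacks i a e v h t o))

end Pops

/-- A list of numbers in unary, each followed by an end marker. -/
def blocks : List ℕ → List QSymbol
  | [] => []
  | n :: l => List.replicate n QSymbol.tick ++ QSymbol.close :: blocks l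

@[simp] theorem blocks_zero (l : List ℕ) : blocks (0 :: l) = QSymbol.close :: blocks l := rfl

theorem blocks_succ (n : ℕ) (l : List ℕ) : blocks ((n + 1) :: l) = QSymbol.tick :: blocks (n :: l) := by
  simp [blocks, List.replicate_succ]

@[simp] theorem head_blocks_succ (n : ℕ) (l : List ℕ) :
    (blocks ((n + 1) :: l)).head? = some QSymbol.tick := by simp [blocks_succ]

@[simp] theorem tail_blocks_succ (n : ℕ) (l : List ℕ) :
    (blocks ((n + 1) :: l)).tail = blocks (n :: l) := by simp [blocks_succ]

/-- The register holds a tick. -/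
def isTick (s : Option QSymbol) : Bool := decide (s = some QSymbol.tick)

/-- Move a number from the values to the environment. -/
def moveValEnv : Prog :=
  seq (push Stk.env fun _ => QSymbol.close) (drain isTick popVal (push Stk.env fun _ => QSymbol.tick))

/-- Move a number from the values to the suspended data. -/
def moveValHold : Prog :=
  seq (push Stk.hold fun _ => QSymbol.close)
    (drain isTick popVal (push Stk.hold fun _ => QSymbol.tick))

/-- Move a number from the environment to the suspended data. -/
def moveEnvHold : Prog :=
  seq (push Stk.hold fun _ => QSymbol.close)
    (drain isTick popEnv (push Stk.hold fun _ => QSymbol.tick))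

/-- Move a number from the suspended data to the environment. -/
def moveHoldEnv : Prog :=
  seq (push Stk.env fun _ => QSymbol.close)
    (drain isTick popHold (push Stk.env fun _ => QSymbol.tick))

/-- A program that does nothing. -/
def skip : Prog := loop (fun _ => false) popTmp

theorem runs_skip (S : Stacks) : Runs skip S 1 S := fun s => ⟨s, 1, le_rfl, .loop_done rfl⟩

/-- Drop a number from the environment. -/
def dropEnv : Prog := drain isTick popEnv skip

/-- Copy the topmost number of the environment to the values. -/
def copyEnvVal : Prog :=
  seq (push Stk.val fun _ => QSymbol.close)
    (seq (drain isTick popEnv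
      (seq (push Stk.val fun _ => QSymbol.tick) (push Stk.tmp fun _ => QSymbol.tick)))
    (seq (push Stk.env fun _ => QSymbol.close)
      (drain isTick popTmp (push Stk.env fun _ => QSymbol.tick))))

section Moves
variable {w a : List QSymbol} {x : ℕ} {ρ vs hs : List ℕ} {e v h t : List QSymbol} {o : List Bool}

/-- Invariant: with `j` ticks left on the source, the new block has `x - j`. The end marker is
pushed first because the block is built from the bottom. The other moves follow the same pattern. -/
theorem runs_moveValEnv : Runs moveValEnv (mkStacks w a (blocks ρ) (blocks (x :: vs)) h t o)
    (3 * x + 3) (mkStacks w a (blocks (x :: ρ)) (blocks vs) h t o) := by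
  have key := Runs.drain (f := isTick) (q := popVal)
      (body := push Stk.env fun _ => QSymbol.tick)
      (fun j => mkStacks w a (blocks ((x - j) :: ρ)) (blocks (j :: vs)) h t o)
      (fun j => mkStacks w a (blocks ((x - (j + 1)) :: ρ)) (blocks (j :: vs)) h t o)
      (fun _ => some QSymbol.tick) (v := x) (c := 1)
      (S' := mkStacks w a (blocks (x :: ρ)) (blocks vs) h t o) (fun _ _ => rfl)
      (fun j hj s => by simpa using exec_popVal (v := blocks ((j + 1) :: vs)))
      (fun j hj => by
        have := runs_pushEnv (i := w) (a := a) (e := blocks ((x - (j + 1)) :: ρ))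
          (v := blocks (j :: vs)) (h := h) (t := t) (o := o) QSymbol.tick
        rw [← blocks_succ, show x - (j + 1) + 1 = x - j by omega] at this
        exact this _)
      (fun s => ⟨some QSymbol.close, rfl, by simpa using exec_popVal (v := blocks (0 :: vs))⟩)
  simp only [Nat.sub_self, blocks_zero] at key
  exact ((runs_pushEnv _).seq key).mono (by omega)

theorem runs_moveValHold : Runs moveValHold (mkStacks w a e (blocks (x :: vs)) (blocks hs) t o)
    (3 * x + 3) (mkStacks w a e (blocks vs) (blocks (x :: hs)) t o) := by
  have key := Runs.drain (f := isTick) (q := popVal)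
      (body := push Stk.hold fun _ => QSymbol.tick)
      (fun j => mkStacks w a e (blocks (j :: vs)) (blocks ((x - j) :: hs)) t o)
      (fun j => mkStacks w a e (blocks (j :: vs)) (blocks ((x - (j + 1)) :: hs)) t o)
      (fun _ => some QSymbol.tick) (v := x) (c := 1)
      (S' := mkStacks w a e (blocks vs) (blocks (x :: hs)) t o) (fun _ _ => rfl)
      (fun j hj s => by simpa using exec_popVal (v := blocks ((j + 1) :: vs)))
      (fun j hj => by
        have := runs_pushHold (i := w) (a := a) (e := e) (h := blocks ((x - (j + 1)) :: hs))
          (v := blocks (j :: vs)) (t := t) (o := o) QSymbol.tick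
        rw [← blocks_succ, show x - (j + 1) + 1 = x - j by omega] at this
        exact this _)
      (fun s => ⟨some QSymbol.close, rfl, by simpa using exec_popVal (v := blocks (0 :: vs))⟩)
  simp only [Nat.sub_self, blocks_zero] at key
  exact ((runs_pushHold _).seq key).mono (by omega)

theorem runs_moveEnvHold : Runs moveEnvHold (mkStacks w a (blocks (x :: ρ)) v (blocks hs) t o)
    (3 * x + 3) (mkStacks w a (blocks ρ) v (blocks (x :: hs)) t o) := by
  have key := Runs.drain (f := isTick) (q := popEnv)
      (body := push Stk.hold fun _ => QSymbol.tick)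
      (fun j => mkStacks w a (blocks (j :: ρ)) v (blocks ((x - j) :: hs)) t o)
      (fun j => mkStacks w a (blocks (j :: ρ)) v (blocks ((x - (j + 1)) :: hs)) t o)
      (fun _ => some QSymbol.tick) (v := x) (c := 1)
      (S' := mkStacks w a (blocks ρ) v (blocks (x :: hs)) t o) (fun _ _ => rfl)
      (fun j hj s => by simpa using exec_popEnv (e := blocks ((j + 1) :: ρ)))
      (fun j hj => by
        have := runs_pushHold (i := w) (a := a) (v := v) (h := blocks ((x - (j + 1)) :: hs))
          (e := blocks (j :: ρ)) (t := t) (o := o) QSymbol.tick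
        rw [← blocks_succ, show x - (j + 1) + 1 = x - j by omega] at this
        exact this _)
      (fun s => ⟨some QSymbol.close, rfl, by simpa using exec_popEnv (e := blocks (0 :: ρ))⟩)
  simp only [Nat.sub_self, blocks_zero] at key
  exact ((runs_pushHold _).seq key).mono (by omega)

theorem runs_moveHoldEnv : Runs moveHoldEnv (mkStacks w a (blocks ρ) v (blocks (x :: hs)) t o)
    (3 * x + 3) (mkStacks w a (blocks (x :: ρ)) v (blocks hs) t o) := by
  have key := Runs.drain (f := isTick) (q := popHold)
      (body := push Stk.env fun _ => QSymbol.tick)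
      (fun j => mkStacks w a (blocks ((x - j) :: ρ)) v (blocks (j :: hs)) t o)
      (fun j => mkStacks w a (blocks ((x - (j + 1)) :: ρ)) v (blocks (j :: hs)) t o)
      (fun _ => some QSymbol.tick) (v := x) (c := 1)
      (S' := mkStacks w a (blocks (x :: ρ)) v (blocks hs) t o) (fun _ _ => rfl)
      (fun j hj s => by simpa using exec_popHold (h := blocks ((j + 1) :: hs)))
      (fun j hj => by
        have := runs_pushEnv (i := w) (a := a) (v := v) (e := blocks ((x - (j + 1)) :: ρ))
          (h := blocks (j :: hs)) (t := t) (o := o) QSymbol.tick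
        rw [← blocks_succ, show x - (j + 1) + 1 = x - j by omega] at this
        exact this _)
      (fun s => ⟨some QSymbol.close, rfl, by simpa using exec_popHold (h := blocks (0 :: hs))⟩)
  simp only [Nat.sub_self, blocks_zero] at key
  exact ((runs_pushEnv _).seq key).mono (by omega)

theorem runs_dropEnv : Runs dropEnv (mkStacks w a (blocks (x :: ρ)) v h t o)
    (3 * x + 2) (mkStacks w a (blocks ρ) v h t o) := by
  have := Runs.drain (f := isTick) (q := popEnv) (body := skip)
      (fun j => mkStacks w a (blocks (j :: ρ)) v h t o)
      (fun j => mkStacks w a (blocks (j :: ρ)) v h t o)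
      (fun _ => some QSymbol.tick) (v := x) (c := 1)
      (S' := mkStacks w a (blocks ρ) v h t o) (fun _ _ => rfl)
      (fun j hj s => by simpa using exec_popEnv (e := blocks ((j + 1) :: ρ)))
      (fun j hj => runs_skip _ _)
      (fun s => ⟨some QSymbol.close, rfl, by simpa using exec_popEnv (e := blocks (0 :: ρ))⟩)
  exact this.mono (by omega)

/-- Reading destroys the source, so the ticks are also parked on `tmp` and then restored. They carry
no end marker there: the second loop stops at the bottom of `tmp`, which must therefore start empty.
-/
theorem runs_copyEnvVal : Runs copyEnvVal (mkStacks w a (blocks (x :: ρ)) (blocks vs) h [] o)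
    (7 * x + 6) (mkStacks w a (blocks (x :: ρ)) (blocks (x :: vs)) h [] o) := by
  have h₁ := Runs.drain (f := isTick) (q := popEnv)
      (body := seq (push Stk.val fun _ => QSymbol.tick) (push Stk.tmp fun _ => QSymbol.tick))
      (fun j => mkStacks w a (blocks (j :: ρ)) (blocks ((x - j) :: vs)) h
        (List.replicate (x - j) QSymbol.tick) o)
      (fun j => mkStacks w a (blocks (j :: ρ)) (blocks ((x - (j + 1)) :: vs)) h
        (List.replicate (x - (j + 1)) QSymbol.tick) o)
      (fun _ => some QSymbol.tick) (v := x) (c := 2)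
      (S' := mkStacks w a (blocks ρ) (blocks (x :: vs)) h (List.replicate x QSymbol.tick) o)
      (fun _ _ => rfl)
      (fun j hj s => by simpa using exec_popEnv (e := blocks ((j + 1) :: ρ)))
      (fun j hj => by
        have := (runs_pushVal (i := w) (a := a) (v := blocks ((x - (j + 1)) :: vs))
          (e := blocks (j :: ρ)) (h := h) (t := List.replicate (x - (j + 1)) QSymbol.tick) (o := o)
          QSymbol.tick).seq (runs_pushTmp QSymbol.tick)
        rw [← blocks_succ, ← List.replicate_succ, show x - (j + 1) + 1 = x - j by omega] at this
        exact this _)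
      (fun s => ⟨some QSymbol.close, rfl, by simpa using exec_popEnv (e := blocks (0 :: ρ))⟩)
  have h₂ := Runs.drain (f := isTick) (q := popTmp) (body := push Stk.env fun _ => QSymbol.tick)
      (fun j => mkStacks w a (blocks ((x - j) :: ρ)) (blocks (x :: vs)) h
        (List.replicate j QSymbol.tick) o)
      (fun j => mkStacks w a (blocks ((x - (j + 1)) :: ρ)) (blocks (x :: vs)) h
        (List.replicate j QSymbol.tick) o)
      (fun _ => some QSymbol.tick) (v := x) (c := 1)
      (S' := mkStacks w a (blocks (x :: ρ)) (blocks (x :: vs)) h [] o)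
      (fun _ _ => rfl)
      (fun j hj s => by
        simpa [List.replicate_succ] using exec_popTmp (t := List.replicate (j + 1) QSymbol.tick))
      (fun j hj => by
        have := runs_pushEnv (i := w) (a := a) (v := blocks (x :: vs))
          (e := blocks ((x - (j + 1)) :: ρ)) (h := h) (t := List.replicate j QSymbol.tick) (o := o)
          QSymbol.tick
        rw [← blocks_succ, show x - (j + 1) + 1 = x - j by omega] at this
        exact this _)
      (fun s => ⟨none, rfl, by simpa using exec_popTmp (t := [])⟩)
  simp only [Nat.sub_self, blocks_zero, List.replicate_zero] at h₁ h₂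
  exact ((runs_pushVal _).seq (h₁.seq ((runs_pushEnv _).seq h₂))).mono (by omega)

/-- The register holds a symbol. -/
def isSome (s : Option QSymbol) : Bool := Option.isSome s

/-- Move the auxiliary stack back to the input. -/
def rewindInput : Prog := drain isSome popAux (push Stk.inp fun s => s.getD QSymbol.tick)

/-- The stacks `inp` and `aux` are the two sides of a reading head, with the symbols already passed
reversed on `aux`; `j` counts those still to be moved back. -/
theorem runs_rewindInput : Runs rewindInput (mkStacks w a e v h t o) (3 * a.length + 2)
    (mkStacks (a.reverse ++ w) [] e v h t o) := by
  have key := Runs.drain (f := isSome) (q := popAux)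
      (body := push Stk.inp fun s => s.getD QSymbol.tick)
      (fun j => mkStacks ((a.take (a.length - j)).reverse ++ w) (a.drop (a.length - j)) e v h t o)
      (fun j => mkStacks ((a.take (a.length - (j + 1))).reverse ++ w) (a.drop (a.length - j))
        e v h t o)
      (fun j => a[a.length - (j + 1)]?) (v := a.length) (c := 1)
      (S' := mkStacks (a.reverse ++ w) [] e v h t o)
      (fun j hj => by
        have : a.length - (j + 1) < a.length := by omega
        simp [isSome, this])
      (fun j hj s => by
        have := exec_popAux (s := s) (i := (a.take (a.length - (j + 1))).reverse ++ w)
          (a := a.drop (a.length - (j + 1))) (e := e) (v := v) (h := h) (t := t) (o := o)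
        rwa [List.head?_drop, List.tail_drop, show a.length - (j + 1) + 1 = a.length - j by omega]
          at this)
      (fun j hj => by
        have hl : a.length - (j + 1) < a.length := by omega
        rw [List.getElem?_eq_getElem hl]
        have := exec_pushInp (i := (a.take (a.length - (j + 1))).reverse ++ w)
          (a := a.drop (a.length - j)) (e := e) (v := v) (h := h) (t := t) (o := o)
          a[a.length - (j + 1)]
        have h2 : (a.take (a.length - j)).reverse
            = a[a.length - (j + 1)] :: (a.take (a.length - (j + 1))).reverse := by
          rw [show a.length - j = a.length - (j + 1) + 1 by omega, List.take_add_one,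
            List.getElem?_eq_getElem hl]
          simp
        rw [h2, List.cons_append]
        exact ⟨_, 1, le_rfl, this⟩)
      (fun s => ⟨none, rfl, by
        simpa using exec_popAux (s := s) (i := a.reverse ++ w) (a := []) (e := e) (v := v) (h := h)
          (t := t) (o := o)⟩)
  simp only [Nat.sub_self, List.take_zero, List.drop_zero, List.reverse_nil, List.nil_append] at key
  exact key.mono (by omega)

/-- Push the length of the input onto the values. -/
def pushLength : Prog :=
  seq (push Stk.val fun _ => QSymbol.close)
    (seq (drain isSome popInp (seq (push Stk.aux fun s => s.getD QSymbol.tick)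
      (push Stk.val fun _ => QSymbol.tick))) rewindInput)

theorem runs_pushLength : Runs pushLength (mkStacks w [] e (blocks vs) h t o) (7 * w.length + 5)
    (mkStacks w [] e (blocks (w.length :: vs)) h t o) := by
  have key := Runs.drain (f := isSome) (q := popInp)
      (body := seq (push Stk.aux fun s => s.getD QSymbol.tick)
        (push Stk.val fun _ => QSymbol.tick))
      (fun j => mkStacks (w.drop (w.length - j)) (w.take (w.length - j)).reverse e
        (blocks ((w.length - j) :: vs)) h t o)
      (fun j => mkStacks (w.drop (w.length - j)) (w.take (w.length - (j + 1))).reverse e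
        (blocks ((w.length - (j + 1)) :: vs)) h t o)
      (fun j => w[w.length - (j + 1)]?) (v := w.length) (c := 2)
      (S' := mkStacks [] w.reverse e (blocks (w.length :: vs)) h t o)
      (fun j hj => by
        have : w.length - (j + 1) < w.length := by omega
        simp [isSome, this])
      (fun j hj s => by
        have := exec_popInp (s := s) (a := (w.take (w.length - (j + 1))).reverse)
          (i := w.drop (w.length - (j + 1))) (e := e) (v := blocks ((w.length - (j + 1)) :: vs))
          (h := h) (t := t) (o := o)
        rwa [List.head?_drop, List.tail_drop, show w.length - (j + 1) + 1 = w.length - j by omega]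
          at this)
      (fun j hj => by
        have hl : w.length - (j + 1) < w.length := by omega
        rw [List.getElem?_eq_getElem hl]
        have h1 := exec_pushAux (a := (w.take (w.length - (j + 1))).reverse)
          (i := w.drop (w.length - j)) (e := e) (v := blocks ((w.length - (j + 1)) :: vs))
          (h := h) (t := t) (o := o) w[w.length - (j + 1)]
        have h2 : (w.take (w.length - j)).reverse
            = w[w.length - (j + 1)] :: (w.take (w.length - (j + 1))).reverse := by
          rw [show w.length - j = w.length - (j + 1) + 1 by omega, List.take_add_one,
            List.getElem?_eq_getElem hl]
          simp
        rw [← h2] at h1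
        obtain ⟨s', t', ht', h3⟩ := runs_pushVal (i := w.drop (w.length - j))
          (a := (w.take (w.length - j)).reverse) (v := blocks ((w.length - (j + 1)) :: vs)) (e := e)
          (h := h) (t := t) (o := o) QSymbol.tick (some w[w.length - (j + 1)])
        rw [← blocks_succ, show w.length - (j + 1) + 1 = w.length - j by omega] at h3
        exact ⟨_, _, by omega, h1.seq h3⟩)
      (fun s => ⟨none, rfl, by
        simpa using exec_popInp (s := s) (a := w.reverse) (i := []) (e := e)
          (v := blocks (w.length :: vs)) (h := h) (t := t) (o := o)⟩)
  simp only [Nat.sub_self, List.take_zero, List.drop_zero, List.reverse_nil, blocks_zero] at key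
  have h2 := runs_rewindInput (w := []) (a := w.reverse) (e := e) (v := blocks (w.length :: vs))
    (h := h) (t := t) (o := o)
  simp only [List.reverse_reverse, List.append_nil, List.length_reverse] at h2
  exact ((runs_pushVal _).seq (key.seq h2)).mono (by omega)

end Moves

end Prog

/-! ### Random access to the input word. -/

namespace Prog

/-- Move one symbol, if there is one, from the input to the auxiliary stack. -/
def shiftInput : Prog :=
  seq popInp (ite isSome (push Stk.aux fun s => s.getD QSymbol.tick) skip)

/-- Beyond the end of the word `take` and `drop` are stationary, so moving nothing still matches the
formula and no bound on `j` is needed. -/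
theorem runs_shiftInput {w : List QSymbol} {j : ℕ} {e v h t : List QSymbol} {o : List Bool} :
    Runs shiftInput (mkStacks (w.drop j) (w.take j).reverse e v h t o) 3
      (mkStacks (w.drop (j + 1)) (w.take (j + 1)).reverse e v h t o) := by
  intro s
  have hp := exec_popInp (s := s) (i := w.drop j) (a := (w.take j).reverse) (e := e) (v := v)
    (h := h) (t := t) (o := o)
  rw [List.head?_drop, List.tail_drop] at hp
  by_cases hj : j < w.length
  · have h2 := exec_pushAux (i := w.drop (j + 1)) (a := (w.take j).reverse) (e := e) (v := v)
      (h := h) (t := t) (o := o) w[j]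
    have h3 : (w.take (j + 1)).reverse = w[j] :: (w.take j).reverse := by
      rw [List.take_add_one, List.getElem?_eq_getElem hj]
      simp
    rw [h3]
    rw [List.getElem?_eq_getElem hj] at hp
    exact ⟨_, _, le_rfl, hp.seq (.ite_true rfl h2)⟩
  · rw [List.getElem?_eq_none (by omega)] at hp
    obtain ⟨s', t', ht', h2⟩ := runs_skip
      (mkStacks (w.drop (j + 1)) (w.take j).reverse e v h t o) none
    rw [show w.take (j + 1) = w.take j by
      rw [List.take_of_length_le (by omega), List.take_of_length_le (by omega)]]
    exact ⟨_, _, by omega, hp.seq (.ite_false rfl h2)⟩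

/-- Replace the number `x` on top of the values by `1` if the `x`-th symbol of the input is `c`,
and by `0` otherwise. -/
def testSymbol (c : QSymbol) : Prog :=
  seq (drain isTick popVal shiftInput)
    (seq (seq popInp
      (seq (ite (fun s => decide (s = some c))
          (seq (push Stk.val fun _ => QSymbol.close) (push Stk.val fun _ => QSymbol.tick))
          (push Stk.val fun _ => QSymbol.close))
        (ite isSome (push Stk.inp fun s => s.getD QSymbol.tick) skip)))
      rewindInput)

theorem runs_testSymbol {c : QSymbol} {w : List QSymbol} {x : ℕ} {vs : List ℕ}
    {e h t : List QSymbol} {o : List Bool} :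
    Runs (testSymbol c) (mkStacks w [] e (blocks (x :: vs)) h t o) (5 * x + 3 * w.length + 12)
      (mkStacks w [] e (blocks ((if w[x]? = some c then 1 else 0) :: vs)) h t o) := by
  have h₁ := Runs.drain (f := isTick) (q := popVal) (body := shiftInput)
      (fun j => mkStacks (w.drop (x - j)) (w.take (x - j)).reverse e (blocks (j :: vs)) h t o)
      (fun j => mkStacks (w.drop (x - (j + 1))) (w.take (x - (j + 1))).reverse e
        (blocks (j :: vs)) h t o)
      (fun _ => some QSymbol.tick) (v := x) (c := 3)
      (S' := mkStacks (w.drop x) (w.take x).reverse e (blocks vs) h t o) (fun _ _ => rfl)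
      (fun j hj s => by simpa using exec_popVal (v := blocks ((j + 1) :: vs)))
      (fun j hj => by
        have := runs_shiftInput (w := w) (j := x - (j + 1)) (e := e) (v := blocks (j :: vs))
          (h := h) (t := t) (o := o)
        rw [show x - (j + 1) + 1 = x - j by omega] at this
        exact this _)
      (fun s => ⟨some QSymbol.close, rfl, by simpa using exec_popVal (v := blocks (0 :: vs))⟩)
  simp only [Nat.sub_self, List.take_zero, List.drop_zero, List.reverse_nil] at h₁
  have h₂ : Runs (seq popInp
      (seq (ite (fun s => decide (s = some c))
          (seq (push Stk.val fun _ => QSymbol.close) (push Stk.val fun _ => QSymbol.tick))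
          (push Stk.val fun _ => QSymbol.close))
        (ite isSome (push Stk.inp fun s => s.getD QSymbol.tick) skip)))
      (mkStacks (w.drop x) (w.take x).reverse e (blocks vs) h t o) 6
      (mkStacks (w.drop x) (w.take x).reverse e
        (blocks ((if w[x]? = some c then 1 else 0) :: vs)) h t o) := by
    intro s
    have hp := exec_popInp (s := s) (i := w.drop x) (a := (w.take x).reverse) (e := e)
      (v := blocks vs) (h := h) (t := t) (o := o)
    -- The register must survive these pushes, because the symbol it holds is put back afterwards;
    -- `Runs` would forget it.
    have hpush : ∀ (y : QSymbol) (r : Option QSymbol) (i v : List QSymbol),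
        Exec (push Stk.val fun _ => y) r (mkStacks i (w.take x).reverse e v h t o) 1 r
          (mkStacks i (w.take x).reverse e (y :: v) h t o) := fun y r i v =>
      (congrArg (Exec _ r _ 1 r) (update_val ..)).mp (Exec.push Stk.val (fun _ => y) r _)
    rw [List.head?_drop, List.tail_drop] at hp
    have hput : ∃ t' ≤ 3, Exec (ite (fun s => decide (s = some c))
          (seq (push Stk.val fun _ => QSymbol.close) (push Stk.val fun _ => QSymbol.tick))
          (push Stk.val fun _ => QSymbol.close)) w[x]?
          (mkStacks (w.drop (x + 1)) (w.take x).reverse e (blocks vs) h t o) t' w[x]?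
          (mkStacks (w.drop (x + 1)) (w.take x).reverse e
            (blocks ((if w[x]? = some c then 1 else 0) :: vs)) h t o) := by
      by_cases hc : w[x]? = some c
      · refine ⟨3, le_rfl, ?_⟩
        rw [if_pos hc]
        exact .ite_true (by simpa using hc) ((hpush _ _ _ _).seq (hpush _ _ _ _))
      · refine ⟨2, by omega, ?_⟩
        rw [if_neg hc]
        exact .ite_false (by simpa using hc) (hpush _ _ _ _)
    obtain ⟨t₁, ht₁, hput⟩ := hput
    by_cases hx : x < w.length
    · have hi := exec_pushInp (i := w.drop (x + 1)) (a := (w.take x).reverse) (e := e)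
        (v := blocks ((if w[x]? = some c then 1 else 0) :: vs)) (h := h) (t := t) (o := o) w[x]
      rw [← List.drop_eq_getElem_cons hx] at hi
      rw [← List.getElem?_eq_getElem hx] at hi
      refine ⟨_, _, ?_, hp.seq (hput.seq (.ite_true ?_ hi))⟩
      · omega
      · simp [isSome, hx]
    · obtain ⟨s', t', ht', hs⟩ := runs_skip
        (mkStacks (w.drop (x + 1)) (w.take x).reverse e
          (blocks ((if w[x]? = some c then 1 else 0) :: vs)) h t o) w[x]?
      -- Beyond the end the pop removed nothing, so nothing is to be restored.
      have hd : w.drop x = w.drop (x + 1) := by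
        rw [List.drop_of_length_le (by omega), List.drop_of_length_le (by omega)]
      rw [hd] at hp ⊢
      refine ⟨_, _, ?_, hp.seq (hput.seq (.ite_false ?_ hs))⟩
      · omega
      · simp [isSome]
        omega
  have h₃ := runs_rewindInput (w := w.drop x) (a := (w.take x).reverse) (e := e)
    (v := blocks ((if w[x]? = some c then 1 else 0) :: vs)) (h := h) (t := t) (o := o)
  rw [List.reverse_reverse, List.take_append_drop, List.length_reverse] at h₃
  refine (h₁.seq (h₂.seq h₃)).mono ?_
  have : (w.take x).length ≤ w.length := by simp
  omega

end Prog

/-! ### Arithmetic expressions over an input word -/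

/-- Expressions with `n` free variables that denote natural numbers. -/
inductive Expr : ℕ → Type
  | top {n : ℕ} : Expr (n + 1)
  | wk {n : ℕ} (e : Expr n) : Expr (n + 1)
  | zero {n : ℕ} : Expr n
  | succ {n : ℕ} (e : Expr n) : Expr n
  | pred {n : ℕ} (e : Expr n) : Expr n
  | isSym {n : ℕ} (c : QSymbol) (e : Expr n) : Expr n
  | len {n : ℕ} : Expr n
  | bind {n : ℕ} (a : Expr n) (b : Expr (n + 1)) : Expr n
  | fold {n : ℕ} (m z : Expr n) (b : Expr (n + 2)) : Expr n

/-- Iterate `f`, which also receives the number of the round, from the start value `z`. -/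
def iter (f : ℕ → ℕ → ℕ) (z : ℕ) : ℕ → ℕ
  | 0 => z
  | i + 1 => f (iter f z i) i

namespace Expr

/-- The value of an expression in an environment, on the input word `w`. -/
def eval (w : List QSymbol) : {n : ℕ} → Expr n → List ℕ → ℕ
  | _, top, ρ => ρ.headD 0
  | _, wk e, ρ => eval w e ρ.tail
  | _, zero, _ => 0
  | _, succ e, ρ => eval w e ρ + 1
  | _, pred e, ρ => eval w e ρ - 1
  | _, isSym c e, ρ => if w[eval w e ρ]? = some c then 1 else 0
  | _, len, _ => w.length
  | _, bind a b, ρ => eval w b (eval w a ρ :: ρ)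
  | _, fold m z b, ρ => iter (fun acc i => eval w b (acc :: i :: ρ)) (eval w z ρ) (eval w m ρ)

/-- All values that occur in the evaluation of an expression are at most `B`, if those in the
environment are. -/
def Bdd (w : List QSymbol) (B : ℕ) : {n : ℕ} → Expr n → List ℕ → Prop
  | _, top, _ => True
  | _, wk e, ρ => Bdd w B e ρ.tail
  | _, zero, _ => True
  | _, succ e, ρ => Bdd w B e ρ ∧ eval w e ρ + 1 ≤ B
  | _, pred e, ρ => Bdd w B e ρ
  | _, isSym _ e, ρ => Bdd w B e ρ
  | _, len, _ => True
  | _, bind a b, ρ => Bdd w B a ρ ∧ Bdd w B b (eval w a ρ :: ρ)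
  | _, fold m z b, ρ => Bdd w B m ρ ∧ Bdd w B z ρ ∧ ∀ i < eval w m ρ,
      Bdd w B b (iter (fun acc i => eval w b (acc :: i :: ρ)) (eval w z ρ) i :: i :: ρ)

/-- `Bdd` checks a size only at `succ`, the one node that increases a value. Every other value is at
most 1, the length of the word, a value of the environment, or bounded by that of a subexpression;
for `fold` this is applied to each accumulator in turn. -/
theorem Bdd.eval_le {w : List QSymbol} {B : ℕ} (hw : w.length ≤ B) (hB : 1 ≤ B) {n : ℕ}
    {e : Expr n} {ρ : List ℕ} (h : Bdd w B e ρ) (hρ : ∀ x ∈ ρ, x ≤ B) : eval w e ρ ≤ B := by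
  induction e generalizing ρ with
  | top =>
    cases ρ with
    | nil => simp [eval]
    | cons x ρ => simpa [eval] using hρ x (by simp)
  | wk e ih => exact ih (ρ := ρ.tail) h (fun x hx => hρ x (List.mem_of_mem_tail hx))
  | zero => exact Nat.zero_le _
  | succ e ih => exact h.2
  | pred e ih => exact (Nat.sub_le _ _).trans (ih h hρ)
  | isSym c e ih => simp only [eval]; split_ifs <;> omega
  | len => exact hw
  | bind a b iha ihb =>
    exact ihb h.2 (by simpa using ⟨iha h.1 hρ, hρ⟩)
  | fold m z b ihm ihz ihb =>
    obtain ⟨hm, hz, hb⟩ := h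
    have key : ∀ i ≤ eval w m ρ,
        iter (fun acc i => eval w b (acc :: i :: ρ)) (eval w z ρ) i ≤ B := by
      intro i hi
      induction i with
      | zero => exact ihz hz hρ
      | succ i ih =>
        refine ihb (hb i hi) ?_
        have h1 := ihm hm hρ
        have h2 := ih (by omega)
        simpa using ⟨h2, by omega, hρ⟩
    exact key _ le_rfl

open Prog in
/-- The program that pushes the value of an expression. -/
def compile : {n : ℕ} → Expr n → Prog
  | _, top => copyEnvVal
  | _, wk e => seq moveEnvHold (seq (compile e) moveHoldEnv)
  | _, zero => push Stk.val fun _ => QSymbol.close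
  | _, succ e => seq (compile e) (push Stk.val fun _ => QSymbol.tick)
  | _, pred e => seq (compile e)
      (seq popVal (ite isTick skip (push Stk.val fun _ => QSymbol.close)))
  | _, isSym c e => seq (compile e) (testSymbol c)
  | _, len => pushLength
  | _, bind a b => seq (compile a) (seq moveValEnv (seq (compile b) dropEnv))
  | _, fold m z b => seq (compile m) (seq moveValHold (seq (compile z)
      (seq (push Stk.env fun _ => QSymbol.close)
        (seq (drain isTick popHold (seq moveValEnv (seq (compile b)
          (seq dropEnv (push Stk.env fun _ => QSymbol.tick))))) dropEnv))))

/-- Running times add under sequencing; this keeps them in the form of a single power of `B + 2`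
whose exponent depends only on the expression. -/
theorem pow_add_pow_le {x : ℕ} (hx : 2 ≤ x) (a b : ℕ) : x ^ a + x ^ b ≤ x ^ (a + b + 1) := by
  have ha : x ^ a ≤ x ^ (a + b) := Nat.pow_le_pow_right (by omega) (by omega)
  have hb : x ^ b ≤ x ^ (a + b) := Nat.pow_le_pow_right (by omega) (by omega)
  calc x ^ a + x ^ b ≤ x ^ (a + b) * 2 := by omega
    _ ≤ x ^ (a + b) * x := Nat.mul_le_mul_left _ hx
    _ = x ^ (a + b + 1) := (pow_succ ..).symm

theorem linear_le_pow {B x : ℕ} (hx : x ≤ 16 * (B + 2)) : x ≤ (B + 2) ^ 5 := by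
  have : 2 ^ 4 ≤ (B + 2) ^ 4 := Nat.pow_le_pow_left (by omega) 4
  calc x ≤ 2 ^ 4 * (B + 2) := hx
    _ ≤ (B + 2) ^ 4 * (B + 2) := Nat.mul_le_mul_right _ this
    _ = (B + 2) ^ 5 := (pow_succ ..).symm

open Prog in
/-- Compiled expressions compute their values, in time polynomial in the largest value that
occurs. -/
theorem runs_compile {n : ℕ} (e : Expr n) : ∃ c, ∀ (w : List QSymbol) (B : ℕ) (ρ vs hs : List ℕ),
    w.length ≤ B → 1 ≤ B → ρ.length = n → (∀ x ∈ ρ, x ≤ B) → Bdd w B e ρ →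
    Runs (compile e) (mkStacks w [] (blocks ρ) (blocks vs) (blocks hs) [] []) ((B + 2) ^ c)
      (mkStacks w [] (blocks ρ) (blocks (eval w e ρ :: vs)) (blocks hs) [] []) := by
  induction e with
  | top =>
    refine ⟨5, fun w B ρ vs hs hw hB hn hρ _ => ?_⟩
    obtain ⟨x, ρ, rfl⟩ := List.exists_cons_of_length_eq_add_one hn
    have : x ≤ B := hρ x (by simp)
    exact runs_copyEnvVal.mono (linear_le_pow (by omega))
  | wk e ih =>
    obtain ⟨c, ih⟩ := ih
    refine ⟨5 + (c + 5 + 1) + 1, fun w B ρ vs hs hw hB hn hρ h => ?_⟩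
    obtain ⟨x, ρ, rfl⟩ := List.exists_cons_of_length_eq_add_one hn
    have hx : x ≤ B := hρ x (by simp)
    have h1 := ih w B ρ vs (x :: hs) hw hB (by simpa using hn) (fun y hy => hρ y (by simp [hy])) h
    refine ((runs_moveEnvHold.mono (linear_le_pow (B := B) (by omega))).seq
      (((h1.seq (runs_moveHoldEnv.mono (linear_le_pow (B := B) (by omega)))).mono
        (pow_add_pow_le (by omega) _ _)))).mono (pow_add_pow_le (by omega) _ _)
  | zero =>
    refine ⟨5, fun w B ρ vs hs hw hB hn hρ _ => ?_⟩
    exact (runs_pushVal _).mono (linear_le_pow (by omega))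
  | succ e ih =>
    obtain ⟨c, ih⟩ := ih
    refine ⟨c + 5 + 1, fun w B ρ vs hs hw hB hn hρ h => ?_⟩
    have h1 := ih w B ρ vs hs hw hB hn hρ h.1
    have h2 := (runs_pushVal (i := w) (a := []) (e := blocks ρ) (v := blocks (eval w e ρ :: vs))
      (h := blocks hs) (t := []) (o := []) QSymbol.tick).mono (linear_le_pow (B := B) (by omega))
    rw [← blocks_succ] at h2
    exact (h1.seq h2).mono (pow_add_pow_le (by omega) _ _)
  | pred e ih =>
    obtain ⟨c, ih⟩ := ih
    refine ⟨c + 5 + 1, fun w B ρ vs hs hw hB hn hρ h => ?_⟩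
    have h1 := ih w B ρ vs hs hw hB hn hρ h
    have h2 : Runs (Prog.seq popVal (Prog.ite isTick skip (push Stk.val fun _ => QSymbol.close)))
        (mkStacks w [] (blocks ρ) (blocks (eval w e ρ :: vs)) (blocks hs) [] []) 3
        (mkStacks w [] (blocks ρ) (blocks ((eval w e ρ - 1) :: vs)) (blocks hs) [] []) := by
      intro s
      have hp := exec_popVal (s := s) (i := w) (a := []) (e := blocks ρ)
        (v := blocks (eval w e ρ :: vs)) (h := blocks hs) (t := []) (o := [])
      rcases hv : eval w e ρ with _ | m
      · rw [hv] at hp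
        obtain ⟨s', t', ht', hs⟩ := runs_pushVal (i := w) (a := []) (e := blocks ρ) (v := blocks vs)
          (h := blocks hs) (t := []) (o := []) QSymbol.close (some QSymbol.close)
        exact ⟨_, _, by omega, hp.seq (.ite_false rfl hs)⟩
      · rw [hv, head_blocks_succ, tail_blocks_succ] at hp
        obtain ⟨s', t', ht', hs⟩ := runs_skip (mkStacks w [] (blocks ρ) (blocks (m :: vs))
          (blocks hs) [] []) (some QSymbol.tick)
        exact ⟨_, _, by omega, hp.seq (.ite_true rfl hs)⟩
    exact (h1.seq (h2.mono (linear_le_pow (B := B) (by omega)))).mono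
      (pow_add_pow_le (by omega) _ _)
  | isSym s e ih =>
    obtain ⟨c, ih⟩ := ih
    refine ⟨c + 5 + 1, fun w B ρ vs hs hw hB hn hρ h => ?_⟩
    have h1 := ih w B ρ vs hs hw hB hn hρ h
    have hv := Bdd.eval_le hw hB (e := e) h hρ
    exact (h1.seq (runs_testSymbol.mono (linear_le_pow (B := B) (by omega)))).mono
      (pow_add_pow_le (by omega) _ _)
  | len =>
    refine ⟨5, fun w B ρ vs hs hw hB hn hρ _ => ?_⟩
    exact runs_pushLength.mono (linear_le_pow (by omega))
  | bind a b iha ihb =>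
    obtain ⟨ca, iha⟩ := iha
    obtain ⟨cb, ihb⟩ := ihb
    refine ⟨ca + (5 + (cb + 5 + 1) + 1) + 1, fun w B ρ vs hs hw hB hn hρ h => ?_⟩
    have hv := Bdd.eval_le hw hB (e := a) h.1 hρ
    have h1 := iha w B ρ vs hs hw hB hn hρ h.1
    have h2 := ihb w B (eval w a ρ :: ρ) vs hs hw hB (by simpa using hn) (by simpa using ⟨hv, hρ⟩)
      h.2
    refine (h1.seq (((runs_moveValEnv.mono (linear_le_pow (B := B) (by omega))).seq
      ((h2.seq (runs_dropEnv.mono (linear_le_pow (B := B) (by omega)))).mono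
        (pow_add_pow_le (by omega) _ _))).mono (pow_add_pow_le (by omega) _ _))).mono
      (pow_add_pow_le (by omega) _ _)
  | fold m z b ihm ihz ihb =>
    obtain ⟨cm, ihm⟩ := ihm
    obtain ⟨cz, ihz⟩ := ihz
    obtain ⟨cb, ihb⟩ := ihb
    refine ⟨cm + (5 + (cz + (5 + ((1 + (5 + cb + 1) + 7) + 5 + 1) + 1) + 1) + 1) + 1,
      fun w B ρ vs hs hw hB hn hρ h => ?_⟩
    have hv := Bdd.eval_le hw hB (e := m) h.1 hρ
    have h1 := ihm w B ρ vs hs hw hB hn hρ h.1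
    have h2 := ihz w B ρ vs (eval w m ρ :: hs) hw hB hn hρ h.2.1
    obtain ⟨N, hN⟩ : ∃ N, N = eval w m ρ := ⟨_, rfl⟩
    obtain ⟨acc, hacc⟩ : ∃ acc, acc = iter (fun acc i => eval w b (acc :: i :: ρ)) (eval w z ρ) :=
      ⟨_, rfl⟩
    have hle : ∀ i ≤ N, acc i ≤ B := by
      intro i hi
      induction i with
      | zero => rw [hacc]; exact Bdd.eval_le hw hB (e := z) h.2.1 hρ
      | succ i ih =>
        have h3 := h.2.2 i (by omega)
        rw [← hacc] at h3
        have h4 := Bdd.eval_le hw hB h3 (by simpa using ⟨ih (by omega), by omega, hρ⟩)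
        rw [hacc] at h4 ⊢
        exact h4
    -- With `j` rounds to go, the environment carries the counter `N - j`, the values carry the
    -- accumulator, and the suspended data carry `j`. A round places the accumulator above the
    -- counter, evaluates `b`, drops the old accumulator and adds a tick to the counter.
    have hloop := Runs.drain (f := isTick) (q := popHold)
      (body := (Prog.seq moveValEnv (Prog.seq (compile b)
          (Prog.seq dropEnv (push Stk.env fun _ => QSymbol.tick)))))
      (fun j => mkStacks w [] (blocks ((N - j) :: ρ)) (blocks (acc (N - j) :: vs))
        (blocks (j :: hs)) [] [])
      (fun j => mkStacks w [] (blocks ((N - (j + 1)) :: ρ)) (blocks (acc (N - (j + 1)) :: vs))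
        (blocks (j :: hs)) [] [])
      (fun _ => some QSymbol.tick) (v := N) (c := (B + 2) ^ (5 + cb + 1))
      (S' := mkStacks w [] (blocks (N :: ρ)) (blocks (acc N :: vs)) (blocks hs) [] [])
      (fun _ _ => rfl)
      (fun j hj s => by simpa using exec_popHold (h := blocks ((j + 1) :: hs)))
      (fun j hj => by
        obtain ⟨i, hi⟩ : ∃ i, i = N - (j + 1) := ⟨_, rfl⟩
        rw [← hi, show N - j = i + 1 by omega]
        have hai : acc i ≤ B := hle i (by omega)
        have hbd := h.2.2 i (by omega)
        rw [← hacc] at hbd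
        have hb := ihb w B (acc i :: i :: ρ) vs (j :: hs) hw hB (by simpa using hn)
          (by simpa using ⟨hai, by omega, hρ⟩) hbd
        rw [show eval w b (acc i :: i :: ρ) = acc (i + 1) by rw [hacc]; rfl] at hb
        have hp := runs_pushEnv (i := w) (a := []) (e := blocks (i :: ρ))
          (v := blocks (acc (i + 1) :: vs)) (h := blocks (j :: hs)) (t := []) (o := [])
          QSymbol.tick
        rw [← blocks_succ] at hp
        refine (runs_moveValEnv.seq (hb.seq (runs_dropEnv.seq hp))).mono ?_ _
        have h5 := linear_le_pow (B := B) (x := 3 * acc i + 3 + (3 * acc i + 2 + 1)) (by omega)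
        have h6 := pow_add_pow_le (x := B + 2) (by omega) 5 cb
        omega)
      (fun s => ⟨some QSymbol.close, rfl, by simpa using exec_popHold (h := blocks (0 :: hs))⟩)
    simp only [Nat.sub_self] at hloop
    -- At most `B` rounds cost one more factor `B + 2`; the summand `7` leaves room for the
    -- lower-order terms.
    have hloop := hloop.mono (T' := (B + 2) ^ (1 + (5 + cb + 1) + 7)) (by
      have e1 : (B + 2) ^ (5 + cb + 1) + 2 ≤ (B + 2) ^ (5 + cb + 1 + 1 + 1) := by
        have := pow_add_pow_le (x := B + 2) (by omega) (5 + cb + 1) 1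
        rw [pow_one] at this
        omega
      have e2 : N * ((B + 2) ^ (5 + cb + 1) + 2) ≤ (B + 2) * (B + 2) ^ (5 + cb + 1 + 1 + 1) :=
        Nat.mul_le_mul (by omega) e1
      rw [← pow_succ'] at e2
      have e3 := pow_add_pow_le (x := B + 2) (by omega) (5 + cb + 1 + 1 + 1 + 1) 1
      rw [pow_one] at e3
      have e4 : (B + 2) ^ (5 + cb + 1 + 1 + 1 + 1 + 1 + 1) ≤ (B + 2) ^ (1 + (5 + cb + 1) + 7) :=
        Nat.pow_le_pow_right (by omega) (by omega)
      omega)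
    rw [show acc 0 = eval w z ρ by rw [hacc]; rfl] at hloop
    rw [← hN] at h1 h2
    have hres : eval w (fold m z b) ρ = acc N := by rw [hacc, hN]; rfl
    rw [hres]
    refine (h1.seq (((runs_moveValHold.mono (linear_le_pow (B := B) (by omega))).seq
      ((h2.seq ((((runs_pushEnv _).mono (linear_le_pow (B := B) (by omega))).seq
        ((hloop.seq (runs_dropEnv.mono (linear_le_pow (B := B) (by omega)))).mono
          (pow_add_pow_le (by omega) _ _))).mono
        (pow_add_pow_le (by omega) _ _))).mono (pow_add_pow_le (by omega) _ _))).mono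
        (pow_add_pow_le (by omega) _ _))).mono (pow_add_pow_le (by omega) _ _)

open Prog in
/-- The program that decides whether the value of a closed expression is zero. -/
def decider (e : Expr 0) : Prog :=
  seq (seq (compile e) (drain isSome popInp skip))
    (seq popVal (ite isTick
      (seq (seq popVal (push Stk.out fun _ => false)) popTmp)
      (seq (push Stk.out fun _ => true) popTmp)))

open Prog in
-- A halting configuration must have all stacks but the output empty and the register reset. Hence
-- the input is drained, the block of the value is removed (this uses that the value is at most 1),
-- and the last pop from the empty `tmp` clears the register.
theorem exec_decider (e : Expr 0) : ∃ c, ∀ (w : List QSymbol) (B : ℕ), w.length ≤ B → 1 ≤ B →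
    Bdd w B e [] → eval w e [] ≤ 1 → ∃ t ≤ (B + 2) ^ c,
      Exec (decider e) none (mkStacks w [] [] [] [] [] []) t none
        (mkStacks [] [] [] [] [] [] [decide (eval w e [] = 0)]) := by
  obtain ⟨c, hc⟩ := runs_compile e
  refine ⟨c + 5 + 1, fun w B hw hB hbdd hle => ?_⟩
  have h1 := hc w B [] [] [] hw hB rfl (by simp) hbdd
  have h2 := Runs.drain (f := isSome) (q := popInp) (body := skip)
    (fun j => mkStacks (w.drop (w.length - j)) [] [] (blocks [eval w e []]) [] [] [])
    (fun j => mkStacks (w.drop (w.length - j)) [] [] (blocks [eval w e []]) [] [] [])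
    (fun j => w[w.length - (j + 1)]?) (v := w.length) (c := 1)
    (S' := mkStacks [] [] [] (blocks [eval w e []]) [] [] [])
    (fun j hj => by
      have : w.length - (j + 1) < w.length := by omega
      simp [isSome, this])
    (fun j hj s => by
      have := exec_popInp (s := s) (a := []) (i := w.drop (w.length - (j + 1))) (e := [])
        (v := blocks [eval w e []]) (h := []) (t := []) (o := [])
      rwa [List.head?_drop, List.tail_drop, show w.length - (j + 1) + 1 = w.length - j by omega]
        at this)
    (fun j hj => runs_skip _ _)
    (fun s => ⟨none, rfl, by
      simpa using exec_popInp (s := s) (a := []) (i := []) (e := []) (v := blocks [eval w e []])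
        (h := []) (t := []) (o := [])⟩)
  simp only [Nat.sub_self, List.drop_zero] at h2
  obtain ⟨s, t, ht, h3⟩ := (h1.seq h2) none
  have hpush : ∀ (b : Bool) (r : Option QSymbol),
      Exec (push Stk.out fun _ => b) r (mkStacks [] [] [] [] [] [] []) 1 r
        (mkStacks [] [] [] [] [] [] [b]) := fun b r =>
    (congrArg (Exec _ r _ 1 r) (update_out ..)).mp (Exec.push Stk.out (fun _ => b) r _)
  have hp := exec_popVal (s := s) (i := []) (a := []) (e := [])
    (v := blocks [eval w e []]) (h := []) (t := []) (o := [])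
  have ht5 := linear_le_pow (B := B) (x := w.length * (1 + 2) + 2 + 6) (by omega)
  have hpw := pow_add_pow_le (x := B + 2) (by omega) c 5
  obtain hv | hv : eval w e [] = 0 ∨ eval w e [] = 1 := by omega
  · rw [hv] at h3 hp ⊢
    refine ⟨_, ?_, h3.seq (hp.seq (.ite_false rfl ((hpush true _).seq exec_popTmp)))⟩
    omega
  · rw [hv] at h3 hp ⊢
    refine ⟨_, ?_, h3.seq (hp.seq (.ite_true rfl
      ((exec_popVal.seq (hpush false _)).seq exec_popTmp)))⟩
    omega

end Expr

/-! ### Logic, arithmetic and bounded quantifiers as expressions. -/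

namespace Expr

variable {n : ℕ}

/-- The truth value of an expression: every number but `0` is true. -/
def Holds (w : List QSymbol) (e : Expr n) (ρ : List ℕ) : Prop := eval w e ρ ≠ 0

/-- The constant `1`. -/
def one : Expr n := succ zero
/-- The constant `2`. -/
def two : Expr n := succ one
/-- The truth value of an expression, as `0` or `1`. -/
def sg (a : Expr n) : Expr n := fold a zero one
/-- Negation. -/
def not (a : Expr n) : Expr n := fold a one zero
/-- Conjunction; the second expression is evaluated only if the first is true. -/
def and (a b : Expr n) : Expr n := fold (sg a) zero (wk (wk (sg b)))
/-- Disjunction. -/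
def or (a b : Expr n) : Expr n := not (and (not a) (not b))
/-- Addition. -/
def add (a b : Expr n) : Expr n := fold b a (succ top)
/-- Truncated subtraction. -/
def sub (a b : Expr n) : Expr n := fold b a (pred top)
/-- Multiplication. -/
def mul (a b : Expr n) : Expr n := fold a zero (add top (wk (wk b)))
/-- Exponentiation. -/
def pow (a b : Expr n) : Expr n := fold b one (mul top (wk (wk a)))
/-- The order of the natural numbers. -/
def le (a b : Expr n) : Expr n := not (sub a b)
/-- Equality. -/
def eq (a b : Expr n) : Expr n := and (le a b) (le b a)
/-- Bounded summation. -/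
def sum (m : Expr n) (f : Expr (n + 1)) : Expr n := fold m zero (add top (wk f))
/-- The number of `i < m` with a property. -/
def count (m : Expr n) (f : Expr (n + 1)) : Expr n := sum m (sg f)
/-- Bounded existential quantification. -/
def ex (m : Expr n) (f : Expr (n + 1)) : Expr n := sg (count m f)
/-- Bounded universal quantification. -/
def all (m : Expr n) (f : Expr (n + 1)) : Expr n := not (ex m (not f))
/-- Division. -/
def div (a b : Expr n) : Expr n := count a (le (mul (succ top) (wk b)) (wk a))
/-- Remainder. -/
def mod (a b : Expr n) : Expr n := sub a (mul b (div a b))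
/-- `a` divided `m` times by `b`. -/
def divPow (a b m : Expr n) : Expr n := fold m a (div top (wk (wk b)))

section Eval
variable {w : List QSymbol} {ρ : List ℕ} {a b m : Expr n} {f : Expr (n + 1)}

@[simp] theorem eval_top {x : ℕ} : eval w (top : Expr (n + 1)) (x :: ρ) = x := rfl
@[simp] theorem eval_wk {x : ℕ} : eval w (wk a) (x :: ρ) = eval w a ρ := rfl
@[simp] theorem eval_zero : eval w (zero : Expr n) ρ = 0 := rfl
@[simp] theorem eval_succ : eval w (succ a) ρ = eval w a ρ + 1 := rfl
@[simp] theorem eval_pred : eval w (pred a) ρ = eval w a ρ - 1 := rfl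
@[simp] theorem eval_len : eval w (len : Expr n) ρ = w.length := rfl
@[simp] theorem eval_bind : eval w (bind a f) ρ = eval w f (eval w a ρ :: ρ) := rfl
@[simp] theorem eval_one : eval w (one : Expr n) ρ = 1 := rfl
@[simp] theorem eval_two : eval w (two : Expr n) ρ = 2 := rfl

@[simp] theorem holds_wk {x : ℕ} : Holds w (wk a) (x :: ρ) ↔ Holds w a ρ := Iff.rfl

theorem holds_bind : Holds w (bind a f) ρ ↔ Holds w f (eval w a ρ :: ρ) := Iff.rfl

@[simp] theorem holds_isSym {c : QSymbol} :
    Holds w (isSym c a) ρ ↔ w[eval w a ρ]? = some c := by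
  unfold Holds
  rw [eval]
  split_ifs with h <;> simp [h]

open Classical in
@[simp] theorem eval_sg : eval w (sg a) ρ = if Holds w a ρ then 1 else 0 := by
  unfold sg Holds
  rw [eval]
  cases h : eval w a ρ <;> simp [iter]

open Classical in
@[simp] theorem eval_not : eval w (not a) ρ = if Holds w a ρ then 0 else 1 := by
  unfold not Holds
  rw [eval]
  cases h : eval w a ρ <;> simp [iter]

@[simp] theorem holds_sg : Holds w (sg a) ρ ↔ Holds w a ρ := by
  rw [Holds, eval_sg]
  split_ifs with h <;> simp [h]

@[simp] theorem holds_not : Holds w (not a) ρ ↔ ¬ Holds w a ρ := by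
  rw [Holds, eval_not]
  split_ifs with h <;> simp [h]

open Classical in
theorem eval_and : eval w (and a b) ρ = if Holds w a ρ ∧ Holds w b ρ then 1 else 0 := by
  unfold and
  rw [eval, eval_sg]
  split_ifs <;> simp_all [iter]

@[simp] theorem holds_and : Holds w (and a b) ρ ↔ Holds w a ρ ∧ Holds w b ρ := by
  rw [Holds, eval_and]
  split_ifs with h <;> simp [h]

@[simp] theorem holds_or : Holds w (or a b) ρ ↔ Holds w a ρ ∨ Holds w b ρ := by
  rw [or, holds_not, holds_and, holds_not, holds_not]
  tauto

theorem iter_add (x : ℕ) : ∀ y, iter (fun acc _ => acc + 1) x y = x + y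
  | 0 => rfl
  | y + 1 => by rw [iter, iter_add x y]; omega

theorem iter_sub (x : ℕ) : ∀ y, iter (fun acc _ => acc - 1) x y = x - y
  | 0 => rfl
  | y + 1 => by rw [iter, iter_sub x y]; omega

theorem iter_sum (g : ℕ → ℕ) : ∀ y, iter (fun acc i => acc + g i) 0 y = ∑ i ∈ Finset.range y, g i
  | 0 => rfl
  | y + 1 => by rw [iter, iter_sum g y, Finset.sum_range_succ]

theorem iter_pow (x : ℕ) : ∀ y, iter (fun acc _ => acc * x) 1 y = x ^ y
  | 0 => rfl
  | y + 1 => by rw [iter, iter_pow x y, pow_succ]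

theorem iter_div (z x : ℕ) : ∀ y, iter (fun acc _ => acc / x) z y = z / x ^ y
  | 0 => by simp [iter]
  | y + 1 => by rw [iter, iter_div z x y, pow_succ, Nat.div_div_eq_div_mul]

@[simp] theorem eval_add : eval w (add a b) ρ = eval w a ρ + eval w b ρ := iter_add _ _

@[simp] theorem eval_sub : eval w (sub a b) ρ = eval w a ρ - eval w b ρ := iter_sub _ _

@[simp] theorem eval_sum : eval w (sum m f) ρ = ∑ i ∈ Finset.range (eval w m ρ), eval w f (i :: ρ) := by
  rw [sum, eval, eval_zero, ← iter_sum]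
  simp

@[simp] theorem eval_mul : eval w (mul a b) ρ = eval w a ρ * eval w b ρ := by
  rw [mul, eval, eval_zero]
  simp [iter_sum fun _ => eval w b ρ]

@[simp] theorem eval_pow : eval w (pow a b) ρ = eval w a ρ ^ eval w b ρ := by
  rw [pow, eval, eval_one]
  simp [iter_pow]

@[simp] theorem holds_le : Holds w (le a b) ρ ↔ eval w a ρ ≤ eval w b ρ := by
  rw [le, holds_not, Holds, eval_sub]
  omega

@[simp] theorem holds_eq : Holds w (eq a b) ρ ↔ eval w a ρ = eval w b ρ := by
  rw [eq, holds_and, holds_le, holds_le]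
  omega

open Classical in
theorem eval_count : eval w (count m f) ρ
    = ((Finset.range (eval w m ρ)).filter fun i => Holds w f (i :: ρ)).card := by
  rw [count, eval_sum, Finset.card_filter]
  simp only [eval_sg]

theorem eval_count_le : eval w (count m f) ρ ≤ eval w m ρ := by
  classical
  rw [eval_count]
  exact (Finset.card_filter_le _ _).trans (by simp)

@[simp] theorem holds_ex : Holds w (ex m f) ρ ↔ ∃ i < eval w m ρ, Holds w f (i :: ρ) := by
  classical
  rw [ex, holds_sg, Holds, eval_count, Finset.card_ne_zero]
  simp [Finset.Nonempty]

@[simp] theorem holds_all : Holds w (all m f) ρ ↔ ∀ i < eval w m ρ, Holds w f (i :: ρ) := by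
  rw [all, holds_not, holds_ex]
  simp

/-- Quotients, variable indices and the bit length are all defined by counting; the counted property
holds exactly on an initial segment, whose length is the count. -/
theorem card_filter_lt (m : ℕ) {N : ℕ} (h : m ≤ N) (p : ℕ → Prop) [DecidablePred p]
    (hp : ∀ i < N, p i ↔ i < m) : ((Finset.range N).filter p).card = m := by
  have : (Finset.range N).filter p = Finset.range m := by
    ext i
    simp only [Finset.mem_filter, Finset.mem_range]
    constructor
    · rintro ⟨h1, h2⟩
      exact (hp i h1).1 h2
    · intro h1
      exact ⟨by omega, (hp i (by omega)).2 h1⟩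
  rw [this, Finset.card_range]

/-- The quotient counts the `i < a` with `(i + 1) * b ≤ a`. For `b = 0` this count would be `a`
instead of Lean's value 0, hence the positivity assumption. -/
theorem eval_div (hb : 0 < eval w b ρ) : eval w (div a b) ρ = eval w a ρ / eval w b ρ := by
  classical
  rw [div, eval_count]
  apply card_filter_lt
  · exact Nat.div_le_self _ _
  · intro i hi
    simp only [holds_le, eval_mul, eval_succ, eval_top, eval_wk]
    rw [← Nat.le_div_iff_mul_le hb]
    exact Iff.rfl

theorem eval_mod (hb : 0 < eval w b ρ) : eval w (mod a b) ρ = eval w a ρ % eval w b ρ := by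
  rw [mod, eval_sub, eval_mul, eval_div hb, Nat.mod_eq_sub]

theorem eval_divPow (hb : 0 < eval w b ρ) :
    eval w (divPow a b m) ρ = eval w a ρ / eval w b ρ ^ eval w m ρ := by
  rw [divPow, eval, ← iter_div]
  congr 1
  funext acc i
  rw [eval_div (by simpa using hb)]
  simp

end Eval

/-! ### Bounds on the intermediate values of derived expressions. -/

section Bounds
variable {w : List QSymbol} {B : ℕ} {ρ : List ℕ} {a b m : Expr n} {f : Expr (n + 1)}

theorem bdd_one (hB : 1 ≤ B) : Bdd w B (one : Expr n) ρ := ⟨trivial, hB⟩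

theorem bdd_two (hB : 2 ≤ B) : Bdd w B (two : Expr n) ρ := ⟨bdd_one (by omega), hB⟩

theorem bdd_wk {x : ℕ} (h : Bdd w B a ρ) : Bdd w B (wk a) (x :: ρ) := h

theorem bdd_succ (ha : Bdd w B a ρ) (h : eval w a ρ + 1 ≤ B) : Bdd w B (succ a) ρ := ⟨ha, h⟩

theorem bdd_isSym {c : QSymbol} (ha : Bdd w B a ρ) : Bdd w B (isSym c a) ρ := ha

theorem bdd_bind (ha : Bdd w B a ρ) (hf : Bdd w B f (eval w a ρ :: ρ)) :
    Bdd w B (bind a f) ρ := ⟨ha, hf⟩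

theorem bdd_sg (hB : 1 ≤ B) (ha : Bdd w B a ρ) : Bdd w B (sg a) ρ :=
  ⟨ha, trivial, fun _ _ => bdd_one hB⟩

theorem bdd_not (hB : 1 ≤ B) (ha : Bdd w B a ρ) : Bdd w B (not a) ρ :=
  ⟨ha, bdd_one hB, fun _ _ => trivial⟩

/-- Conjunction is lazy: if `a` fails, the fold makes no round and `b` is never evaluated. This lets
a cheap guard protect the expensive search. -/
theorem bdd_and (hB : 1 ≤ B) (ha : Bdd w B a ρ) (hb : Holds w a ρ → Bdd w B b ρ) :
    Bdd w B (and a b) ρ := by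
  refine ⟨bdd_sg hB ha, trivial, fun i hi => ?_⟩
  rw [eval_sg] at hi
  split_ifs at hi with h
  · exact bdd_sg (ρ := ρ) hB (hb h)
  · omega

theorem bdd_or (hB : 1 ≤ B) (ha : Bdd w B a ρ) (hb : Bdd w B b ρ) : Bdd w B (or a b) ρ :=
  bdd_not hB (bdd_and hB (bdd_not hB ha) fun _ => bdd_not hB hb)

theorem bdd_add (ha : Bdd w B a ρ) (hb : Bdd w B b ρ) (h : eval w a ρ + eval w b ρ ≤ B) :
    Bdd w B (add a b) ρ := by
  refine ⟨hb, ha, fun i hi => ⟨trivial, ?_⟩⟩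
  simp only [eval_succ, eval_top, iter_add]
  omega

theorem bdd_sub (ha : Bdd w B a ρ) (hb : Bdd w B b ρ) : Bdd w B (sub a b) ρ :=
  ⟨hb, ha, fun _ _ => trivial⟩

/-- Partial sums increase, so the final sum bounds every accumulator. -/
theorem bdd_sum (hm : Bdd w B m ρ) (hf : ∀ i < eval w m ρ, Bdd w B f (i :: ρ))
    (h : ∑ i ∈ Finset.range (eval w m ρ), eval w f (i :: ρ) ≤ B) : Bdd w B (sum m f) ρ := by
  refine ⟨hm, trivial, fun i hi => ?_⟩
  refine bdd_add trivial (bdd_wk (hf i hi)) ?_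
  simp only [eval_top, eval_wk, eval_add, eval_zero, iter_sum fun i => eval w f (i :: ρ)]
  rw [← Finset.sum_range_succ]
  exact (Finset.sum_le_sum_of_subset (by simpa using hi)).trans h

theorem bdd_mul (ha : Bdd w B a ρ) (hb : Bdd w B b ρ) (h : eval w a ρ * eval w b ρ ≤ B) :
    Bdd w B (mul a b) ρ := by
  refine ⟨ha, trivial, fun i hi => ?_⟩
  refine bdd_add trivial (bdd_wk (bdd_wk hb)) ?_
  simp only [eval_top, eval_wk, eval_add, eval_zero, iter_sum fun _ => eval w b ρ]
  rw [← Finset.sum_range_succ, Finset.sum_const, Finset.card_range, smul_eq_mul]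
  exact (Nat.mul_le_mul_right _ hi).trans h

/-- For a positive base the partial powers increase up to the final one. -/
theorem bdd_pow (ha : Bdd w B a ρ) (hb : Bdd w B b ρ) (hpos : 0 < eval w a ρ)
    (h : eval w a ρ ^ eval w b ρ ≤ B) : Bdd w B (pow a b) ρ := by
  refine ⟨hb, bdd_one ((Nat.one_le_pow _ _ hpos).trans h), fun i hi => ?_⟩
  refine bdd_mul trivial (bdd_wk (bdd_wk ha)) ?_
  simp only [eval_top, eval_wk, eval_mul, eval_one, iter_pow]
  rw [← pow_succ]
  exact (Nat.pow_le_pow_right hpos hi).trans h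

theorem bdd_le (hB : 1 ≤ B) (ha : Bdd w B a ρ) (hb : Bdd w B b ρ) : Bdd w B (le a b) ρ :=
  bdd_not hB (bdd_sub ha hb)

theorem bdd_eq (hB : 1 ≤ B) (ha : Bdd w B a ρ) (hb : Bdd w B b ρ) : Bdd w B (eq a b) ρ :=
  bdd_and hB (bdd_le hB ha hb) fun _ => bdd_le hB hb ha

theorem bdd_count (hB : 1 ≤ B) (hm : Bdd w B m ρ) (hle : eval w m ρ ≤ B)
    (hf : ∀ i < eval w m ρ, Bdd w B f (i :: ρ)) : Bdd w B (count m f) ρ := by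
  refine bdd_sum hm (fun i hi => bdd_sg hB (hf i hi)) ?_
  have := eval_count_le (w := w) (m := m) (f := f) (ρ := ρ)
  rw [count, eval_sum] at this
  exact this.trans hle

theorem bdd_ex (hB : 1 ≤ B) (hm : Bdd w B m ρ) (hle : eval w m ρ ≤ B)
    (hf : ∀ i < eval w m ρ, Bdd w B f (i :: ρ)) : Bdd w B (ex m f) ρ :=
  bdd_sg hB (bdd_count hB hm hle hf)

theorem bdd_all (hB : 1 ≤ B) (hm : Bdd w B m ρ) (hle : eval w m ρ ≤ B)
    (hf : ∀ i < eval w m ρ, Bdd w B f (i :: ρ)) : Bdd w B (all m f) ρ :=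
  bdd_not hB (bdd_ex hB hm hle fun i hi => bdd_not hB (hf i hi))

/-- The search multiplies every candidate up to `a` by `b`, so the product `a * b`, not just the
quotient, has to stay below `B`. -/
theorem bdd_div (hB : 1 ≤ B) (ha : Bdd w B a ρ) (hb : Bdd w B b ρ) (hle : eval w a ρ + 1 ≤ B)
    (h : eval w a ρ * eval w b ρ ≤ B) : Bdd w B (div a b) ρ := by
  refine bdd_count hB ha (by omega) fun i hi => bdd_le hB (bdd_mul (bdd_succ trivial ?_)
    (bdd_wk hb) ?_) (bdd_wk ha)
  · simp only [eval_top]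
    omega
  · simp only [eval_succ, eval_top, eval_wk]
    exact (Nat.mul_le_mul_right _ hi).trans h

theorem bdd_mod (hB : 1 ≤ B) (ha : Bdd w B a ρ) (hb : Bdd w B b ρ) (hpos : 0 < eval w b ρ)
    (hle : eval w a ρ + 1 ≤ B) (h : eval w a ρ * eval w b ρ ≤ B) : Bdd w B (mod a b) ρ := by
  refine bdd_sub ha (bdd_mul hb (bdd_div hB ha hb hle h) ?_)
  rw [eval_div hpos]
  exact (Nat.mul_div_le _ _).trans (by omega)

/-- Iterated quotients only decrease and the power `b ^ m` is never formed. This matters because `m`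
can be as large as the length of the input. -/
theorem bdd_divPow (hB : 1 ≤ B) (ha : Bdd w B a ρ) (hb : Bdd w B b ρ) (hm : Bdd w B m ρ)
    (hpos : 0 < eval w b ρ) (hle : eval w a ρ + 1 ≤ B) (h : eval w a ρ * eval w b ρ ≤ B) :
    Bdd w B (divPow a b m) ρ := by
  refine ⟨hm, ha, fun i hi => ?_⟩
  have key : iter (fun acc i => eval w (div top (wk (wk b))) (acc :: i :: ρ)) (eval w a ρ) i
      ≤ eval w a ρ := by
    have : iter (fun acc i => eval w (div top (wk (wk b))) (acc :: i :: ρ)) (eval w a ρ) i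
        = eval w a ρ / eval w b ρ ^ i := by
      rw [← iter_div]
      congr 1
      funext acc i
      rw [eval_div (by simpa using hpos)]
      simp
    rw [this]
    exact Nat.div_le_self _ _
  refine bdd_div hB trivial (bdd_wk (bdd_wk hb)) ?_ ?_
  · simp only [eval_top]
    omega
  · simp only [eval_top, eval_wk]
    exact (Nat.mul_le_mul_right _ key).trans h

end Bounds

end Expr

/-! ### Reading a formula from its code -/

/-- A literal starts at position `r` of the word `w`. -/
def IsLit (w : List QSymbol) (r : ℕ) : Prop := w[r]? = some QSymbol.pos ∨ w[r]? = some QSymbol.neg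

/-- A literal of the clause that ends at position `q` starts at position `r`. -/
def InClause (w : List QSymbol) (q r : ℕ) : Prop :=
  r < q ∧ IsLit w r ∧ ∀ i < q, r ≤ i → w[i]? ≠ some QSymbol.close

/-- The literal at position `r` is over an existential variable. -/
def IsEx (w : List QSymbol) (r : ℕ) : Prop := w[r + 1]? = some QSymbol.ex

open Classical in
/-- The index of the variable of the literal at position `r`. -/
noncomputable def varIdx (w : List QSymbol) (r : ℕ) : ℕ :=
  ((Finset.range w.length).filter fun i => ∀ j < i + 1, w[r + 2 + j]? = some QSymbol.tick).card

/-- The literals at two positions are complementary. -/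
def Complementary (w : List QSymbol) (r s : ℕ) : Prop :=
  ¬ (w[r]? = some QSymbol.pos ↔ w[s]? = some QSymbol.pos) ∧ (IsEx w r ↔ IsEx w s) ∧
    varIdx w r = varIdx w s

/-- Two clauses can simultaneously be falsified on their universal literals, and every existential
literal of the first is complementary to every existential literal of the second. -/
def HasClash (w : List QSymbol) : Prop :=
  ∃ q < w.length, w[q]? = some QSymbol.close ∧ ∃ q' < w.length, w[q']? = some QSymbol.close ∧
    (∀ r < w.length, (InClause w q r ∨ InClause w q' r) ∧ ¬ IsEx w r →
      ∀ s < w.length, (InClause w q s ∨ InClause w q' s) ∧ ¬ IsEx w s → ¬ Complementary w r s) ∧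
    ∀ r < w.length, InClause w q r ∧ IsEx w r →
      ∀ s < w.length, InClause w q' s ∧ IsEx w s → Complementary w r s

open Classical in
/-- The number of existential quantifiers. -/
noncomputable def numEx (w : List QSymbol) : ℕ :=
  ((Finset.range w.length).filter fun i => w[i]? = some QSymbol.ex ∧ ¬ IsLit w (i - 1)).card

open Classical in
/-- The maximal number of literals of a clause. -/
noncomputable def width (w : List QSymbol) : ℕ :=
  ((Finset.range w.length).filter fun j => ∃ q < w.length, w[q]? = some QSymbol.close ∧
    j + 1 ≤ ((Finset.range w.length).filter fun r => InClause w q r).card).card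

/-- The number of binary digits of the length. -/
noncomputable def numBits (w : List QSymbol) : ℕ :=
  ((Finset.range w.length).filter fun i => 2 ^ i ≤ w.length).card

/-- The literal at position `r` is false, if the existential variables are the binary digits of
`X`, and the universal variables are true whose index is modulo `p` one of the last `t` digits of
`Y` to the base `Q`. -/
def LitFalse (w : List QSymbol) (Q t p Y X r : ℕ) : Prop :=
  w[r]? = some QSymbol.pos ↔ ¬ ((IsEx w r ∧ X / 2 ^ varIdx w r % 2 ≠ 0) ∨
    (¬ IsEx w r ∧ ∃ j < t, Y / Q ^ j % Q = varIdx w r % p))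

/-- One of the assignments to the universal variables that are given by a modulus `p < Q` and `t`
residues makes the matrix unsatisfiable. -/
def Refutes (w : List QSymbol) (k Q t : ℕ) : Prop :=
  ∃ p < Q, p ≠ 0 ∧ ∃ Y < Q ^ t, ∀ X < 2 ^ k, ∃ q < w.length, w[q]? = some QSymbol.close ∧
    ∀ r < w.length, InClause w q r → LitFalse w Q t p Y X r

/-! ### Expressions for the predicates on the input word. -/

namespace Expr

variable {n : ℕ}

/-- Implication. -/
def imp (a b : Expr n) : Expr n := or (not a) b
/-- Equivalence. -/
def iff (a b : Expr n) : Expr n := eq (sg a) (sg b)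

/-- The expression for `IsLit`. -/
def isLit (r : Expr n) : Expr n := or (isSym QSymbol.pos r) (isSym QSymbol.neg r)

/-- The expression for `InClause`. -/
def inClause (q r : Expr n) : Expr n :=
  and (le (succ r) q) (and (isLit r) (all q (imp (le (wk r) top) (not (isSym QSymbol.close top)))))

/-- The expression for `IsEx`. -/
def isEx (r : Expr n) : Expr n := isSym QSymbol.ex (succ r)

/-- The expression for `varIdx`. -/
def varIdx (r : Expr n) : Expr n :=
  count len (all (succ top) (isSym QSymbol.tick (add (add (wk (wk r)) two) top)))

/-- The expression for `Complementary`. -/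
def compl (r s : Expr n) : Expr n :=
  and (not (iff (isSym QSymbol.pos r) (isSym QSymbol.pos s)))
    (and (iff (isEx r) (isEx s)) (eq (varIdx r) (varIdx s)))

/-- The expression for `HasClash`. -/
def hasClash : Expr n :=
  ex len (and (isSym QSymbol.close top) (ex len (and (isSym QSymbol.close top) (and
    (all len (imp (and (or (inClause (wk (wk top)) top) (inClause (wk top) top)) (not (isEx top)))
      (all len (imp (and (or (inClause (wk (wk (wk top))) top) (inClause (wk (wk top)) top))
        (not (isEx top))) (not (compl (wk top) top))))))
    (all len (imp (and (inClause (wk (wk top)) top) (isEx top))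
      (all len (imp (and (inClause (wk (wk top)) top) (isEx top)) (compl (wk top) top)))))))))

/-- The expression for `numEx`. -/
def numEx : Expr n := count len (and (isSym QSymbol.ex top) (not (isLit (pred top))))

/-- The expression for `width`. -/
def width : Expr n :=
  count len (ex len (and (isSym QSymbol.close top)
    (le (succ (wk top)) (count len (inClause (wk top) top)))))

/-- The expression for `numBits`. -/
def numBits : Expr n := count len (divPow len two top)

/-- The expression for `LitFalse`. -/
def litFalse (Q t p Y X r : Expr n) : Expr n :=
  iff (isSym QSymbol.pos r) (not (or
    (and (isEx r) (mod (divPow X two (varIdx r)) two))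
    (and (not (isEx r)) (ex t (eq (mod (divPow (wk Y) (wk Q) top) (wk Q))
      (mod (varIdx (wk r)) (wk p)))))))

/-- The expression for `Refutes`. -/
def refutes (k Q t : Expr n) : Expr n :=
  ex Q (and top (ex (wk (pow Q t)) (all (wk (wk (pow two k))) (ex len
    (and (isSym QSymbol.close top) (all len (imp (inClause (wk top) top)
      (litFalse (wk (wk (wk (wk (wk Q))))) (wk (wk (wk (wk (wk t))))) (wk (wk (wk (wk top))))
        (wk (wk (wk top))) (wk (wk top)) top))))))))

/-- The expression that is true if and only if the formula that is encoded by the input is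
false. -/
def isFalse : Expr 0 :=
  or hasClash (and (and (le two numEx) (le two width))
    (bind numEx (bind (mul width (pow (succ (mul two top)) (pred width)))
      (bind (succ (mul two (succ (mul numBits (mul top top)))))
        (refutes (wk (wk top)) top (wk top))))))

section Eval
variable {w : List QSymbol} {ρ : List ℕ}

@[simp] theorem holds_imp {a b : Expr n} : Holds w (imp a b) ρ ↔ (Holds w a ρ → Holds w b ρ) := by
  rw [imp, holds_or, holds_not]
  tauto

@[simp] theorem holds_iff {a b : Expr n} : Holds w (iff a b) ρ ↔ (Holds w a ρ ↔ Holds w b ρ) := by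
  classical
  rw [iff, holds_eq, eval_sg, eval_sg]
  split_ifs <;> simp_all

@[simp] theorem holds_top {x : ℕ} : Holds w (top : Expr (n + 1)) (x :: ρ) ↔ x ≠ 0 := Iff.rfl

@[simp] theorem holds_isLit {r : Expr n} : Holds w (isLit r) ρ ↔ IsLit w (eval w r ρ) := by
  simp [isLit, IsLit]

@[simp] theorem holds_inClause {q r : Expr n} :
    Holds w (inClause q r) ρ ↔ InClause w (eval w q ρ) (eval w r ρ) := by
  simp [inClause, InClause]

@[simp] theorem holds_isEx {r : Expr n} : Holds w (isEx r) ρ ↔ IsEx w (eval w r ρ) := by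
  simp [isEx, IsEx]

@[simp] theorem eval_varIdx {r : Expr n} : eval w (varIdx r) ρ = _root_.varIdx w (eval w r ρ) := by
  classical
  rw [varIdx, eval_count, _root_.varIdx]
  simp

@[simp] theorem holds_compl {r s : Expr n} :
    Holds w (compl r s) ρ ↔ Complementary w (eval w r ρ) (eval w s ρ) := by
  simp [compl, Complementary]

theorem holds_hasClash : Holds w (hasClash : Expr n) ρ ↔ HasClash w := by
  simp only [hasClash, HasClash, holds_ex, holds_and, holds_isSym, holds_all, holds_imp, holds_or,
    holds_not, holds_inClause, holds_isEx, holds_compl, eval_top, eval_wk, eval_len]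

@[simp] theorem eval_numEx : eval w (numEx : Expr n) ρ = _root_.numEx w := by
  classical
  rw [numEx, eval_count, _root_.numEx]
  simp

@[simp] theorem eval_width : eval w (width : Expr n) ρ = _root_.width w := by
  classical
  rw [width, eval_count, _root_.width]
  simp [eval_count]

@[simp] theorem eval_numBits : eval w (numBits : Expr n) ρ = _root_.numBits w := by
  classical
  rw [numBits, eval_count, _root_.numBits]
  -- The condition `2 ^ i ≤ length` is tested as `length / 2 ^ i ≠ 0`, which avoids forming the
  -- power.
  have h : ∀ i, eval w (divPow len two top : Expr (n + 1)) (i :: ρ) = w.length / 2 ^ i := fun i => by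
    rw [eval_divPow (by simp)]
    simp
  simp [Holds, h]

theorem holds_litFalse {Q t p Y X r : Expr n} (hQ : 0 < eval w Q ρ) (hp : 0 < eval w p ρ) :
    Holds w (litFalse Q t p Y X r) ρ ↔ LitFalse w (eval w Q ρ) (eval w t ρ) (eval w p ρ)
      (eval w Y ρ) (eval w X ρ) (eval w r ρ) := by
  have h1 : Holds w (mod (divPow X two (varIdx r)) two) ρ
      ↔ eval w X ρ / 2 ^ _root_.varIdx w (eval w r ρ) % 2 ≠ 0 := by
    rw [Holds, eval_mod (by simp), eval_divPow (by simp)]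
    simp
  have h2 : ∀ j, eval w (mod (divPow (wk Y) (wk Q) top) (wk Q)) (j :: ρ)
      = eval w Y ρ / eval w Q ρ ^ j % eval w Q ρ := by
    intro j
    rw [eval_mod (by simpa), eval_divPow (by simpa)]
    simp
  have h3 : ∀ j, eval w (mod (varIdx (wk r)) (wk p)) (j :: ρ)
      = _root_.varIdx w (eval w r ρ) % eval w p ρ := by
    intro j
    rw [eval_mod (by simpa)]
    simp
  simp only [litFalse, LitFalse, holds_iff, holds_isSym, holds_not, holds_or, holds_and, holds_isEx,
    h1, holds_ex, holds_eq, h2, h3]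

/-- The guard `p ≠ 0` together with `p < Q` makes both moduli positive, as the correctness of
remainders requires. -/
theorem holds_refutes {k Q t : Expr n} : Holds w (refutes k Q t) ρ ↔
    Refutes w (eval w k ρ) (eval w Q ρ) (eval w t ρ) := by
  simp only [refutes, Refutes, holds_ex, holds_and, holds_isSym, holds_all, holds_imp,
    holds_inClause, eval_top, eval_wk, eval_len, eval_pow, eval_two, holds_top]
  refine exists_congr fun p => and_congr_right fun hp => and_congr_right fun hp0 =>
    exists_congr fun Y => and_congr_right fun _ => forall_congr' fun X => imp_congr_right fun _ =>
    exists_congr fun q => and_congr_right fun _ => and_congr_right fun _ =>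
    forall_congr' fun r => imp_congr_right fun _ => imp_congr_right fun _ => ?_
  rw [holds_litFalse]
  · simp
  · simp only [eval_wk]
    omega
  · simp only [eval_wk, eval_top]
    omega

/-- The number of universal variables on which an assignment has to be prescribed. -/
noncomputable def _root_.budget (w : List QSymbol) : ℕ :=
  _root_.width w * (2 * _root_.numEx w + 1) ^ (_root_.width w - 1)

/-- The base of the numbers that encode sets of residues; an upper bound on the moduli. -/
noncomputable def _root_.base (w : List QSymbol) : ℕ :=
  2 * (_root_.numBits w * (budget w * budget w) + 1) + 1

theorem holds_isFalse : Holds w isFalse [] ↔ HasClash w ∨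
    (2 ≤ _root_.numEx w ∧ 2 ≤ _root_.width w) ∧
      Refutes w (_root_.numEx w) (base w) (budget w) := by
  rw [isFalse, holds_or, holds_hasClash, holds_and, holds_and, holds_le, holds_le, holds_bind,
    holds_bind, holds_bind, holds_refutes]
  simp [budget, base]

end Eval

/-! ### Bounds on the values that occur in the decision procedure. -/

section Bounds
variable {w : List QSymbol} {B : ℕ} {ρ : List ℕ}

theorem bdd_imp {a b : Expr n} (hB : 1 ≤ B) (ha : Bdd w B a ρ) (hb : Bdd w B b ρ) :
    Bdd w B (imp a b) ρ := bdd_or hB (bdd_not hB ha) hb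

theorem bdd_iff {a b : Expr n} (hB : 1 ≤ B) (ha : Bdd w B a ρ) (hb : Bdd w B b ρ) :
    Bdd w B (iff a b) ρ := bdd_eq hB (bdd_sg hB ha) (bdd_sg hB hb)

theorem bdd_isLit {r : Expr n} (hB : 1 ≤ B) (hr : Bdd w B r ρ) : Bdd w B (isLit r) ρ :=
  bdd_or hB (bdd_isSym hr) (bdd_isSym hr)

theorem bdd_inClause {q r : Expr n} (hB : 1 ≤ B) (hq : Bdd w B q ρ) (hr : Bdd w B r ρ)
    (hql : eval w q ρ ≤ B) (hrl : eval w r ρ + 1 ≤ B) : Bdd w B (inClause q r) ρ :=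
  bdd_and hB (bdd_le hB (bdd_succ hr hrl) hq) fun _ => bdd_and hB (bdd_isLit hB hr) fun _ =>
    bdd_all hB hq hql fun _ _ => bdd_imp hB (bdd_le hB (bdd_wk hr) trivial)
      (bdd_not hB (bdd_isSym trivial))

theorem bdd_isEx {r : Expr n} (hr : Bdd w B r ρ) (hrl : eval w r ρ + 1 ≤ B) :
    Bdd w B (isEx r) ρ := bdd_isSym (bdd_succ hr hrl)

theorem bdd_varIdx {r : Expr n} (hB : 2 ≤ B) (hr : Bdd w B r ρ)
    (hrl : eval w r ρ + 2 + w.length ≤ B) : Bdd w B (varIdx r) ρ := by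
  refine bdd_count (by omega) trivial (by rw [eval_len]; omega) fun i hi => ?_
  rw [eval_len] at hi
  refine bdd_all (by omega) (bdd_succ trivial ?_) ?_ fun j hj => bdd_isSym
    (bdd_add (bdd_add (bdd_wk (bdd_wk hr)) (bdd_two hB) ?_) trivial ?_)
  all_goals simp only [eval_top, eval_succ, eval_wk, eval_two, eval_add] at *
  all_goals omega

theorem bdd_compl {r s : Expr n} (hB : 2 ≤ B) (hr : Bdd w B r ρ) (hs : Bdd w B s ρ)
    (hrl : eval w r ρ + 2 + w.length ≤ B) (hsl : eval w s ρ + 2 + w.length ≤ B) :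
    Bdd w B (compl r s) ρ :=
  bdd_and (by omega) (bdd_not (by omega) (bdd_iff (by omega) (bdd_isSym hr) (bdd_isSym hs)))
    fun _ => bdd_and (by omega) (bdd_iff (by omega) (bdd_isEx hr (by omega))
      (bdd_isEx hs (by omega))) fun _ => bdd_eq (by omega) (bdd_varIdx hB hr hrl)
        (bdd_varIdx hB hs hsl)

theorem bdd_hasClash (hB : 2 * w.length + 2 ≤ B) : Bdd w B (hasClash : Expr n) ρ := by
  have h1 : 1 ≤ B := by omega
  have hl : w.length ≤ B := by omega
  refine bdd_ex h1 trivial hl fun q hq => bdd_and h1 (bdd_isSym trivial) fun _ =>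
    bdd_ex h1 trivial hl fun q' hq' => bdd_and h1 (bdd_isSym trivial) fun _ =>
    bdd_and h1
      (bdd_all h1 trivial hl fun r hr => bdd_imp h1 (bdd_and h1 (bdd_or h1
          (bdd_inClause h1 trivial trivial ?_ ?_) (bdd_inClause h1 trivial trivial ?_ ?_))
          fun _ => bdd_not h1 (bdd_isEx trivial ?_))
        (bdd_all h1 trivial hl fun s hs => bdd_imp h1 (bdd_and h1 (bdd_or h1
          (bdd_inClause h1 trivial trivial ?_ ?_) (bdd_inClause h1 trivial trivial ?_ ?_))
          fun _ => bdd_not h1 (bdd_isEx trivial ?_))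
          (bdd_not h1 (bdd_compl (by omega) trivial trivial ?_ ?_))))
      (fun _ => bdd_all h1 trivial hl fun r hr => bdd_imp h1 (bdd_and h1
          (bdd_inClause h1 trivial trivial ?_ ?_) fun _ => bdd_isEx trivial ?_)
        (bdd_all h1 trivial hl fun s hs => bdd_imp h1 (bdd_and h1
          (bdd_inClause h1 trivial trivial ?_ ?_) fun _ => bdd_isEx trivial ?_)
          (bdd_compl (by omega) trivial trivial ?_ ?_)))
  all_goals simp only [eval_top, eval_wk, eval_len] at *
  all_goals omega

theorem bdd_numEx (hB : 1 ≤ B) (hl : w.length ≤ B) : Bdd w B (numEx : Expr n) ρ :=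
  bdd_count hB trivial hl fun _ _ => bdd_and hB (bdd_isSym trivial) fun _ =>
    bdd_not hB (bdd_isLit hB trivial)

theorem bdd_width (hB : w.length + 1 ≤ B) : Bdd w B (width : Expr n) ρ := by
  have h1 : 1 ≤ B := by omega
  have hl : w.length ≤ B := by omega
  refine bdd_count h1 trivial hl fun j hj => bdd_ex h1 trivial hl fun q hq =>
    bdd_and h1 (bdd_isSym trivial) fun _ => bdd_le h1 (bdd_succ trivial ?_)
    (bdd_count h1 trivial hl fun r hr => bdd_inClause h1 trivial trivial ?_ ?_)
  all_goals simp only [eval_top, eval_wk, eval_len] at *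
  all_goals omega

theorem bdd_numBits (hB : 2 * w.length + 2 ≤ B) : Bdd w B (numBits : Expr n) ρ := by
  have h1 : 1 ≤ B := by omega
  refine bdd_count h1 trivial (by rw [eval_len]; omega) fun j hj =>
    bdd_divPow h1 trivial (bdd_two (by omega)) trivial ?_ ?_ ?_
  all_goals simp only [eval_two, eval_len] at *
  all_goals omega

theorem varIdx_le (w : List QSymbol) (r : ℕ) : _root_.varIdx w r ≤ w.length := by
  classical
  exact (Finset.card_filter_le _ _).trans (by simp)

theorem bdd_litFalse {Q t p Y X r : Expr n} (hB : 2 ≤ B) (hQ : Bdd w B Q ρ) (ht : Bdd w B t ρ)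
    (hp : Bdd w B p ρ) (hY : Bdd w B Y ρ) (hX : Bdd w B X ρ) (hr : Bdd w B r ρ)
    (hQ0 : 0 < eval w Q ρ) (hp0 : 0 < eval w p ρ)
    (hrl : eval w r ρ + 2 + w.length ≤ B) (htl : eval w t ρ ≤ B)
    (hXl : eval w X ρ * 2 ≤ B) (hXl' : eval w X ρ + 1 ≤ B)
    (hYl : eval w Y ρ * eval w Q ρ ≤ B) (hYl' : eval w Y ρ + 1 ≤ B)
    (hpl : w.length * eval w p ρ ≤ B) : Bdd w B (litFalse Q t p Y X r) ρ := by
  have h1 : 1 ≤ B := by omega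
  refine bdd_iff h1 (bdd_isSym hr) (bdd_not h1 (bdd_or h1
    (bdd_and h1 (bdd_isEx hr (by omega)) fun _ => bdd_mod h1
      (bdd_divPow h1 hX (bdd_two hB) (bdd_varIdx hB hr hrl) (by simp) hXl' (by simpa))
      (bdd_two hB) (by simp) ?_ ?_)
    (bdd_and h1 (bdd_not h1 (bdd_isEx hr (by omega))) fun _ => bdd_ex h1 ht htl fun j hj =>
      bdd_eq h1
        (bdd_mod h1 (bdd_divPow h1 (bdd_wk hY) (bdd_wk hQ) trivial (by simpa) (by simpa)
          (by simpa)) (bdd_wk hQ) (by simpa) ?_ ?_)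
        (bdd_mod h1 (bdd_varIdx hB (bdd_wk hr) (by simpa)) (bdd_wk hp) (by simpa) ?_ ?_))))
  · rw [eval_divPow (by simp)]
    have := Nat.div_le_self (eval w X ρ) (eval w (two : Expr n) ρ ^ eval w (varIdx r) ρ)
    omega
  · rw [eval_divPow (by simp), eval_two]
    exact (Nat.mul_le_mul_right _ (Nat.div_le_self _ _)).trans hXl
  · rw [eval_divPow (by simpa)]
    have := Nat.div_le_self (eval w Y ρ) (eval w Q ρ ^ j)
    simp only [eval_wk, eval_top]
    omega
  · rw [eval_divPow (by simpa), eval_wk, eval_wk]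
    exact (Nat.mul_le_mul_right _ (Nat.div_le_self _ _)).trans hYl
  · have := varIdx_le w (eval w r ρ)
    simp only [eval_varIdx, eval_wk]
    omega
  · simp only [eval_varIdx, eval_wk]
    exact (Nat.mul_le_mul_right _ (varIdx_le _ _)).trans hpl

/-- The candidates range below `Q ^ t` and `2 ^ k`; the extra factors `Q` and `2` and the term
`w.length * Q` pay for the divisions, which need dividend times divisor below `B`. -/
theorem bdd_refutes {k Q t : Expr n} (hB : 2 * w.length + 2 ≤ B) (hk : Bdd w B k ρ)
    (hQ : Bdd w B Q ρ) (ht : Bdd w B t ρ) (hQ0 : 0 < eval w Q ρ) (hQl : eval w Q ρ ≤ B)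
    (htl : eval w t ρ ≤ B) (hXl : 2 ^ eval w k ρ * 2 ≤ B)
    (hYl : eval w Q ρ ^ eval w t ρ * eval w Q ρ ≤ B) (hpl : w.length * eval w Q ρ ≤ B) :
    Bdd w B (refutes k Q t) ρ := by
  have h1 : 1 ≤ B := by omega
  have hl : w.length ≤ B := by omega
  have hYl' : eval w Q ρ ^ eval w t ρ ≤ B :=
    (Nat.le_mul_of_pos_right _ hQ0).trans hYl
  refine bdd_ex h1 hQ hQl fun p hp => bdd_and h1 trivial fun hp0 =>
    bdd_ex h1 (bdd_wk (bdd_pow hQ ht hQ0 hYl')) (by simpa) fun Y hY =>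
    bdd_all h1 (bdd_wk (bdd_wk (bdd_pow (bdd_two (by omega)) hk (by simp) ?_))) ?_ fun X hX =>
    bdd_ex h1 trivial hl fun q hq => bdd_and h1 (bdd_isSym trivial) fun _ =>
    bdd_all h1 trivial hl fun r hr => bdd_imp h1 (bdd_inClause h1 trivial trivial ?_ ?_)
      (bdd_litFalse (by omega) hQ ht trivial trivial trivial trivial ?_ ?_ ?_ ?_ ?_ ?_ ?_ ?_ ?_)
  all_goals simp only [eval_top, eval_wk, eval_len, eval_two, eval_pow, holds_top] at *
  any_goals omega
  · exact (Nat.mul_le_mul_right _ hY.le).trans hYl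
  · exact (Nat.mul_le_mul_left _ hp.le).trans hpl

theorem numEx_le (w : List QSymbol) : _root_.numEx w ≤ w.length := by
  classical
  exact (Finset.card_filter_le _ _).trans (by simp)

/-- The large bounds are required only behind the guard; when it fails, a bound linear in the length
suffices. -/
theorem bdd_isFalse (hB : 2 * w.length + 2 ≤ B)
    (h : 2 ≤ _root_.numEx w → 2 ≤ _root_.width w → base w ≤ B ∧ 2 ^ _root_.numEx w * 2 ≤ B ∧
      base w ^ budget w * base w ≤ B ∧ w.length * base w ≤ B ∧ budget w * budget w ≤ B) :
    Bdd w B isFalse [] := by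
  have h1 : 1 ≤ B := by omega
  refine bdd_or h1 (bdd_hasClash hB) (bdd_and h1 (bdd_and h1
    (bdd_le h1 (bdd_two (by omega)) (bdd_numEx h1 (by omega)))
      fun _ => (bdd_le h1 (bdd_two (by omega)) (bdd_width (by omega)))) fun hg => ?_)
  simp only [holds_and, holds_le, eval_two, eval_numEx, eval_width] at hg
  obtain ⟨hb, hX, hY, hp, ht⟩ := h hg.1 hg.2
  have hk := numEx_le w
  have htl : budget w ≤ B := (Nat.le_mul_self _).trans ht
  have hpow : (2 * _root_.numEx w + 1) ^ (_root_.width w - 1) ≤ B :=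
    (Nat.le_mul_of_pos_left _ (by omega)).trans htl
  have hbase : base w = 2 * (_root_.numBits w * (budget w * budget w) + 1) + 1 := rfl
  refine bdd_bind (bdd_numEx h1 (by omega)) (bdd_bind
    (bdd_mul (bdd_width (by omega)) (bdd_pow (bdd_succ (bdd_mul (bdd_two (by omega)) trivial ?_) ?_)
      (bdd_width (by omega)) ?_ ?_) ?_)
    (bdd_bind (bdd_succ (bdd_mul (bdd_two (by omega)) (bdd_succ (bdd_mul (bdd_numBits hB)
        (bdd_mul trivial trivial ?_) ?_) ?_) ?_) ?_)
      (bdd_refutes hB trivial trivial trivial ?_ ?_ ?_ ?_ ?_ ?_)))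
  all_goals simp only [eval_top, eval_wk, eval_two, eval_succ, eval_mul, eval_pow, eval_pred,
    eval_numEx, eval_width, eval_numBits]
  all_goals try simp only [show _root_.width w * (2 * _root_.numEx w + 1) ^ (_root_.width w - 1)
    = budget w from rfl]
  all_goals first
    | omega
    | exact hX
    | exact hY
    | exact hp

end Bounds

end Expr

namespace ForallExistsQBF

/-! ### Positions in the code of a formula -/

/-- The index of a variable within its block. -/
def varIndex {u k : ℕ} : Fin u ⊕ Fin k → ℕ := Sum.elim Fin.val Fin.val

/-- The code of the literal `l` starts at position `r` of the word `w`. -/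
def LitAt {u k : ℕ} (w : List QSymbol) (r : ℕ) (l : QLiteral u k) : Prop :=
  ∃ rest : List QSymbol, w.drop r = encodeLiteral l ++ rest ∧ rest.head? ≠ some QSymbol.tick

section LitAt
variable {u k : ℕ} {w : List QSymbol} {r s : ℕ} {l l' : QLiteral u k}

theorem encodeLiteral_eq (l : QLiteral u k) : encodeLiteral l =
    (if l.2 = true then QSymbol.pos else QSymbol.neg) ::
      (if l.1.isRight = true then QSymbol.ex else QSymbol.all) ::
        List.replicate (varIndex l.1) QSymbol.tick := by
  obtain ⟨i | j, b⟩ := l <;> rfl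

theorem LitAt.getElem (h : LitAt w r l) : w[r]? = some QSymbol.pos ↔ l.2 = true := by
  obtain ⟨rest, h, _⟩ := h
  have := congrArg (fun z => z[0]?) h
  simp only [encodeLiteral_eq, List.getElem?_drop, Nat.add_zero] at this
  rw [this]
  cases l.2 <;> simp

theorem LitAt.isEx (h : LitAt w r l) : IsEx w r ↔ l.1.isRight = true := by
  obtain ⟨rest, h, _⟩ := h
  have := congrArg (fun z => z[1]?) h
  simp only [encodeLiteral_eq, List.getElem?_drop] at this
  rw [IsEx, this]
  cases l.1.isRight <;> simp

/-- The count measures the run of ticks from position `r + 2`; it ends with the literal because the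
rest of the word does not begin with a tick. -/
theorem LitAt.varIdx (h : LitAt w r l) : varIdx w r = varIndex l.1 := by
  classical
  obtain ⟨rest, h, hrest⟩ := h
  have hlen := congrArg List.length h
  simp only [encodeLiteral_eq, List.length_drop, List.length_append, List.length_cons,
    List.length_replicate] at hlen
  have hget : ∀ j, w[r + 2 + j]? = (List.replicate (varIndex l.1) QSymbol.tick ++ rest)[j]? := by
    intro j
    have := congrArg (fun z => z[2 + j]?) h
    simp only [encodeLiteral_eq, List.getElem?_drop] at this
    rw [Nat.add_assoc, this, Nat.add_comm 2 j]
    simp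
  rw [_root_.varIdx]
  apply Expr.card_filter_lt
  · omega
  · intro i _
    constructor
    · intro hi
      by_contra hlt
      have := hi (varIndex l.1) (by omega)
      rw [hget, List.getElem?_append_right (by simp)] at this
      simp only [List.length_replicate, Nat.sub_self] at this
      exact hrest (by rwa [List.head?_eq_getElem?])
    · intro hi j hj
      rw [hget, List.getElem?_append_left (by simp; omega), List.getElem?_replicate,
        if_pos (by omega)]

theorem var_eq_iff (v v' : Fin u ⊕ Fin k) :
    v = v' ↔ (v.isRight = true ↔ v'.isRight = true) ∧ varIndex v = varIndex v' := by
  rcases v with i | j <;> rcases v' with i' | j' <;> simp [varIndex, Fin.ext_iff]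

theorem LitAt.complementary (h : LitAt w r l) (h' : LitAt w s l') :
    Complementary w r s ↔ l.1 = l'.1 ∧ l.2 ≠ l'.2 := by
  rw [Complementary, h.getElem, h'.getElem, h.isEx, h'.isEx, h.varIdx, h'.varIdx, var_eq_iff,
    and_comm]
  refine and_congr_right fun _ => ?_
  cases l.2 <;> cases l'.2 <;> simp

end LitAt

/-- The code of a clause `c` ends at position `q` of the word `w`. -/
structure ClauseAt {u k : ℕ} (w : List QSymbol) (q : ℕ) (c : List (QLiteral u k)) : Prop where
  lt : q < w.length
  close : w[q]? = some QSymbol.close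
  exists_lit : ∀ r, InClause w q r → ∃ l ∈ c, LitAt w r l
  exists_pos : ∀ l ∈ c, ∃ r, InClause w q r ∧ LitAt w r l
  card : ∀ p : DecidablePred (InClause w q),
    (@Finset.filter _ (InClause w q) p (Finset.range w.length)).card = c.length

section Positions
variable {u k : ℕ}

theorem encodeLiteral_getElem_ne_close (l : QLiteral u k) (i : ℕ) :
    (encodeLiteral l)[i]? ≠ some QSymbol.close := by
  intro h
  have := List.mem_of_getElem? h
  rw [encodeLiteral_eq] at this
  revert this
  cases l.2 <;> cases l.1.isRight <;> simp

theorem literals_getElem_ne_close (c : List (QLiteral u k)) (i : ℕ) :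
    (c.flatMap encodeLiteral)[i]? ≠ some QSymbol.close := by
  intro h
  have := List.mem_of_getElem? h
  obtain ⟨l, _, hl⟩ := List.mem_flatMap.1 this
  obtain ⟨i, hi⟩ := List.mem_iff_getElem?.1 hl
  exact encodeLiteral_getElem_ne_close l i hi

theorem encodeLiteral_isLit (l : QLiteral u k) (i : ℕ) : IsLit (encodeLiteral l) i ↔ i = 0 := by
  rw [encodeLiteral_eq, IsLit]
  rcases i with _ | _ | i
  · cases l.2 <;> simp
  · cases l.1.isRight <;> simp
  · simp [List.getElem?_replicate]

theorem encodeLiteral_length_pos (l : QLiteral u k) : 0 < (encodeLiteral l).length := by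
  rw [encodeLiteral_eq]
  simp

theorem isLit_append_left {s s' : List QSymbol} {i : ℕ} (h : i < s.length) :
    IsLit (s ++ s') i ↔ IsLit s i := by
  rw [IsLit, IsLit, List.getElem?_append_left h]

theorem isLit_append_right {s s' : List QSymbol} {i : ℕ} :
    IsLit (s ++ s') (s.length + i) ↔ IsLit s' i := by
  rw [IsLit, IsLit, List.getElem?_append_right (by omega), Nat.add_sub_cancel_left]

/-- The sign symbols occur only as first symbols of literals, so each of them marks a boundary
between literals. -/
theorem exists_split_of_isLit (c : List (QLiteral u k)) {i : ℕ}
    (h : IsLit (c.flatMap encodeLiteral) i) :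
    ∃ c₁ l c₂, c = c₁ ++ l :: c₂ ∧ i = (c₁.flatMap encodeLiteral).length := by
  induction c generalizing i with
  | nil => simp [IsLit] at h
  | cons l c ih =>
    rw [List.flatMap_cons] at h
    by_cases hi : i < (encodeLiteral l).length
    · rw [isLit_append_left hi, encodeLiteral_isLit] at h
      exact ⟨[], l, c, rfl, by simpa⟩
    · obtain ⟨j, rfl⟩ := Nat.exists_eq_add_of_le (not_lt.1 hi)
      rw [isLit_append_right] at h
      obtain ⟨c₁, l', c₂, rfl, rfl⟩ := ih h
      exact ⟨l :: c₁, l', c₂, rfl, by simp⟩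

theorem card_isLit (c : List (QLiteral u k)) (p : DecidablePred (IsLit (c.flatMap encodeLiteral))) :
    ((Finset.range (c.flatMap encodeLiteral).length).filter
      (IsLit (c.flatMap encodeLiteral))).card = c.length := by
  classical
  induction c with
  | nil => simp
  | cons l c ih =>
    have ih := ih inferInstance
    rw [Finset.card_filter] at ih ⊢
    simp only [List.flatMap_cons, List.length_append] at ih ⊢
    rw [Finset.sum_range_add, List.length_cons, Nat.add_comm c.length, ← ih]
    congr 1
    · rw [Finset.sum_eq_single_of_mem 0 (by simpa using encodeLiteral_length_pos l)]
      · rw [if_pos]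
        rw [isLit_append_left (encodeLiteral_length_pos l), encodeLiteral_isLit]
      · intro b hb h0
        rw [if_neg]
        rw [isLit_append_left (by simpa using hb), encodeLiteral_isLit]
        exact h0
    · refine Finset.sum_congr rfl fun i _ => ?_
      simp only [isLit_append_right]

/-- A literal is followed by a sign or an end marker, which delimits its unary index. -/
theorem literals_head_ne_tick (c : List (QLiteral u k)) (R : List QSymbol) :
    (c.flatMap encodeLiteral ++ QSymbol.close :: R).head? ≠ some QSymbol.tick := by
  cases c with
  | nil => simp
  | cons l c =>
    rw [List.flatMap_cons, encodeLiteral_eq]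
    cases l.2 <;> simp

theorem litAt_of_split {A R : List QSymbol} (c₁ c₂ : List (QLiteral u k)) (l : QLiteral u k) :
    LitAt (A ++ ((c₁ ++ l :: c₂).flatMap encodeLiteral ++ QSymbol.close :: R))
      (A.length + (c₁.flatMap encodeLiteral).length) l := by
  refine ⟨c₂.flatMap encodeLiteral ++ QSymbol.close :: R, ?_, literals_head_ne_tick _ _⟩
  rw [List.flatMap_append, List.flatMap_cons]
  have : A ++ (c₁.flatMap encodeLiteral ++ (encodeLiteral l ++ c₂.flatMap encodeLiteral) ++
      QSymbol.close :: R) = (A ++ c₁.flatMap encodeLiteral) ++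
        (encodeLiteral l ++ (c₂.flatMap encodeLiteral ++ QSymbol.close :: R)) := by
    simp
  rw [this, ← List.length_append, List.drop_left]

/-- By `hA`, an end marker inside `A` separates every literal of `A` from `q`, so exactly the
literals of the last segment `C` remain. -/
theorem inClause_iff {A C R : List QSymbol} {q r : ℕ}
    (hA : ∀ r < A.length, IsLit A r → ∃ i < A.length, r ≤ i ∧ A[i]? = some QSymbol.close)
    (hC : ∀ i : ℕ, C[i]? ≠ some QSymbol.close) (hq : q = A.length + C.length) :
    InClause (A ++ (C ++ QSymbol.close :: R)) q r ↔ ∃ i < C.length, r = A.length + i ∧ IsLit C i := by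
  constructor
  · rintro ⟨hr, hl, hn⟩
    rcases lt_or_ge r A.length with h | h
    · rw [isLit_append_left h] at hl
      obtain ⟨i, hi, hri, hc⟩ := hA r h hl
      refine absurd ?_ (hn i (by omega) hri)
      rwa [List.getElem?_append_left hi]
    · obtain ⟨i, rfl⟩ := Nat.exists_eq_add_of_le h
      have hi : i < C.length := by omega
      rw [isLit_append_right, isLit_append_left hi] at hl
      exact ⟨i, hi, rfl, hl⟩
  · rintro ⟨i, hi, rfl, hl⟩
    refine ⟨by omega, ?_, fun j hj hij => ?_⟩
    · rwa [isLit_append_right, isLit_append_left hi]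
    · rw [List.getElem?_append_right (by omega), List.getElem?_append_left (by omega)]
      exact hC _

theorem clauseAt_of_split {A R : List QSymbol} (c : List (QLiteral u k))
    (hA : ∀ r < A.length, IsLit A r → ∃ i < A.length, r ≤ i ∧ A[i]? = some QSymbol.close) :
    ClauseAt (A ++ (c.flatMap encodeLiteral ++ QSymbol.close :: R))
      (A.length + (c.flatMap encodeLiteral).length) c where
  lt := by simp
  close := by
    rw [List.getElem?_append_right (by omega), List.getElem?_append_right (by omega)]
    simp
  exists_lit r hr := by
    rw [inClause_iff hA (literals_getElem_ne_close c) rfl] at hr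
    obtain ⟨i, hi, rfl, hl⟩ := hr
    obtain ⟨c₁, l, c₂, rfl, rfl⟩ := exists_split_of_isLit c hl
    exact ⟨l, by simp, litAt_of_split c₁ c₂ l⟩
  exists_pos l hl := by
    obtain ⟨c₁, c₂, rfl⟩ := List.append_of_mem hl
    refine ⟨_, ?_, litAt_of_split c₁ c₂ l⟩
    rw [inClause_iff hA (literals_getElem_ne_close _) rfl]
    have hpos := encodeLiteral_length_pos l
    refine ⟨(c₁.flatMap encodeLiteral).length, ?_, rfl, ?_⟩
    · rw [List.flatMap_append, List.flatMap_cons, List.length_append, List.length_append]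
      omega
    · have := isLit_append_right (s := c₁.flatMap encodeLiteral)
        (s' := (l :: c₂).flatMap encodeLiteral) (i := 0)
      rw [List.flatMap_append]
      rw [Nat.add_zero] at this
      rw [this, List.flatMap_cons, isLit_append_left hpos, encodeLiteral_isLit]
  card p := by
    classical
    rw [← card_isLit c inferInstance]
    symm
    apply Finset.card_bij (fun i _ => A.length + i)
    · intro i hi
      simp only [Finset.mem_filter, Finset.mem_range] at hi ⊢
      refine ⟨?_, (inClause_iff hA (literals_getElem_ne_close c) rfl).2 ⟨i, hi.1, rfl, hi.2⟩⟩
      rw [List.length_append, List.length_append]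
      omega
    · intro i _ j _ h
      omega
    · intro r hr
      simp only [Finset.mem_filter, Finset.mem_range] at hr ⊢
      obtain ⟨i, hi, rfl, hl⟩ := (inClause_iff hA (literals_getElem_ne_close c) rfl).1 hr.2
      exact ⟨i, ⟨hi, hl⟩, rfl⟩

theorem exists_split_of_close (m : List (List (QLiteral u k))) {i : ℕ}
    (h : (m.flatMap encodeClause)[i]? = some QSymbol.close) :
    ∃ m₁ c m₂, m = m₁ ++ c :: m₂ ∧
      i = (m₁.flatMap encodeClause).length + (c.flatMap encodeLiteral).length := by
  induction m generalizing i with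
  | nil => simp at h
  | cons c m ih =>
    rw [List.flatMap_cons] at h
    have hlen : (encodeClause c).length = (c.flatMap encodeLiteral).length + 1 := by
      simp [encodeClause]
    rcases lt_trichotomy i (c.flatMap encodeLiteral).length with hi | rfl | hi
    · rw [List.getElem?_append_left (by omega), encodeClause, List.getElem?_append_left hi] at h
      exact absurd h (literals_getElem_ne_close c i)
    · exact ⟨[], c, m, rfl, by simp⟩
    · obtain ⟨j, rfl⟩ : ∃ j, i = (encodeClause c).length + j := ⟨i - (encodeClause c).length, by omega⟩
      rw [List.getElem?_append_right (by omega), Nat.add_sub_cancel_left] at h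
      obtain ⟨m₁, c', m₂, rfl, rfl⟩ := ih h
      exact ⟨c :: m₁, c', m₂, rfl, by simp [Nat.add_assoc]⟩

end Positions

/-! ### The predicates on words, read on the code of a formula. -/

variable (φ : ForallExistsQBF)

/-- The code of the quantifier prefix. -/
def prefixCode : List QSymbol := List.replicate φ.u QSymbol.all ++ List.replicate φ.k QSymbol.ex

theorem encode_eq : φ.encode = φ.prefixCode ++ φ.matrix.flatMap encodeClause := rfl

theorem mem_prefixCode {c : QSymbol} (h : c ∈ φ.prefixCode) : c = QSymbol.all ∨ c = QSymbol.ex := by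
  rw [prefixCode, List.mem_append] at h
  exact h.imp (fun h => List.eq_of_mem_replicate h) fun h => List.eq_of_mem_replicate h

theorem not_isLit_prefixCode (r : ℕ) : ¬ IsLit φ.prefixCode r := by
  rintro (h | h) <;> rcases φ.mem_prefixCode (List.mem_of_getElem? h) with h | h <;> cases h

/-- The quantifier prefix contains no sign symbol, and as soon as a clause has been written the word
ends with an end marker. -/
theorem close_before (m : List (List (QLiteral φ.u φ.k))) (r : ℕ)
    (hr : r < (φ.prefixCode ++ m.flatMap encodeClause).length)
    (h : IsLit (φ.prefixCode ++ m.flatMap encodeClause) r) :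
    ∃ i < (φ.prefixCode ++ m.flatMap encodeClause).length, r ≤ i ∧
      (φ.prefixCode ++ m.flatMap encodeClause)[i]? = some QSymbol.close := by
  rcases List.eq_nil_or_concat m with rfl | ⟨m, c, rfl⟩
  · rw [List.flatMap_nil, List.append_nil] at h
    exact absurd h (φ.not_isLit_prefixCode r)
  · rw [List.concat_eq_append] at hr h ⊢
    refine ⟨(φ.prefixCode ++ (m ++ [c]).flatMap encodeClause).length - 1, by omega, by omega, ?_⟩
    rw [← List.getLast?_eq_getElem?]
    simp [encodeClause, ← List.append_assoc]

theorem clauseAt_of_matrix_eq {m₁ m₂ : List (List (QLiteral φ.u φ.k))} {c : List (QLiteral φ.u φ.k)}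
    (h : φ.matrix = m₁ ++ c :: m₂) : ClauseAt φ.encode
      ((φ.prefixCode ++ m₁.flatMap encodeClause).length + (c.flatMap encodeLiteral).length) c := by
  have : φ.encode = (φ.prefixCode ++ m₁.flatMap encodeClause) ++
      (c.flatMap encodeLiteral ++ QSymbol.close :: m₂.flatMap encodeClause) := by
    rw [encode_eq, h]
    simp [encodeClause]
  rw [this]
  exact clauseAt_of_split c (φ.close_before m₁)

theorem exists_clauseAt {c : List (QLiteral φ.u φ.k)} (hc : c ∈ φ.matrix) :
    ∃ q, ClauseAt φ.encode q c := by
  obtain ⟨m₁, m₂, h⟩ := List.append_of_mem hc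
  exact ⟨_, φ.clauseAt_of_matrix_eq h⟩

theorem exists_clause_of_close {q : ℕ} (h : φ.encode[q]? = some QSymbol.close) :
    ∃ c ∈ φ.matrix, ClauseAt φ.encode q c := by
  rcases lt_or_ge q φ.prefixCode.length with hq | hq
  · rw [encode_eq, List.getElem?_append_left hq] at h
    rcases φ.mem_prefixCode (List.mem_of_getElem? h) with h | h <;> cases h
  · rw [encode_eq, List.getElem?_append_right hq] at h
    obtain ⟨m₁, c, m₂, hm, hi⟩ := exists_split_of_close _ h
    refine ⟨c, by simp [hm], ?_⟩
    have := φ.clauseAt_of_matrix_eq hm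
    rw [List.length_append] at this
    rwa [show q = φ.prefixCode.length + (m₁.flatMap encodeClause).length
      + (c.flatMap encodeLiteral).length by omega]

/-- Existential markers inside the matrix directly follow a sign; this distinguishes them from the
quantifiers of the prefix. The property passes to concatenations, so single literals suffice. -/
theorem isLit_before_ex (i : ℕ)
    (h : (φ.matrix.flatMap encodeClause)[i]? = some QSymbol.ex) :
    ∃ j, i = j + 1 ∧ IsLit (φ.matrix.flatMap encodeClause) j := by
  let P : List QSymbol → Prop := fun s => ∀ i : ℕ, s[i]? = some QSymbol.ex → ∃ j, i = j + 1 ∧ IsLit s j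
  have happ : ∀ s s', P s → P s' → P (s ++ s') := by
    intro s s' hs hs' i hi
    rcases lt_or_ge i s.length with h | h
    · rw [List.getElem?_append_left h] at hi
      obtain ⟨j, rfl, hj⟩ := hs i hi
      exact ⟨j, rfl, (isLit_append_left (by omega)).2 hj⟩
    · rw [List.getElem?_append_right h] at hi
      obtain ⟨j, hij, hj⟩ := hs' _ hi
      exact ⟨s.length + j, by omega, isLit_append_right.2 hj⟩
  have hnil : P [] := fun i hi => by simp at hi
  have hflat : ∀ {α : Type} (f : α → List QSymbol), (∀ a, P (f a)) → ∀ l : List α, P (l.flatMap f) := by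
    intro α f hf l
    induction l with
    | nil => exact hnil
    | cons a l ih => exact happ _ _ (hf a) ih
  refine hflat encodeClause (fun c => happ _ _ (hflat encodeLiteral (fun l => ?_) c) ?_) _ i h
  · intro i hi
    rw [encodeLiteral_eq] at hi
    rcases i with _ | _ | i
    · cases hl : l.2 <;> simp [hl] at hi
    · exact ⟨0, rfl, (encodeLiteral_isLit l 0).2 rfl⟩
    · simp [List.getElem?_replicate] at hi
  · intro i hi
    rcases i with _ | i <;> simp at hi

/-- The counted positions are exactly the block of existential quantifiers: nothing in the prefix is
a sign, which also covers `i = 0` where `i - 1` is truncated, and in the matrix each existential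
marker follows a sign. -/
theorem numEx_encode : numEx φ.encode = φ.k := by
  classical
  have hlen : φ.prefixCode.length = φ.u + φ.k := by simp [prefixCode]
  have hlen' : φ.encode.length = φ.u + φ.k + (φ.matrix.flatMap encodeClause).length := by
    rw [encode_eq, List.length_append, hlen]
  rw [numEx]
  have : (Finset.range φ.encode.length).filter
      (fun i => φ.encode[i]? = some QSymbol.ex ∧ ¬ IsLit φ.encode (i - 1))
      = Finset.Ico φ.u (φ.u + φ.k) := by
    ext i
    simp only [Finset.mem_filter, Finset.mem_range, Finset.mem_Ico]
    rcases lt_or_ge i (φ.u + φ.k) with hi | hi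
    · rw [encode_eq, List.getElem?_append_left (by omega), isLit_append_left (by omega),
        ← encode_eq, prefixCode]
      have hn := φ.not_isLit_prefixCode (i - 1)
      rcases lt_or_ge i φ.u with hu | hu
      · rw [List.getElem?_append_left (by simpa)]
        simp [hu]
      · rw [List.getElem?_append_right (by simpa)]
        simp only [prefixCode] at hn
        simp [hn, List.getElem?_replicate]
        omega
    · rw [encode_eq, List.getElem?_append_right (by omega)]
      constructor
      · rintro ⟨_, h1, h2⟩
        obtain ⟨j, hj, hl⟩ := φ.isLit_before_ex _ h1
        refine absurd ?_ h2
        rw [show i - 1 = φ.prefixCode.length + j by omega]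
        exact isLit_append_right.2 hl
      · omega
  rw [this]
  simp

theorem length_le_width {c : List (QLiteral φ.u φ.k)} (hc : c ∈ φ.matrix) :
    c.length ≤ width φ.encode := by
  classical
  obtain ⟨q, hq⟩ := φ.exists_clauseAt hc
  have hcard := hq.card inferInstance
  have hle : c.length ≤ φ.encode.length := by
    rw [← hcard]
    exact (Finset.card_filter_le _ _).trans (by simp)
  rw [width]
  calc c.length = (Finset.range c.length).card := by simp
    _ ≤ _ := Finset.card_le_card fun j hj => by
      simp only [Finset.mem_filter, Finset.mem_range] at hj ⊢
      refine ⟨by omega, q, hq.lt, hq.close, ?_⟩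
      have : (Finset.filter (fun r => InClause φ.encode q r) (Finset.range φ.encode.length)).card
        = c.length := hq.card _
      omega

theorem width_le_of_isCNF {d : ℕ} (h : φ.IsCNF d) : width φ.encode ≤ d := by
  classical
  rw [width]
  calc _ ≤ (Finset.range d).card := Finset.card_le_card fun j hj => by
        simp only [Finset.mem_filter, Finset.mem_range] at hj ⊢
        obtain ⟨_, q, _, hq, hj⟩ := hj
        obtain ⟨c, hc, hqc⟩ := φ.exists_clause_of_close hq
        have := h c hc
        have : (Finset.filter (fun r => InClause φ.encode q r)
          (Finset.range φ.encode.length)).card = c.length := hqc.card _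
        omega
    _ = d := by simp

/-- Two clauses of `φ` can simultaneously be falsified on their universal literals, and every
existential literal of the first is complementary to every existential literal of the second. -/
def Clash : Prop :=
  ∃ c ∈ φ.matrix, ∃ c' ∈ φ.matrix,
    (∀ l : QLiteral φ.u φ.k, (l ∈ c ∨ l ∈ c') ∧ ¬ l.1.isRight = true →
      ∀ l' : QLiteral φ.u φ.k, (l' ∈ c ∨ l' ∈ c') ∧ ¬ l'.1.isRight = true →
        ¬ (l.1 = l'.1 ∧ l.2 ≠ l'.2)) ∧
    ∀ l ∈ c, l.1.isRight = true → ∀ l' ∈ c', l'.1.isRight = true → l.1 = l'.1 ∧ l.2 ≠ l'.2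

/-- Each literal of a clause has a position and each literal position of a clause carries one of its
literals. Only membership matters, so repeated literals are harmless. -/
theorem hasClash_encode : HasClash φ.encode ↔ φ.Clash := by
  have key : ∀ {q q' : ℕ} {c c' : List (QLiteral φ.u φ.k)}, ClauseAt φ.encode q c →
      ClauseAt φ.encode q' c' →
      (((∀ r < φ.encode.length, (InClause φ.encode q r ∨ InClause φ.encode q' r) ∧
          ¬ IsEx φ.encode r → ∀ s < φ.encode.length,
          (InClause φ.encode q s ∨ InClause φ.encode q' s) ∧ ¬ IsEx φ.encode s →
          ¬ Complementary φ.encode r s) ∧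
        ∀ r < φ.encode.length, InClause φ.encode q r ∧ IsEx φ.encode r →
          ∀ s < φ.encode.length, InClause φ.encode q' s ∧ IsEx φ.encode s →
          Complementary φ.encode r s) ↔
      (∀ l : QLiteral φ.u φ.k, (l ∈ c ∨ l ∈ c') ∧ ¬ l.1.isRight = true →
        ∀ l' : QLiteral φ.u φ.k, (l' ∈ c ∨ l' ∈ c') ∧ ¬ l'.1.isRight = true →
          ¬ (l.1 = l'.1 ∧ l.2 ≠ l'.2)) ∧
      ∀ l ∈ c, l.1.isRight = true → ∀ l' ∈ c', l'.1.isRight = true → l.1 = l'.1 ∧ l.2 ≠ l'.2) := by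
    intro q q' c c' hc hc'
    have hlt : ∀ {r}, InClause φ.encode q r ∨ InClause φ.encode q' r → r < φ.encode.length := by
      rintro r (h | h)
      · exact h.1.trans hc.lt
      · exact h.1.trans hc'.lt
    have hto : ∀ {r}, InClause φ.encode q r ∨ InClause φ.encode q' r →
        ∃ l, (l ∈ c ∨ l ∈ c') ∧ LitAt φ.encode r l := by
      rintro r (h | h)
      · obtain ⟨l, hl, h⟩ := hc.exists_lit r h
        exact ⟨l, .inl hl, h⟩
      · obtain ⟨l, hl, h⟩ := hc'.exists_lit r h
        exact ⟨l, .inr hl, h⟩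
    have hof : ∀ {l}, l ∈ c ∨ l ∈ c' →
        ∃ r, (InClause φ.encode q r ∨ InClause φ.encode q' r) ∧ LitAt φ.encode r l := by
      rintro l (h | h)
      · obtain ⟨r, hr, h⟩ := hc.exists_pos l h
        exact ⟨r, .inl hr, h⟩
      · obtain ⟨r, hr, h⟩ := hc'.exists_pos l h
        exact ⟨r, .inr hr, h⟩
    constructor
    · rintro ⟨h1, h2⟩
      constructor
      · rintro l ⟨hl, hle⟩ l' ⟨hl', hle'⟩
        obtain ⟨r, hr, hrl⟩ := hof hl
        obtain ⟨s, hs, hsl⟩ := hof hl'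
        rw [← hrl.complementary hsl]
        exact h1 r (hlt hr) ⟨hr, by rwa [hrl.isEx]⟩ s (hlt hs) ⟨hs, by rwa [hsl.isEx]⟩
      · intro l hl hle l' hl' hle'
        obtain ⟨r, hr, hrl⟩ := hc.exists_pos l hl
        obtain ⟨s, hs, hsl⟩ := hc'.exists_pos l' hl'
        rw [← hrl.complementary hsl]
        exact h2 r (hlt (.inl hr)) ⟨hr, by rwa [hrl.isEx]⟩ s (hlt (.inr hs))
          ⟨hs, by rwa [hsl.isEx]⟩
    · rintro ⟨h1, h2⟩
      constructor
      · rintro r _ ⟨hr, hre⟩ s _ ⟨hs, hse⟩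
        obtain ⟨l, hl, hrl⟩ := hto hr
        obtain ⟨l', hl', hsl⟩ := hto hs
        rw [hrl.complementary hsl]
        exact h1 l ⟨hl, by rwa [← hrl.isEx]⟩ l' ⟨hl', by rwa [← hsl.isEx]⟩
      · rintro r _ ⟨hr, hre⟩ s _ ⟨hs, hse⟩
        obtain ⟨l, hl, hrl⟩ := hc.exists_lit r hr
        obtain ⟨l', hl', hsl⟩ := hc'.exists_lit s hs
        rw [hrl.complementary hsl]
        exact h2 l hl (by rwa [← hrl.isEx]) l' hl' (by rwa [← hsl.isEx])
  constructor
  · rintro ⟨q, _, hq, q', _, hq', h⟩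
    obtain ⟨c, hc, hqc⟩ := φ.exists_clause_of_close hq
    obtain ⟨c', hc', hqc'⟩ := φ.exists_clause_of_close hq'
    exact ⟨c, hc, c', hc', (key hqc hqc').1 h⟩
  · rintro ⟨c, hc, c', hc', h⟩
    obtain ⟨q, hq⟩ := φ.exists_clauseAt hc
    obtain ⟨q', hq'⟩ := φ.exists_clauseAt hc'
    exact ⟨q, hq.lt, hq.close, q', hq'.lt, hq'.close, (key hq hq').2 h⟩

/-- The assignment to the universal variables that makes those variables true whose index is
modulo `p` one of the last `t` digits of `Y` to the base `Q`. -/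
def residueAssignment (Q t p Y : ℕ) (i : Fin φ.u) : Bool :=
  decide (∃ j < t, Y / Q ^ j % Q = i.val % p)

/-- The assignment to the existential variables by the binary digits of a number. -/
def digitAssignment (X : ℕ) (j : Fin φ.k) : Bool := decide (X / 2 ^ j.val % 2 ≠ 0)

theorem LitAt.litFalse_iff {w : List QSymbol} {r Q t p Y X : ℕ} {l : QLiteral φ.u φ.k}
    (h : LitAt w r l) : LitFalse w Q t p Y X r ↔
      Sum.elim (φ.residueAssignment Q t p Y) (φ.digitAssignment X) l.1 ≠ l.2 := by
  rw [LitFalse, h.getElem, h.isEx, h.varIdx]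
  obtain ⟨i | j, b⟩ := l
  · simp only [varIndex, residueAssignment, Sum.elim_inl, Sum.isRight_inl]
    cases b <;> simp
  · simp only [varIndex, digitAssignment, Sum.elim_inr, Sum.isRight_inr]
    cases b <;> simp

theorem refutes_encode (k Q t : ℕ) : Refutes φ.encode k Q t ↔ ∃ p < Q, p ≠ 0 ∧ ∃ Y < Q ^ t,
    ∀ X < 2 ^ k, ¬ φ.Satisfies (φ.residueAssignment Q t p Y) (φ.digitAssignment X) := by
  refine exists_congr fun p => and_congr_right fun _ => and_congr_right fun _ =>
    exists_congr fun Y => and_congr_right fun _ => forall_congr' fun X => imp_congr_right fun _ => ?_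
  rw [Satisfies]
  push Not
  constructor
  · rintro ⟨q, _, hq, h⟩
    obtain ⟨c, hc, hqc⟩ := φ.exists_clause_of_close hq
    refine ⟨c, hc, fun l hl => ?_⟩
    obtain ⟨r, hr, hrl⟩ := hqc.exists_pos l hl
    exact (LitAt.litFalse_iff φ hrl).1 (h r (hr.1.trans hqc.lt) hr)
  · rintro ⟨c, hc, h⟩
    obtain ⟨q, hq⟩ := φ.exists_clauseAt hc
    refine ⟨q, hq.lt, hq.close, fun r _ hr => ?_⟩
    obtain ⟨l, hl, hrl⟩ := hq.exists_lit r hr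
    exact (LitAt.litFalse_iff φ hrl).2 (h l hl)

end ForallExistsQBF

/-! ### Moduli that separate a small set of numbers -/

/-- Cancel `2 * n` in `2 * n * 2 ^ n ≤ 4 ^ n ≤ 2 * n * n.centralBinom`. -/
theorem two_pow_le_centralBinom {n : ℕ} (hn : 0 < n) : 2 ^ n ≤ n.centralBinom := by
  have h1 := Nat.four_pow_le_two_mul_self_mul_centralBinom n hn
  have h2 : 2 * n ≤ 2 ^ n := by
    induction n with
    | zero => simp
    | succ n ih =>
      rcases Nat.eq_zero_or_pos n with rfl | h
      · simp
      · have := ih h (Nat.four_pow_le_two_mul_self_mul_centralBinom n h)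
        rw [pow_succ]
        have : 1 < 2 ^ n := Nat.one_lt_two_pow h.ne'
        omega
  have h3 : 2 * n * 2 ^ n ≤ 2 * n * n.centralBinom := by
    calc 2 * n * 2 ^ n ≤ 2 ^ n * 2 ^ n := Nat.mul_le_mul_right _ h2
      _ = 4 ^ n := by rw [← mul_pow]; norm_num
      _ ≤ _ := h1
  exact Nat.le_of_mul_le_mul_left h3 (by omega)

/-- A number that is divisible by all of `1, …, 2 n` is divisible by the central binomial
coefficient. -/
theorem centralBinom_dvd {n m : ℕ} (hn : 0 < n) (h : ∀ q, 0 < q → q ≤ 2 * n → q ∣ m) :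
    n.centralBinom ∣ m := by
  rw [Nat.dvd_iff_prime_pow_dvd_dvd]
  intro p i hp hi
  apply h _ (pow_pos hp.pos _)
  rw [hp.pow_dvd_iff_le_factorization (Nat.centralBinom_ne_zero n)] at hi
  -- A prime power dividing the central binomial coefficient is at most `2 * n`, hence among the
  -- assumed divisors.
  exact (Nat.pow_le_pow_right hp.pos hi).trans
    (Nat.pow_factorization_choose_le (by omega : 0 < 2 * n))

/-- Put `n = a * (t * t) + 1`. If no modulus up to `2 * n` separates `V`, each of them divides some
difference and thus the nonzero product of all differences, which is at most `2 ^ (n - 1)`. Then the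
central binomial coefficient of `n` divides it too, although it is at least `2 ^ n`. -/
theorem exists_injOn_mod (V : Finset ℕ) (a t : ℕ) (hV : ∀ v ∈ V, v < 2 ^ a) (ht : V.card ≤ t) :
    ∃ p, p ≠ 0 ∧ p < 2 * (a * (t * t) + 1) + 1 ∧ Set.InjOn (fun v => v % p) (V : Set ℕ) := by
  by_contra hcon
  push Not at hcon
  have hdvd : ∀ q, 0 < q → q ≤ 2 * (a * (t * t) + 1) → q ∣ ∏ z ∈ V.offDiag, Nat.dist z.1 z.2 := by
    intro q hq hq'
    have := hcon q hq.ne' (by omega)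
    rw [Set.InjOn] at this
    push Not at this
    obtain ⟨v, hv, v', hv', hmod, hne⟩ := this
    refine dvd_trans ?_ (Finset.dvd_prod_of_mem _
      (Finset.mem_offDiag.2 ⟨hv, hv', hne⟩ : (v, v') ∈ V.offDiag))
    rcases le_total v v' with h | h
    · rw [Nat.dist_eq_sub_of_le h]
      exact (Nat.modEq_iff_dvd' h).1 hmod
    · rw [Nat.dist_eq_sub_of_le_right h]
      exact (Nat.modEq_iff_dvd' h).1 hmod.symm
  have hpos : 0 < ∏ z ∈ V.offDiag, Nat.dist z.1 z.2 := Finset.prod_pos fun z hz =>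
    Nat.dist_pos_of_ne (Finset.mem_offDiag.1 hz).2.2
  have hle : ∏ z ∈ V.offDiag, Nat.dist z.1 z.2 ≤ 2 ^ (a * (t * t)) := by
    calc ∏ z ∈ V.offDiag, Nat.dist z.1 z.2 ≤ (2 ^ a) ^ V.offDiag.card :=
          Finset.prod_le_pow_card _ _ _ fun z hz => by
            obtain ⟨h1, h2, _⟩ := Finset.mem_offDiag.1 hz
            have h1 := hV _ h1
            have h2 := hV _ h2
            rw [Nat.dist]
            omega
      _ ≤ (2 ^ a) ^ (t * t) := by
          refine Nat.pow_le_pow_right (by positivity) ?_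
          rw [Finset.offDiag_card]
          exact (Nat.sub_le _ _).trans (Nat.mul_le_mul ht ht)
      _ = 2 ^ (a * (t * t)) := (pow_mul ..).symm
  have h1 := Nat.le_of_dvd hpos (centralBinom_dvd (Nat.succ_pos _) hdvd)
  have h2 := two_pow_le_centralBinom (Nat.succ_pos (a * (t * t)))
  have h3 : 2 ^ (a * (t * t)) < 2 ^ (a * (t * t)).succ := Nat.pow_lt_pow_right (by omega) (by omega)
  omega

/-- The list is read as a number to the base `Q`, least significant digit first. -/
theorem exists_digits {Q : ℕ} (L : List ℕ) (hL : ∀ x ∈ L, x < Q) :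
    ∃ Y < Q ^ L.length, ∀ (j : ℕ) (hj : j < L.length), Y / Q ^ j % Q = L[j] := by
  induction L with
  | nil => exact ⟨0, by simp⟩
  | cons x L ih =>
    obtain ⟨Y, hY, h⟩ := ih fun y hy => hL y (by simp [hy])
    have hx : x < Q := hL x (by simp)
    refine ⟨x + Q * Y, ?_, ?_⟩
    · rw [List.length_cons, pow_succ']
      have : Q * (Y + 1) ≤ Q * Q ^ L.length := Nat.mul_le_mul_left _ hY
      rw [Nat.mul_add] at this
      omega
    · intro j hj
      rcases j with _ | j
      · simp [Nat.add_mul_mod_self_left, Nat.mod_eq_of_lt hx]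
      · rw [pow_succ', ← Nat.div_div_eq_div_mul, Nat.add_mul_div_left _ _ (by omega),
          Nat.div_eq_of_lt hx, Nat.zero_add]
        exact h j _

theorem lt_two_pow_numBits (w : List QSymbol) (h : w ≠ []) : w.length < 2 ^ numBits w := by
  have hpos : w.length ≠ 0 := by simpa using h
  have : numBits w = Nat.log 2 w.length + 1 := by
    rw [numBits]
    apply Expr.card_filter_lt
    · exact Nat.log_lt_self 2 hpos
    · intro i _
      rw [← Nat.le_log_iff_pow_le (by omega) hpos]
      omega
  rw [this]
  exact Nat.lt_pow_succ_log_self (by omega) _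

theorem two_pow_numBits_le (w : List QSymbol) (h : w ≠ []) : 2 ^ numBits w ≤ 2 * w.length := by
  have hpos : w.length ≠ 0 := by simpa using h
  have : numBits w = Nat.log 2 w.length + 1 := by
    rw [numBits]
    apply Expr.card_filter_lt
    · exact Nat.log_lt_self 2 hpos
    · intro i _
      rw [← Nat.le_log_iff_pow_le (by omega) hpos]
      omega
  rw [this, pow_succ']
  exact Nat.mul_le_mul_left _ (Nat.pow_log_le_self _ hpos)

namespace ForallExistsQBF

variable (φ : ForallExistsQBF)

/-! ### Correctness of the two tests -/

theorem not_isTrue_iff : ¬ φ.IsTrue ↔ ∃ y, ∀ x, ∃ c ∈ φ.matrix, ∀ l ∈ c, Sum.elim y x l.1 ≠ l.2 := by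
  simp only [IsTrue, Satisfies]
  push Not
  rfl

/-- Let `y` falsify all universal literals of both clauses. If some `x` satisfies the first clause,
it does so by an existential literal; all existential literals of the second clause are
complementary to it and hence false. -/
theorem not_isTrue_of_clash (h : φ.Clash) : ¬ φ.IsTrue := by
  classical
  obtain ⟨c, hc, c', hc', h1, h2⟩ := h
  rw [not_isTrue_iff]
  let y : Fin φ.u → Bool := fun i => decide ((Sum.inl i, false) ∈ c ∨ (Sum.inl i, false) ∈ c')
  have hy : ∀ (i : Fin φ.u) (b : Bool), ((Sum.inl i, b) ∈ c ∨ (Sum.inl i, b) ∈ c') → y i ≠ b := by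
    intro i b hb
    cases b with
    | false =>
      have : y i = true := decide_eq_true hb
      rw [this]
      simp
    | true =>
      have : ¬ ((Sum.inl i, false) ∈ c ∨ (Sum.inl i, false) ∈ c') := fun hf =>
        h1 (Sum.inl i, true) ⟨hb, by simp⟩ (Sum.inl i, false) ⟨hf, by simp⟩ ⟨rfl, by simp⟩
      simp [y, this]
  refine ⟨y, fun x => ?_⟩
  by_cases hx : ∀ l ∈ c, Sum.elim y x l.1 ≠ l.2
  · exact ⟨c, hc, hx⟩
  · push Not at hx
    obtain ⟨⟨v, b⟩, hl, hlx⟩ := hx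
    refine ⟨c', hc', fun l' hl' => ?_⟩
    obtain ⟨v', b'⟩ := l'
    rcases v' with i | j'
    · exact hy i b' (.inr hl')
    · rcases v with i | j
      · exact absurd hlx (hy i b (.inl hl))
      · obtain ⟨hv, hb⟩ := h2 _ hl rfl _ hl' rfl
        simp only [Sum.elim_inr] at hlx hv hb ⊢
        rw [← Sum.inr.inj hv, hlx]
        exact hb

/-- Under a refuting `y`, one or two well-chosen assignments `x` already exhibit the clash: the two
constant ones if `k ≤ 1`, and the one forced by the positive unit clauses for a 1-CNF. -/
theorem clash_of_not_isTrue (h : ¬ φ.IsTrue) (hφ : φ.k ≤ 1 ∨ φ.IsCNF 1) : φ.Clash := by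
  rw [not_isTrue_iff] at h
  obtain ⟨y, hy⟩ := h
  have huniv : ∀ c c' : List (QLiteral φ.u φ.k),
      (∀ l ∈ c, l.1.isRight = true ∨ ∀ x, Sum.elim y x l.1 ≠ l.2) →
      (∀ l ∈ c', l.1.isRight = true ∨ ∀ x, Sum.elim y x l.1 ≠ l.2) →
      ∀ l : QLiteral φ.u φ.k, (l ∈ c ∨ l ∈ c') ∧ ¬ l.1.isRight = true →
      ∀ l' : QLiteral φ.u φ.k, (l' ∈ c ∨ l' ∈ c') ∧ ¬ l'.1.isRight = true →
        ¬ (l.1 = l'.1 ∧ l.2 ≠ l'.2) := by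
    rintro c c' hc hc' l ⟨hl, hle⟩ l' ⟨hl', hle'⟩ ⟨hv, hb⟩
    have f1 : ∀ l, (l ∈ c ∨ l ∈ c') → ¬ l.1.isRight = true → ∀ x, Sum.elim y x l.1 ≠ l.2 :=
      fun l hl hle => by
        rcases hl with hl | hl
        · exact (hc l hl).resolve_left hle
        · exact (hc' l hl).resolve_left hle
    have e1 := f1 l hl hle (fun _ => true)
    have e2 := f1 l' hl' hle' (fun _ => true)
    rw [hv] at e1
    revert e1 e2 hb
    cases Sum.elim y (fun _ => true) l'.1 <;> cases l.2 <;> cases l'.2 <;> simp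
  have hfals : ∀ (c : List (QLiteral φ.u φ.k)) (x : Fin φ.k → Bool),
      (∀ l ∈ c, Sum.elim y x l.1 ≠ l.2) →
      ∀ l ∈ c, l.1.isRight = true ∨ ∀ x, Sum.elim y x l.1 ≠ l.2 := by
    rintro c x hc ⟨i | j, b⟩ hl
    · exact .inr fun _ => hc _ hl
    · exact .inl rfl
  rcases hφ with hk | hd
  -- A clause falsified by all-false has only positive existential literals, one falsified by
  -- all-true only negative ones, and there is at most one variable.
  · obtain ⟨c, hc, hcx⟩ := hy fun _ => false
    obtain ⟨c', hc', hcx'⟩ := hy fun _ => true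
    refine ⟨c, hc, c', hc', huniv c c' (hfals c _ hcx) (hfals c' _ hcx'), ?_⟩
    rintro ⟨i | j, b⟩ hl hle ⟨i' | j', b'⟩ hl' hle'
    · simp at hle
    · simp at hle
    · simp at hle'
    · have e1 := hcx _ hl
      have e2 := hcx' _ hl'
      refine ⟨congrArg Sum.inr (Fin.ext (by omega)), ?_⟩
      simp only [Sum.elim_inr] at e1 e2 ⊢
      revert e1 e2
      cases b <;> cases b' <;> simp
  · classical
    -- A falsified existential unit clause must be negative, and then its positive counterpart is in
    -- the matrix. A falsified clause without existential literals clashes with itself.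
    obtain ⟨c, hc, hcx⟩ := hy fun j => decide ([(Sum.inr j, true)] ∈ φ.matrix)
    by_cases he : ∃ l ∈ c, l.1.isRight = true
    · obtain ⟨⟨v, b⟩, hl, hle⟩ := he
      have hlen := hd c hc
      obtain ⟨l₀, rfl⟩ : ∃ l₀, c = [l₀] := by
        rcases c with _ | ⟨l₀, _ | ⟨l₁, c⟩⟩
        · simp at hl
        · exact ⟨l₀, rfl⟩
        · simp at hlen
      rw [List.mem_singleton] at hl
      subst hl
      rcases v with i | j
      · simp at hle
      have e := hcx (Sum.inr j, b) (by simp)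
      simp only [Sum.elim_inr] at e
      have hb : b = false := by
        cases b with
        | false => rfl
        | true => exact absurd (decide_eq_true hc) e
      subst hb
      have hc' : [(Sum.inr j, true)] ∈ φ.matrix := by simpa using e
      refine ⟨_, hc, _, hc', huniv _ _ ?_ ?_, ?_⟩
      · intro l hl
        rw [List.mem_singleton] at hl
        exact .inl (hl ▸ rfl)
      · intro l hl
        rw [List.mem_singleton] at hl
        exact .inl (hl ▸ rfl)
      · intro l hl _ l' hl' _
        rw [List.mem_singleton] at hl hl'
        subst hl hl'
        simp
    · push Not at he
      refine ⟨c, hc, c, hc, huniv c c (hfals c _ hcx) (hfals c _ hcx), ?_⟩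
      intro l hl hle
      exact absurd hle (he l hl)

theorem exists_digitAssignment (x : Fin φ.k → Bool) : ∃ X < 2 ^ φ.k, φ.digitAssignment X = x := by
  obtain ⟨X, hX, h⟩ := exists_digits (Q := 2) (List.ofFn fun j => if x j = true then 1 else 0) (by
    intro z hz
    obtain ⟨j, rfl⟩ := (List.mem_ofFn' _ _).1 hz
    dsimp only
    split_ifs <;> omega)
  rw [List.length_ofFn] at hX
  refine ⟨X, hX, ?_⟩
  funext j
  have := h j.val (by simp)
  rw [digitAssignment, this]
  simp

/-- Soundness needs nothing about `Q` and `t`: a candidate is a genuine assignment, and the numbers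
`X` exhaust all assignments `x`. -/
theorem not_isTrue_of_refutes {Q t : ℕ} (h : Refutes φ.encode φ.k Q t) : ¬ φ.IsTrue := by
  rw [refutes_encode] at h
  obtain ⟨p, _, _, Y, _, h⟩ := h
  intro ht
  obtain ⟨x, hx⟩ := ht (φ.residueAssignment Q t p Y)
  obtain ⟨X, hX, rfl⟩ := φ.exists_digitAssignment x
  exact h X hX hx

/-! ### Completeness of the search: small support and hashing. -/

/-- The existential literals of a clause. -/
def exPart {u k : ℕ} (c : List (QLiteral u k)) : List (Fin k × Bool) :=
  c.filterMap fun l => Sum.elim (fun _ => none) (fun j => some (j, l.2)) l.1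

/-- The indices of the universal variables of a clause. -/
def univIndices {u k : ℕ} (c : List (QLiteral u k)) : List ℕ :=
  c.filterMap fun l => Sum.elim (fun i => some i.val) (fun _ => none) l.1

theorem mem_exPart {u k : ℕ} {c : List (QLiteral u k)} {j : Fin k} {b : Bool} :
    (j, b) ∈ exPart c ↔ (Sum.inr j, b) ∈ c := by
  rw [exPart, List.mem_filterMap]
  constructor
  · rintro ⟨⟨i | j', b'⟩, hl, h⟩
    · simp at h
    · simp only [Sum.elim_inr, Option.some.injEq, Prod.mk.injEq] at h
      obtain ⟨rfl, rfl⟩ := h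
      exact hl
  · intro h
    exact ⟨_, h, rfl⟩

theorem mem_univIndices {u k : ℕ} {c : List (QLiteral u k)} {i : Fin u} {b : Bool}
    (h : (Sum.inl i, b) ∈ c) : i.val ∈ univIndices c := by
  rw [univIndices, List.mem_filterMap]
  exact ⟨_, h, rfl⟩

theorem lt_of_mem_univIndices {u k : ℕ} {c : List (QLiteral u k)} {v : ℕ}
    (h : v ∈ univIndices c) : v < u := by
  rw [univIndices, List.mem_filterMap] at h
  obtain ⟨⟨i | j, b⟩, _, h⟩ := h
  · simp only [Sum.elim_inl, Option.some.injEq] at h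
    omega
  · simp at h

theorem length_exPart_add {u k : ℕ} (c : List (QLiteral u k)) :
    (exPart c).length + (univIndices c).length = c.length := by
  induction c with
  | nil => rfl
  | cons l c ih =>
    obtain ⟨i | j, b⟩ := l
    · simp only [exPart, univIndices, List.filterMap_cons, Sum.elim_inl, List.length_cons] at ih ⊢
      omega
    · simp only [exPart, univIndices, List.filterMap_cons, Sum.elim_inr, List.length_cons] at ih ⊢
      omega

/-- A list of length at most `n` is determined by its first `n` entries, where `none` stands for a
missing one; this accounts for the `+ 1` in the base. -/
theorem card_le_of_length_le {α : Type*} [Fintype α] (E : Finset (List α)) (n : ℕ)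
    (h : ∀ e ∈ E, e.length ≤ n) : E.card ≤ (Fintype.card α + 1) ^ n := by
  classical
  calc E.card ≤ (Finset.univ : Finset (Fin n → Option α)).card := by
        refine Finset.card_le_card_of_injOn (fun e i => e[i.val]?) (fun _ _ => Finset.mem_coe.2 (Finset.mem_univ _)) ?_
        intro e he e' he' hee
        apply List.ext_getElem?
        intro i
        rcases lt_or_ge i n with hi | hi
        · exact congrFun hee ⟨i, hi⟩
        · rw [List.getElem?_eq_none ((h e he).trans hi), List.getElem?_eq_none ((h e' he').trans hi)]
    _ = (Fintype.card α + 1) ^ n := by simp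

/-- Whether an assignment to the universal variables makes the matrix unsatisfiable depends on few
variables only. -/
theorem exists_support {d : ℕ} (hd : φ.IsCNF d) {y : Fin φ.u → Bool}
    (hy : ∀ x, ∃ c ∈ φ.matrix, ∀ l ∈ c, Sum.elim y x l.1 ≠ l.2) :
    ∃ V : Finset ℕ, V.card ≤ d * (2 * φ.k + 1) ^ (d - 1) ∧ (∀ v ∈ V, v < φ.u) ∧
      ∀ y' : Fin φ.u → Bool, (∀ i : Fin φ.u, i.val ∈ V → y' i = y i) →
        ∀ x, ∃ c ∈ φ.matrix, ∀ l ∈ c, Sum.elim y' x l.1 ≠ l.2 := by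
  classical
  -- `S` consists of the clauses with a universal literal whose universal literals are all false
  -- under `y`; `f` below picks one of them for each existential part.
  let S := φ.matrix.toFinset.filter fun c =>
    univIndices c ≠ [] ∧ ∀ i b, (Sum.inl i, b) ∈ c → y i ≠ b
  let E := S.image exPart
  have hE : ∀ e ∈ E, ∃ c ∈ S, exPart c = e := fun e he => Finset.mem_image.1 he
  choose! f hf hfe using hE
  have hS : ∀ c ∈ S, c ∈ φ.matrix ∧ univIndices c ≠ [] ∧ ∀ i b, (Sum.inl i, b) ∈ c → y i ≠ b := by
    intro c hc
    simpa [S] using hc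
  refine ⟨E.biUnion fun e => (univIndices (f e)).toFinset, ?_, ?_, ?_⟩
  · have h1 : E.card ≤ (2 * φ.k + 1) ^ (d - 1) := by
      have := card_le_of_length_le E (d - 1) fun e he => by
        -- A universal literal takes one of the `d` places, so at most `d - 1` existential ones
        -- remain; this is the source of the exponent `d - 1`.
        obtain ⟨hm, hu, _⟩ := hS _ (hf e he)
        have h1 := length_exPart_add (f e)
        rw [hfe e he] at h1
        have h2 := hd _ hm
        have h3 := List.length_pos_iff.2 hu
        omega
      rwa [Fintype.card_prod, Fintype.card_bool, Fintype.card_fin, Nat.mul_comm] at this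
    refine (Finset.card_biUnion_le_card_mul _ _ d fun e he => ?_).trans ?_
    · obtain ⟨hm, _, _⟩ := hS _ (hf e he)
      have h1 := length_exPart_add (f e)
      have h2 := hd _ hm
      exact (List.toFinset_card_le _).trans (by omega)
    · rw [Nat.mul_comm]
      exact Nat.mul_le_mul_left _ h1
  · intro v hv
    simp only [Finset.mem_biUnion, List.mem_toFinset] at hv
    obtain ⟨e, _, hv⟩ := hv
    exact lt_of_mem_univIndices hv
  · intro y' hy' x
    obtain ⟨c, hc, hcx⟩ := hy x
    by_cases hu : univIndices c = []
    · refine ⟨c, hc, ?_⟩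
      rintro ⟨i | j, b⟩ hl
      · have := mem_univIndices hl
        rw [hu] at this
        simp at this
      · exact hcx _ hl
    · have hcS : c ∈ S := by
        simp only [S, Finset.mem_filter, List.mem_toFinset]
        exact ⟨hc, hu, fun i b hl => hcx _ hl⟩
      -- The representative of `c` is falsified instead: `x` falsifies the shared existential part,
      -- and `y'` agrees with `y` on its universal variables.
      have he : exPart c ∈ E := Finset.mem_image_of_mem _ hcS
      obtain ⟨hm, _, hfy⟩ := hS _ (hf _ he)
      refine ⟨f (exPart c), hm, ?_⟩
      rintro ⟨i | j, b⟩ hl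
      · rw [Sum.elim_inl, hy' i]
        · exact hfy i b hl
        · simp only [Finset.mem_biUnion, List.mem_toFinset]
          exact ⟨_, he, mem_univIndices hl⟩
      · have h1 := mem_exPart.2 hl
        rw [hfe _ he, mem_exPart] at h1
        exact hcx _ h1

/-- Prescribe the residues of the true variables of `V`. Since the modulus separates `V`, no false
variable of `V` shares such a residue; outside `V` the values do not matter. -/
theorem exists_residueAssignment {V : Finset ℕ} {a t : ℕ} (hV : ∀ v ∈ V, v < 2 ^ a)
    (ht : V.card ≤ t) (y : Fin φ.u → Bool) :
    ∃ p < 2 * (a * (t * t) + 1) + 1, p ≠ 0 ∧ ∃ Y < (2 * (a * (t * t) + 1) + 1) ^ t,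
      ∀ i : Fin φ.u, i.val ∈ V →
        φ.residueAssignment (2 * (a * (t * t) + 1) + 1) t p Y i = y i := by
  classical
  obtain ⟨p, hp0, hpQ, hinj⟩ := exists_injOn_mod V a t hV ht
  -- False variables, and the padding of `L` to length `t`, are represented by `p`: a legal digit
  -- since `p < Q`, but never a residue modulo `p`.
  obtain ⟨g, hg⟩ : ∃ g : ℕ → ℕ, g = fun v => if ∃ i : Fin φ.u, i.val = v ∧ y i = true then v % p else p :=
    ⟨_, rfl⟩
  obtain ⟨L, hL⟩ : ∃ L : List ℕ, L = V.toList.map g ++ List.replicate (t - V.card) p := ⟨_, rfl⟩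
  have hlen : L.length = t := by
    rw [hL, List.length_append, List.length_map, Finset.length_toList, List.length_replicate]
    omega
  have hmem : ∀ z ∈ L, z = p ∨ ∃ v ∈ V, (∃ i : Fin φ.u, i.val = v ∧ y i = true) ∧ z = v % p := by
    intro z hz
    rw [hL, List.mem_append] at hz
    rcases hz with hz | hz
    · obtain ⟨v, hv, rfl⟩ := List.mem_map.1 hz
      rw [hg]
      dsimp only
      split_ifs with h
      · exact .inr ⟨v, Finset.mem_toList.1 hv, h, rfl⟩
      · exact .inl rfl
    · exact .inl (List.eq_of_mem_replicate hz)
  obtain ⟨Y, hY, hdig⟩ := exists_digits L (Q := 2 * (a * (t * t) + 1) + 1) (by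
    intro z hz
    rcases hmem z hz with rfl | ⟨v, _, _, rfl⟩
    · exact hpQ
    · exact (Nat.mod_lt _ (by omega)).trans hpQ)
  rw [hlen] at hY
  refine ⟨p, hpQ, hp0, Y, hY, fun i hi => ?_⟩
  rw [residueAssignment, Bool.eq_iff_iff, decide_eq_true_iff]
  constructor
  · rintro ⟨j, hj, h⟩
    rw [hdig j (hlen.symm ▸ hj)] at h
    have hlt : i.val % p < p := Nat.mod_lt _ (by omega)
    rcases hmem _ (List.getElem_mem (hlen.symm ▸ hj)) with h' | ⟨v, hv, ⟨i', rfl, hy'⟩, h'⟩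
    · omega
    · have := hinj (Finset.mem_coe.2 hi) (Finset.mem_coe.2 hv) (h.symm.trans h')
      rwa [Fin.ext this]
  · intro hyi
    have hiL : i.val % p ∈ L := by
      rw [hL, List.mem_append]
      refine .inl (List.mem_map.2 ⟨i.val, Finset.mem_toList.2 hi, ?_⟩)
      rw [hg]
      exact if_pos ⟨i, rfl, hyi⟩
    obtain ⟨j, hj, h⟩ := List.mem_iff_getElem.1 hiL
    exact ⟨j, hlen ▸ hj, (hdig j hj).trans h⟩

theorem isCNF_width : φ.IsCNF (width φ.encode) := fun _ hc => φ.length_le_width hc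

theorem length_encode_ge : φ.u + φ.k ≤ φ.encode.length := by
  rw [encode_eq, List.length_append, prefixCode, List.length_append, List.length_replicate,
    List.length_replicate]
  omega

theorem refutes_of_not_isTrue (h : ¬ φ.IsTrue) (hk : 0 < φ.k) :
    Refutes φ.encode φ.k (base φ.encode) (budget φ.encode) := by
  rw [not_isTrue_iff] at h
  obtain ⟨y, hy⟩ := h
  obtain ⟨V, hcard, hVu, hV⟩ := φ.exists_support φ.isCNF_width hy
  have hge := φ.length_encode_ge
  -- As `k` is positive the word is nonempty; its length, and hence every universal index, is below
  -- `2 ^ numBits`.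
  have hbits := lt_two_pow_numBits φ.encode (by
    intro h
    rw [h] at hge
    simp at hge
    omega)
  have hbud : budget φ.encode
      = width φ.encode * (2 * φ.k + 1) ^ (width φ.encode - 1) := by
    rw [budget, numEx_encode]
  rw [← hbud] at hcard
  obtain ⟨p, hp, hp0, Y, hY, hres⟩ := φ.exists_residueAssignment (a := numBits φ.encode)
    (fun v hv => by have := hVu v hv; omega) hcard y
  rw [refutes_encode]
  refine ⟨p, hp, hp0, Y, hY, fun X _ hsat => ?_⟩
  obtain ⟨c, hc, hcx⟩ := hV _ hres (φ.digitAssignment X)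
  obtain ⟨l, hl, hlx⟩ := hsat c hc
  exact hcx l hl hlx

/-- Both tests are sound without any guard. For completeness the search settles `k, width ≥ 2`, and
the clash test settles the cases where the guard fails. -/
theorem holds_isFalse_encode : Expr.Holds φ.encode Expr.isFalse [] ↔ ¬ φ.IsTrue := by
  rw [Expr.holds_isFalse, hasClash_encode, numEx_encode]
  constructor
  · rintro (h | ⟨_, h⟩)
    · exact φ.not_isTrue_of_clash h
    · exact φ.not_isTrue_of_refutes h
  · intro h
    by_cases hk : 2 ≤ φ.k ∧ 2 ≤ width φ.encode
    · exact .inr ⟨hk, φ.refutes_of_not_isTrue h (by omega)⟩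
    · refine .inl (φ.clash_of_not_isTrue h ?_)
      by_cases hk1 : φ.k ≤ 1
      · exact .inl hk1
      · refine .inr fun c hc => ?_
        have := φ.length_le_width hc
        omega

end ForallExistsQBF

/-! ### The running time -/

/-- Raise `a ≤ t * 2 ^ (a / t)` to the power `t`. With `a` logarithmic in the input length, the last
factor is polynomial, which makes the hashing affordable. -/
theorem pow_le_pow_self_mul_two_pow (a : ℕ) {t : ℕ} (ht : 0 < t) : a ^ t ≤ t ^ t * 2 ^ a := by
  have h1 : a ≤ t * 2 ^ (a / t) := by
    calc a ≤ t * (a / t + 1) := (Nat.lt_mul_div_succ a ht).le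
      _ ≤ t * 2 ^ (a / t) := Nat.mul_le_mul_left _ Nat.lt_two_pow_self
  calc a ^ t ≤ (t * 2 ^ (a / t)) ^ t := Nat.pow_le_pow_left h1 t
    _ = t ^ t * 2 ^ (a / t * t) := by rw [mul_pow, ← pow_mul]
    _ ≤ t ^ t * 2 ^ a :=
      Nat.mul_le_mul_left _ (Nat.pow_le_pow_right (by omega) (Nat.div_mul_le_self a t))

namespace ForallExistsQBF

variable (φ : ForallExistsQBF)

theorem length_encodeLiteral_le (l : QLiteral φ.u φ.k) :
    (encodeLiteral l).length ≤ φ.size + 1 := by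
  rw [encodeLiteral_eq, size]
  obtain ⟨i | j, b⟩ := l <;>
    simp only [List.length_cons, List.length_replicate, varIndex, Sum.elim_inl, Sum.elim_inr] <;>
    omega

/-- Unary indices lengthen each literal by at most the size of the formula, so the code is at most
quadratic. -/
theorem length_encode_le : φ.encode.length ≤ 4 * φ.size ^ 2 := by
  have hclause : ∀ c : List (QLiteral φ.u φ.k),
      (encodeClause c).length ≤ (c.length + 1) * (φ.size + 1) := by
    intro c
    rw [encodeClause, List.length_append, List.length_flatMap]
    have := List.sum_le_card_nsmul (c.map fun l => (encodeLiteral l).length) (φ.size + 1) (by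
      intro x hx
      obtain ⟨l, _, rfl⟩ := List.mem_map.1 hx
      exact φ.length_encodeLiteral_le l)
    rw [List.length_map, smul_eq_mul] at this
    rw [Nat.add_mul]
    simp only [List.length_singleton]
    omega
  have hmatrix : (φ.matrix.flatMap encodeClause).length
      ≤ (φ.matrix.map fun c => c.length + 1).sum * (φ.size + 1) := by
    rw [List.length_flatMap, ← List.sum_map_mul_right]
    exact List.sum_le_sum fun c _ => hclause c
  have hlen : φ.encode.length = φ.u + φ.k + (φ.matrix.flatMap encodeClause).length := by
    rw [encode_eq, prefixCode]
    simp [Nat.add_assoc]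
  have hs : φ.size = 1 + φ.u + φ.k + (φ.matrix.map fun c => c.length + 1).sum := rfl
  have h1 : (φ.matrix.map fun c => c.length + 1).sum * (φ.size + 1) ≤ φ.size * (φ.size + 1) :=
    Nat.mul_le_mul_right _ (by omega)
  have h2 : φ.size ≤ φ.size * φ.size := Nat.le_mul_self _
  have h3 : φ.size * (φ.size + 1) = φ.size * φ.size + φ.size := Nat.mul_succ _ _
  rw [pow_two]
  omega

theorem size_pos : 0 < φ.size := by
  rw [size]
  omega

/-- The exponent is `budget + 1` because divisions of `Y` cost another factor `base`. Bounding the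
exponent by `2 * T` and the base by `5 * a * T ^ 2` leaves `(a ^ T) ^ 2`, which is at most `(T ^ T *
(2 * w.length)) ^ 2`. -/
theorem base_pow_le {w : List QSymbol} (ha : 0 < numBits w) (hT : 0 < budget w) (hw : w ≠ []) :
    base w ^ (budget w + 1) ≤ (25 * budget w ^ 6) ^ budget w * (4 * w.length ^ 2) := by
  set T := budget w with hTdef
  set a := numBits w with hadef
  have hbase : base w ≤ 5 * a * T ^ 2 := by
    have h1 : 1 ≤ a * (T * T) := Nat.mul_pos ha (Nat.mul_pos hT hT)
    have h2 : base w = 2 * (a * (T * T) + 1) + 1 := rfl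
    have h3 : 5 * a * T ^ 2 = 5 * (a * (T * T)) := by ring
    omega
  have hpow := pow_le_pow_self_mul_two_pow a hT
  have hbits := two_pow_numBits_le w hw
  have hbase0 : 0 < base w := Nat.succ_pos _
  calc base w ^ (T + 1) ≤ base w ^ (2 * T) := Nat.pow_le_pow_right hbase0 (by omega)
    _ ≤ (5 * a * T ^ 2) ^ (2 * T) := Nat.pow_le_pow_left hbase _
    _ = (25 * T ^ 4) ^ T * (a ^ T) ^ 2 := by
      rw [pow_mul, ← pow_mul a, Nat.mul_comm T 2, pow_mul a, ← mul_pow]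
      congr 1
      ring
    _ ≤ (25 * T ^ 4) ^ T * (T ^ T * (2 * w.length)) ^ 2 :=
      Nat.mul_le_mul_left _ (Nat.pow_le_pow_left (hpow.trans (Nat.mul_le_mul_left _ hbits)) _)
    _ = (25 * T ^ 6) ^ T * (4 * w.length ^ 2) := by
      have : (25 * T ^ 6) ^ T = (25 * T ^ 4) ^ T * (T ^ T) ^ 2 := by
        rw [← pow_mul T, Nat.mul_comm T 2, pow_mul T, ← mul_pow]
        congr 1
        ring
      rw [this]
      ring

/-- The constant in the exponent of the running time. -/
def exponentConst (d : ℕ) : ℕ :=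
  (25 * (d * 3 ^ (d - 1)) ^ 6 + 6 * (d - 1)) * (d * 3 ^ (d - 1)) + 1

/-- Since `k ≥ 2`, a constant `m` is at most `k ^ m`, so constants move into the exponent. Since `d
≥ 2`, the exponent `k` in `2 ^ k` is at most `k ^ (d - 1)`, so the brute force over `x` is absorbed.
-/
theorem pow_budget_le {d k T : ℕ} (hd : 2 ≤ d) (hk : 2 ≤ k) (hT : T ≤ d * 3 ^ (d - 1) * k ^ (d - 1)) :
    (25 * T ^ 6) ^ T * 2 ^ (k + 2) ≤ 4 * k ^ (exponentConst d * k ^ (d - 1)) := by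
  rw [exponentConst]
  set g := d * 3 ^ (d - 1) with hg
  have hgpos : 0 < g := by positivity
  have hkpos : 0 < k := by omega
  have hgk : 0 < g * k ^ (d - 1) := by positivity
  have h1 : 25 * g ^ 6 ≤ k ^ (25 * g ^ 6) :=
    (Nat.lt_two_pow_self).le.trans (Nat.pow_le_pow_left hk _)
  have h2 : (25 * T ^ 6) ^ T ≤ k ^ ((25 * g ^ 6 + 6 * (d - 1)) * (g * k ^ (d - 1))) := by
    calc (25 * T ^ 6) ^ T ≤ (25 * (g * k ^ (d - 1)) ^ 6) ^ T :=
          Nat.pow_le_pow_left (Nat.mul_le_mul_left _ (Nat.pow_le_pow_left hT _)) _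
      _ ≤ (25 * (g * k ^ (d - 1)) ^ 6) ^ (g * k ^ (d - 1)) :=
          Nat.pow_le_pow_right (by positivity) hT
      _ ≤ (k ^ (25 * g ^ 6 + 6 * (d - 1))) ^ (g * k ^ (d - 1)) := by
          refine Nat.pow_le_pow_left ?_ _
          rw [mul_pow, ← Nat.mul_assoc, ← pow_mul, pow_add, Nat.mul_comm (d - 1) 6]
          exact Nat.mul_le_mul_right _ h1
      _ = _ := by rw [← pow_mul]
  have h3 : 2 ^ k ≤ k ^ k ^ (d - 1) := by
    calc 2 ^ k ≤ k ^ k := Nat.pow_le_pow_left hk _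
      _ ≤ k ^ k ^ (d - 1) := Nat.pow_le_pow_right hkpos (by
        calc k = k ^ 1 := (pow_one k).symm
          _ ≤ k ^ (d - 1) := Nat.pow_le_pow_right hkpos (by omega))
  calc (25 * T ^ 6) ^ T * 2 ^ (k + 2)
      ≤ k ^ ((25 * g ^ 6 + 6 * (d - 1)) * (g * k ^ (d - 1))) * (k ^ k ^ (d - 1) * 4) := by
        rw [pow_add]
        exact Nat.mul_le_mul h2 (Nat.mul_le_mul_right _ h3)
    _ = 4 * k ^ (((25 * g ^ 6 + 6 * (d - 1)) * g + 1) * k ^ (d - 1)) := by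
        have e : ((25 * g ^ 6 + 6 * (d - 1)) * g + 1) * k ^ (d - 1)
            = (25 * g ^ 6 + 6 * (d - 1)) * (g * k ^ (d - 1)) + k ^ (d - 1) := by ring
        rw [e, pow_add, Nat.mul_comm _ 4, Nat.mul_left_comm]

theorem budget_le {d : ℕ} (hφ : φ.IsCNF d) (hk : 1 ≤ φ.k) :
    budget φ.encode ≤ d * 3 ^ (d - 1) * φ.k ^ (d - 1) := by
  have hw := φ.width_le_of_isCNF hφ
  rw [budget, numEx_encode, Nat.mul_assoc, ← mul_pow]
  calc width φ.encode * (2 * φ.k + 1) ^ (width φ.encode - 1)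
      ≤ d * (2 * φ.k + 1) ^ (d - 1) :=
        Nat.mul_le_mul hw (Nat.pow_le_pow_right (by omega) (by omega))
    _ ≤ d * (3 * φ.k) ^ (d - 1) :=
        Nat.mul_le_mul_left _ (Nat.pow_le_pow_left (by omega) _)

/-- A bound on the values that occur while the decision procedure runs. -/
theorem exists_bound {d : ℕ} (hφ : φ.IsCNF d) : ∃ B, φ.encode.length ≤ B ∧ 1 ≤ B ∧
    Expr.Bdd φ.encode B Expr.isFalse [] ∧
    B + 2 ≤ 1024 * max φ.k 1 ^ (exponentConst d * φ.k ^ (d - 1)) * φ.size ^ 6 := by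
  have hs := φ.size_pos
  have hlen := φ.length_encode_le
  have hwd := φ.width_le_of_isCNF hφ
  have hpow1 : 1 ≤ max φ.k 1 ^ (exponentConst d * φ.k ^ (d - 1)) :=
    Nat.one_le_pow _ _ (by omega)
  by_cases hg : 2 ≤ φ.k ∧ 2 ≤ width φ.encode
  · obtain ⟨hk, hD⟩ := hg
    have hge := φ.length_encode_ge
    have hL : 2 ≤ φ.encode.length := by omega
    have hne : φ.encode ≠ [] := by
      intro h
      rw [h] at hL
      simp at hL
    have hk' := φ.numEx_encode
    set w := φ.encode with hwdef
    have ha : 0 < numBits w := by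
      have := lt_two_pow_numBits w hne
      rcases Nat.eq_zero_or_pos (numBits w) with h | h
      · rw [h] at this
        omega
      · exact h
    have hT : 0 < budget w := by
      rw [budget]
      positivity
    have hbase : base w = 2 * (numBits w * (budget w * budget w) + 1) + 1 := rfl
    have hTT : budget w * budget w ≤ base w := by
      have : 1 * (budget w * budget w) ≤ numBits w * (budget w * budget w) :=
        Nat.mul_le_mul_right _ ha
      omega
    have hb0 : 3 ≤ base w := by omega
    have hbT : base w ≤ base w ^ (budget w + 1) := by
      calc base w = base w ^ 1 := (pow_one _).symm
        _ ≤ _ := Nat.pow_le_pow_right (by omega) (by omega)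
    set P := base w ^ (budget w + 1) with hP
    have h8 : 8 ≤ 2 ^ (φ.k + 1) := by
      calc 8 = 2 ^ 3 := rfl
        _ ≤ _ := Nat.pow_le_pow_right (by omega) (by omega)
    have hLP : w.length * P ≤ w.length * P * 2 ^ (φ.k + 1) := Nat.le_mul_of_pos_right _ (by omega)
    have hPL : P ≤ w.length * P := Nat.le_mul_of_pos_left _ (by omega)
    have hbig : w.length * 3 * 8 ≤ w.length * P * 2 ^ (φ.k + 1) :=
      Nat.mul_le_mul (Nat.mul_le_mul_left _ (by omega)) h8
    -- The product of the length, the bound on candidates `Y` and the bound on candidates `X`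
    -- dominates each quantity required separately.
    refine ⟨w.length * P * 2 ^ (φ.k + 1), by omega, by omega, ?_, ?_⟩
    · refine Expr.bdd_isFalse (by omega) fun _ _ => ⟨by omega, ?_, ?_, ?_, by omega⟩
      · rw [hk', ← pow_succ]
        exact Nat.le_mul_of_pos_left _ (Nat.mul_pos (by omega) (by omega))
      · rw [← pow_succ]
        omega
      · exact (Nat.mul_le_mul_left _ hbT).trans hLP
    · have hmax : max φ.k 1 = φ.k := by omega
      have h1 := base_pow_le ha hT hne
      have h2 := pow_budget_le (hD.trans hwd) hk (φ.budget_le hφ (by omega))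
      rw [hmax]
      have hL3 : w.length ^ 3 ≤ (4 * φ.size ^ 2) ^ 3 := Nat.pow_le_pow_left hlen 3
      calc w.length * P * 2 ^ (φ.k + 1) + 2 ≤ w.length * P * 2 ^ (φ.k + 1) * 2 := by omega
        _ = w.length * P * 2 ^ (φ.k + 2) := by rw [pow_succ 2 (φ.k + 1)]; ring
        _ ≤ w.length * ((25 * budget w ^ 6) ^ budget w * (4 * w.length ^ 2)) * 2 ^ (φ.k + 2) :=
          Nat.mul_le_mul_right _ (Nat.mul_le_mul_left _ h1)
        _ = 4 * w.length ^ 3 * ((25 * budget w ^ 6) ^ budget w * 2 ^ (φ.k + 2)) := by ring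
        _ ≤ 4 * (4 * φ.size ^ 2) ^ 3 * (4 * φ.k ^ (exponentConst d * φ.k ^ (d - 1))) :=
          Nat.mul_le_mul (Nat.mul_le_mul_left _ hL3) h2
        _ = 1024 * φ.k ^ (exponentConst d * φ.k ^ (d - 1)) * φ.size ^ 6 := by ring
  -- The guard fails, the search is skipped, and all values are linear in the length.
  · refine ⟨2 * φ.encode.length + 2, by omega, by omega, ?_, ?_⟩
    · refine Expr.bdd_isFalse (by omega) fun h1 h2 => absurd ⟨?_, h2⟩ hg
      rwa [numEx_encode] at h1
    · have h1 : φ.size ^ 2 ≤ φ.size ^ 6 := Nat.pow_le_pow_right hs (by omega)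
      have h2 : 1 ≤ φ.size ^ 2 := Nat.one_le_pow _ _ hs
      have h3 : 1024 * φ.size ^ 6
          ≤ 1024 * max φ.k 1 ^ (exponentConst d * φ.k ^ (d - 1)) * φ.size ^ 6 :=
        Nat.mul_le_mul_right _ (by omega)
      omega

end ForallExistsQBF

/-- There is a single algorithm (a Turing machine) that decides the truth of every `∀∃`-formula
`φ` with CNF matrix and that runs in time `O(k ^ (O_d(k ^ (d - 1)))) * |φ| ^ O(1)` whenever the
matrix is a `d`-CNF, where `k` is the number of existential variables. The constants `A` and `c`
are absolute, and `C` depends only on `d`. For `k = 0` the base of the power is read as `1`. -/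
theorem theorem3 :
    ∃ (M : Turing.TM2ComputableAux QSymbol Bool) (A c : ℕ),
      ∀ d : ℕ, 1 ≤ d → ∃ C : ℕ, ∀ φ : ForallExistsQBF, φ.IsCNF d →
        DecidesWithin M φ (A * max φ.k 1 ^ (C * φ.k ^ (d - 1)) * φ.size ^ c) := by
  obtain ⟨c, hc⟩ := Expr.exec_decider Expr.isFalse
  -- The time is the `c`-th power of the bound on values, where `c` depends only on the fixed
  -- expression; so each factor is raised to the power `c`.
  refine ⟨(Expr.decider Expr.isFalse).machine, 1024 ^ c, 6 * c, fun d _ =>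
    ⟨ForallExistsQBF.exponentConst d * c, fun φ hφ => ?_⟩⟩
  obtain ⟨B, hlen, hB, hbdd, hle⟩ := φ.exists_bound hφ
  have hval : Expr.eval φ.encode Expr.isFalse [] ≤ 1 := by
    classical
    rw [Expr.isFalse, Expr.or, Expr.eval_not]
    split_ifs <;> omega
  obtain ⟨t, ht, hexec⟩ := hc φ.encode B hlen hB hbdd hval
  refine ⟨decide (Expr.eval φ.encode Expr.isFalse [] = 0), ?_, Prog.outputs_of_exec hexec ?_⟩
  · have := φ.holds_isFalse_encode
    rw [Expr.Holds] at this
    rw [decide_eq_true_iff]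
    tauto
  · refine ht.trans ((Nat.pow_le_pow_left hle c).trans (le_of_eq ?_))
    rw [mul_pow, mul_pow, ← pow_mul, ← pow_mul]
    congr 3
    ring
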